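/- **Setting.** Let $\mathbb N=\{1,2,\dots\}$, $\mathbb N_0=\mathbb N\cup\{0\}$, $n,d\in\mathbb N$ and $m,q\in\mathbb N_0$. Let $\mathbb X,\mathbb W\subseteq\mathbb R^n$, $\mathbb U\subseteq\mathbb R^m$, $\mathbb S\subseteq\mathbb R^q$, $f:\mathbb X\times\mathbb U\to\mathbb R^n$, $\psi:\mathbb X\times\mathbb U\to\mathbb R^d$, $\alpha:\mathbb X\times\mathbb S\times\mathbb R^{d\times n}\to\mathbb U$, $\theta_*,\vartheta_0\in\mathbb R^{d\times n}$ and $\gamma>0$. Put $g(x,u,w)=f(x,u)+\theta_*^\top\psi(x,u)+w$ and suppose that $g(x,u,w)\in\mathbb X$ for all $x\in\mathbb X$, $u\in\mathbb U$, $w\in\mathbb W$. $|\cdot|$ is the Euclidean norm of vectors and the induced 2-norm of matrices, $|\cdot|_F$ the Frobenius norm, and $B_r(\cdot)$ a closed ball for $|\cdot|$. On a probability space, random variables $W(t)$ ($t\in\mathbb N$) and $S(t)$ ($t\in\mathbb N_0$) take values in $\mathbb W$ and $\mathbb S$. The closed loop started at $x_0$ is $X(0)=x_0$, $$X(t+1)=g(X(t),U(t),W(t+1)),\qquad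 U(t)=\alpha(X(t),S(t),\hat\theta(t-1)),\qquad t\in\mathbb N_0,$$ where $\hat\theta(-1)=\hat\theta(0)=\vartheta_0$ and, for $t\in\mathbb N$, $\hat\theta(t)$ is the minimiser over $\theta\in\mathbb R^{d\times n}$ of $$\sum_{s=1}^t\big|X(s)-\theta^\top\psi(X(s-1),U(s-1))-f(X(s-1),U(s-1))\big|^2+\gamma|\theta|_F^2 .$$ Functions $[0,\infty)\to[0,\infty)$: $h\in\mathcal K_\infty$ means that $h$ is continuous, strictly increasing, unbounded and $h(0)=0$; $h\in\mathcal K_\infty^{k\text{-SE}}$ means in addition $\ln h(r^k)=o(r)$ as $r\to\infty$. **Assumptions.** 1. $f,\psi,\alpha$ are Borel measurable. 2. $W(1),W(2),\dots$ are i.i.d. with law $\mu_w$; $S(0),S(1),\dots$ are i.i.d. with law $\mu_s$; the two sequences are independent; for some $\sigma_w\ge0$, $W(t)$ is zero-mean and $\mathbb E\exp(\lambda\zeta^\top W(t))\le\exp(\lambda^2\sigma_w^2/2)$ for all $\lambda\in\mathbb R$ and unit vectors $\zeta\in\mathbb R^n$. 3. There are $\chi_1,\chi_3,\sigma_2\in\mathcal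 K_\infty^{1\text{-SE}}$, $\chi_4\in\mathcal K_\infty^{2\text{-SE}}$, $\chi_2,\sigma_1\in\mathcal K_\infty$ and $c_1\ge0$ such that for all $t\in\mathbb N_0$, $\xi\in\mathbb X$, $u(0),\dots,u(t-1)\in\mathbb U$ and $w(1),\dots,w(t)\in\mathbb W$, the solution $x(t)$ at time $t$ of $x(0)=\xi$, $x(i+1)=g(x(i),u(i),w(i+1))$ satisfies $$|x(t)|\le\chi_1(t)+\chi_2(|\xi|)+\chi_3\Big(\sum_{i=0}^{t-1}\sigma_1(|u(i)|)\Big)+\chi_4\Big(\sum_{i=1}^{t}\sigma_2(|w(i)|)\Big)+c_1 .$$ 4. There is $u_{\max}\ge0$ with $|\alpha(x,s,\vartheta)|\le u_{\max}$ for all $x\in\mathbb X$, $s\in\mathbb S$, $\vartheta\in\mathbb R^{d\times n}$. 5. There is a non-decreasing $\chi_5:[0,\infty)\to[0,\infty)$ with $\chi_5(r)=O(r^k)$ as $r\to\infty$ for some $k\in\mathbb N_0$, such that $|\psi(x,u)|\le\chi_5\big(\sqrt{|x|^2+|u|^2}\big)$ for all $x\in\mathbb X$, $u\in\mathbb U$.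 6. (Regional excitation) There are $\mathcal X_{\rm PE}\subseteq\mathbb X$ and $c_{\rm PE},p_{\rm PE}>0$ such that for all $\vartheta\in\mathbb R^{d\times n}$, $x\in\mathcal X_{\rm PE}$ and unit vectors $\zeta\in\mathbb R^d$, with $(s,w)$ distributed as $\mu_s\times\mu_w$, the probability that $x+w\in\mathbb X$ and $|\zeta^\top\psi(x+w,\alpha(x+w,s,\vartheta))|^2\ge c_{\rm PE}$ is at least $p_{\rm PE}$. 7. (RPI set) There are $\mathcal X_{\rm RPI}\subseteq\mathbb X$ and $\bar\vartheta>0$ such that $g(x,\alpha(x,s,\vartheta),w)\in\mathcal X_{\rm RPI}$ for all $x\in\mathcal X_{\rm RPI}$, $w\in\mathbb W$, $s\in\mathbb S$ and $\vartheta\in B_{\bar\vartheta}(\theta_*)$, and such that $g(x,u,0)\in\mathcal X_{\rm PE}$ for all $x\in\mathcal X_{\rm RPI}$ and $u\in\mathbb U$ with $|u|\le u_{\max}$. **Bounds.** Let $\overline w(0,\delta)=0$, $\overline w(t,\delta)=\sigma_w\sqrt{2n\ln\frac{n\pi^2t^2}{3\delta}}$ for $t\in\mathbb N$, and $$\overline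 x(t,\delta,x_0)=\chi_1(t)+\chi_2(|x_0|)+\chi_3(t\sigma_1(u_{\max}))+\chi_4(t\sigma_2(\overline w(t,\delta)))+c_1,$$ $$\overline z(t,\delta,x_0)=\chi_5\Big(\sqrt{\overline x(t-1,\delta,x_0)^2+u_{\max}^2}\Big),\qquad \beta_{\max}(t,\delta,x_0)=\sum_{i=1}^t\overline z(i,\delta,x_0)^2+\gamma,$$ $$e(t,\delta,x_0)=\frac{\gamma^{1/2}|\theta_*|_F+\sigma_w\sqrt{2n\big(\ln(3n/\delta)+\tfrac d2\ln(\beta_{\max}(t,\delta/3,x_0)\gamma^{-1})\big)}}{\sqrt{\tfrac{c_{\rm PE}p_{\rm PE}}4(t-1)+\gamma}},\qquad t\in\mathbb N .$$ With suprema and infima taken in $\mathbb N_0\cup\{\infty\}$ ($\sup\emptyset=0$, $\inf\emptyset=\infty$), let $$T_{\rm contained}(\delta,x_0)=\sup\{T\in\mathbb N: B_{\overline x(T,\delta/3,x_0)}(0)\cap\mathbb X\subseteq\mathcal X_{\rm RPI}\},$$ let $T_{\text{burn-in}}(\delta,x_0)$ be the infimum of the $T\in\mathbb N$ such that for all $t\ge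 T$ $$t\ \ge\ \frac{2}{(1-\ln2)p_{\rm PE}}\Big(d\ln\Big(1+\frac{16\sum_{i=1}^t\overline z(i,\delta/3,x_0)^2}{c_{\rm PE}p_{\rm PE}(t-1)}\Big)+\ln\frac{\pi^2(t-T+1)^2}{2\delta}\Big)+1$$ (this is taken to fail at $t=1$), and $$T_{\rm converge}(\delta,x_0)=\max\big(T_{\text{burn-in}}(\delta,x_0),\ \inf\{T\in\mathbb N: e(t,\delta,x_0)\le\bar\vartheta\ \ \forall t\ge T\}\big).$$ **Theorem.** Under these assumptions, for every $x_0\in\mathcal X_{\rm RPI}$ and $\delta\in(0,1)$: if $T_{\rm converge}(\delta,x_0)+1\le T_{\rm contained}(\delta,x_0)$, then, for the closed loop started at $x_0$, $$\mathbb P\Big(|\hat\theta(t)-\theta_*|\le e(t,\delta,x_0)\ \ \forall t\ge T_{\text{burn-in}}(\delta,x_0)\ \text{ and }\ X(t)\in\mathcal X_{\rm RPI}\ \ \forall t\ge0\Big)\ge1-\delta$$ (if $\mathcal X_{\rm RPI}$ is not Borel, this means that the event contains a measurable set of probability at least $1-\delta$). Moreover, for all $x_0\in\mathcal X_{\rm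 RPI}$ and $\delta\in(0,1)$, whether or not that condition holds, (1) $\lim_{t\to\infty}e(t,\delta,x_0)=0$, (2) $T_{\text{burn-in}}(\delta,x_0)<\infty$, (3) $T_{\rm converge}(\delta,x_0)<\infty$. -/

import Mathlib

open MeasureTheory ProbabilityTheory Filter Topology Asymptotics Set
open scoped NNReal ENNReal Matrix

noncomputable section

namespace AdaptiveControl

/-- `ℝⁿ` with the Euclidean norm. -/
abbrev Vec (n : ℕ) : Type := EuclideanSpace ℝ (Fin n)

/-- Parameters: real `d × n` matrices. -/
abbrev Param (d n : ℕ) : Type := Matrix (Fin d) (Fin n) ℝ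

/-- Borel structure on matrices (entrywise, i.e. that of `ℝ^(d × n)`). -/
instance instMeasurableSpaceParam (d n : ℕ) : MeasurableSpace (Param d n) :=
  inferInstanceAs (MeasurableSpace (Fin d → Fin n → ℝ))

/-- Induced 2-norm of a matrix. -/
def specNorm {d n : ℕ} (A : Param d n) : ℝ :=
  ‖LinearMap.toContinuousLinearMap (Matrix.toEuclideanLin A)‖

/-- Frobenius norm of a matrix. -/
def frobNorm {d n : ℕ} (A : Param d n) : ℝ :=
  Real.sqrt (∑ i, ∑ j, A i j ^ 2)

/-- `θᵀ z` for `θ ∈ ℝ^(d × n)` and `z ∈ ℝ^d`. -/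
def applyT {d n : ℕ} (θ : Param d n) (z : Vec d) : Vec n :=
  Matrix.toEuclideanLin θᵀ z

/-! ### Comparison functions (functions on `[0, ∞)`; values at negative reals are irrelevant) -/

/-- Class `𝒦_∞`. -/
structure IsKInf (h : ℝ → ℝ) : Prop where
  continuousOn : ContinuousOn h (Ici 0)
  strictMonoOn : StrictMonoOn h (Ici 0)
  map_zero : h 0 = 0
  tendsto : Tendsto h atTop atTop

/-- `h` is `k`-order sub-exponential: `ln (h (r ^ k)) = o(r)` as `r → ∞`. -/
def IsSubExp (k : ℕ) (h : ℝ → ℝ) : Prop :=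
  (fun r : ℝ => Real.log (h (r ^ k))) =o[atTop] (fun r : ℝ => r)

/-- Class `𝒦_∞^{k-SE}`. -/
def IsKInfSE (k : ℕ) (h : ℝ → ℝ) : Prop := IsKInf h ∧ IsSubExp k h

/-- `h : [0, ∞) → [0, ∞)` is asymptotically polynomially bounded. -/
def IsAPB (h : ℝ → ℝ) : Prop :=
  (∀ r, 0 ≤ r → 0 ≤ h r) ∧ ∃ k : ℕ, h =O[atTop] (fun r : ℝ => r ^ k)

/-! ### System, policy, estimator -/

/-- The data of the controlled system and of the adaptive controller. The maps `f`, `ψ`, `α` matter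
only on `𝕏 × 𝕌`, `𝕏 × 𝕌` and `𝕏 × 𝕊 × ℝ^(d × n)`; they are written as total functions for
convenience, and nothing is required of their values elsewhere. -/
structure Sys (n m q d : ℕ) where
  /-- state space -/
  𝕏 : Set (Vec n)
  /-- control space -/
  𝕌 : Set (Vec m)
  /-- set of values of the process noise -/
  𝕎 : Set (Vec n)
  /-- set of values of the exploratory noise -/
  𝕊 : Set (Vec q)
  /-- nominal model -/
  f : Vec n → Vec m → Vec n
  /-- basis functions -/
  ψ : Vec n → Vec m → Vec d
  /-- control policy -/
  α : Vec n → Vec q → Param d n → Vec m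
  /-- true parameter -/
  θstar : Param d n
  /-- initial estimate -/
  ϑ₀ : Param d n
  /-- regularisation parameter -/
  γ : ℝ

namespace Sys

variable {n m q d : ℕ}

/-- `g(x, u, w) = f(x, u) + θ_*ᵀ ψ(x, u) + w`. -/
def g (sys : Sys n m q d) (x : Vec n) (u : Vec m) (w : Vec n) : Vec n :=
  sys.f x u + applyT sys.θstar (sys.ψ x u) + w

/-- The maps have the stated codomains (`g` maps into `𝕏`, `α` into `𝕌`), and `γ > 0`. -/
structure WellPosed (sys : Sys n m q d) : Prop where
  g_mem : ∀ x ∈ sys.𝕏, ∀ u ∈ sys.𝕌, ∀ w ∈ sys.𝕎, sys.g x u w ∈ sys.𝕏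
  α_mem : ∀ x ∈ sys.𝕏, ∀ s ∈ sys.𝕊, ∀ ϑ, sys.α x s ϑ ∈ sys.𝕌
  γ_pos : 0 < sys.γ

/-- `f`, `ψ`, `α` are Borel measurable on their domains. -/
structure MeasurableMaps (sys : Sys n m q d) : Prop where
  f : Measurable (fun p : sys.𝕏 × sys.𝕌 => sys.f p.1 p.2)
  ψ : Measurable (fun p : sys.𝕏 × sys.𝕌 => sys.ψ p.1 p.2)
  α : Measurable (fun p : sys.𝕏 × sys.𝕊 × Param d n => sys.α p.1 p.2.1 p.2.2)

/-- The deterministic solution `φ(t, ξ, u, w)`; it uses only `u 0, …, u (t-1)` and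
`w 1, …, w t`. -/
def φ (sys : Sys n m q d) (ξ : Vec n) (u : ℕ → Vec m) (w : ℕ → Vec n) : ℕ → Vec n
  | 0 => ξ
  | t + 1 => sys.g (φ sys ξ u w t) (u t) (w (t + 1))

/-- The regularised least-squares cost
`∑_{s=1}^t |X(s) - θᵀ ψ(X(s-1),U(s-1)) - f(X(s-1),U(s-1))|² + γ |θ|_F²`. -/
def rlsCost (sys : Sys n m q d) (x : ℕ → Vec n) (u : ℕ → Vec m) (t : ℕ) (θ : Param d n) : ℝ :=
  ∑ s ∈ Finset.Icc 1 t,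
      ‖x s - applyT θ (sys.ψ (x (s - 1)) (u (s - 1))) - sys.f (x (s - 1)) (u (s - 1))‖ ^ 2
    + sys.γ * frobNorm θ ^ 2

/-- `X`, `U`, `est` are the states, controls and estimates of the closed loop started at `x₀` and
driven by the noise sequences `W(1), W(2), …` and `S(0), S(1), …` (the value `W 0` is not used).
These equations determine `X`, `U` and `est`, because `γ > 0` makes the least-squares minimiser
exist and be unique. At `t = 0` the index `t - 1` is `0` in `ℕ`, and `est 0 = ϑ₀` is also the
estimate at time `-1`. -/
structure IsClosedLoop {Ω : Type*} (sys : Sys n m q d) (x₀ : Vec n)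
    (W : ℕ → Ω → sys.𝕎) (S : ℕ → Ω → sys.𝕊)
    (X : ℕ → Ω → Vec n) (U : ℕ → Ω → Vec m) (est : ℕ → Ω → Param d n) : Prop where
  init : ∀ ω, X 0 ω = x₀
  step : ∀ t ω, X (t + 1) ω = sys.g (X t ω) (U t ω) (W (t + 1) ω)
  control : ∀ t ω, U t ω = sys.α (X t ω) (S t ω) (est (t - 1) ω)
  est_zero : ∀ ω, est 0 ω = sys.ϑ₀
  est_min : ∀ t, 1 ≤ t → ∀ ω,
    IsMinOn (sys.rlsCost (fun s => X s ω) (fun s => U s ω) t) univ (est t ω)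

end Sys

/-! ### Assumptions -/

/-- Constants and comparison functions of the assumptions. -/
structure Bounds where
  χ₁ : ℝ → ℝ
  χ₂ : ℝ → ℝ
  χ₃ : ℝ → ℝ
  χ₄ : ℝ → ℝ
  χ₅ : ℝ → ℝ
  σ₁ : ℝ → ℝ
  σ₂ : ℝ → ℝ
  c₁ : ℝ
  /-- bound on the controls -/
  uMax : ℝ
  /-- sub-Gaussian parameter of the process noise -/
  σw : ℝ≥0

namespace Sys

variable {n m q d : ℕ}

/-- `W(1), W(2), …` are i.i.d. with law `μw`, zero-mean and `σw²`-sub-Gaussian; `S(0), S(1), …` are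
i.i.d. with law `μs`; the two sequences are independent. -/
structure NoiseAssumption {Ω : Type*} [MeasurableSpace Ω] (P : Measure Ω) (sys : Sys n m q d)
    (W : ℕ → Ω → sys.𝕎) (S : ℕ → Ω → sys.𝕊) (μw : Measure sys.𝕎) (μs : Measure sys.𝕊)
    (σw : ℝ≥0) : Prop where
  measurable_W : ∀ t, 1 ≤ t → Measurable (W t)
  measurable_S : ∀ t, Measurable (S t)
  law_W : ∀ t, 1 ≤ t → P.map (W t) = μw
  law_S : ∀ t, P.map (S t) = μs
  iIndep_W : iIndepFun (fun t : ℕ => W (t + 1)) P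
  iIndep_S : iIndepFun S P
  indep_WS : IndepFun (fun ω (t : ℕ) => W (t + 1) ω) (fun ω (t : ℕ) => S t ω) P
  mean_zero : ∀ t, 1 ≤ t → ∫ ω, (W t ω : Vec n) ∂P = 0
  subgaussian : ∀ t, 1 ≤ t → ∀ ζ : Vec n, ‖ζ‖ = 1 →
    HasSubgaussianMGF (fun ω => inner ℝ ζ (W t ω : Vec n)) (σw ^ 2) P

/-- Sub-exponential input-to-state bound on reachable states. -/
structure ReachAssumption (sys : Sys n m q d) (b : Bounds) : Prop where
  χ₁ : IsKInfSE 1 b.χ₁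
  χ₂ : IsKInf b.χ₂
  χ₃ : IsKInfSE 1 b.χ₃
  χ₄ : IsKInfSE 2 b.χ₄
  σ₁ : IsKInf b.σ₁
  σ₂ : IsKInfSE 1 b.σ₂
  c₁ : 0 ≤ b.c₁
  bound : ∀ t : ℕ, ∀ ξ ∈ sys.𝕏, ∀ (u : ℕ → Vec m) (w : ℕ → Vec n),
    (∀ i < t, u i ∈ sys.𝕌) → (∀ i ∈ Finset.Icc 1 t, w i ∈ sys.𝕎) →
    ‖sys.φ ξ u w t‖ ≤ b.χ₁ t + b.χ₂ ‖ξ‖ + b.χ₃ (∑ i ∈ Finset.range t, b.σ₁ ‖u i‖)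
      + b.χ₄ (∑ i ∈ Finset.Icc 1 t, b.σ₂ ‖w i‖) + b.c₁

/-- Constrained controls. -/
structure ControlAssumption (sys : Sys n m q d) (b : Bounds) : Prop where
  uMax_nonneg : 0 ≤ b.uMax
  bound : ∀ x ∈ sys.𝕏, ∀ s ∈ sys.𝕊, ∀ ϑ, ‖sys.α x s ϑ‖ ≤ b.uMax

/-- Basis functions bounded by a non-decreasing asymptotically polynomially bounded function of the
Euclidean norm `√(|x|² + |u|²)` of the stacked vector. -/
structure BasisAssumption (sys : Sys n m q d) (b : Bounds) : Prop where
  apb : IsAPB b.χ₅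
  mono : MonotoneOn b.χ₅ (Ici 0)
  bound : ∀ x ∈ sys.𝕏, ∀ u ∈ sys.𝕌, ‖sys.ψ x u‖ ≤ b.χ₅ (Real.sqrt (‖x‖ ^ 2 + ‖u‖ ^ 2))

/-- `(ψ, α, μw, μs)` is `(𝒳, c, p)`-regionally excited. The clause `x + w ∈ 𝕏` says that
`ψ(x + w, α(x + w, s, ϑ))` is defined. -/
def RegionallyExcited (sys : Sys n m q d) (μw : Measure sys.𝕎) (μs : Measure sys.𝕊)
    (𝒳 : Set (Vec n)) (c p : ℝ) : Prop :=
  ∀ ϑ : Param d n, ∀ x ∈ 𝒳, ∀ ζ : Vec d, ‖ζ‖ = 1 →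
    ENNReal.ofReal p ≤ (μs.prod μw) {z : sys.𝕊 × sys.𝕎 |
      x + (z.2 : Vec n) ∈ sys.𝕏 ∧
      c ≤ |inner ℝ ζ (sys.ψ (x + z.2) (sys.α (x + z.2) z.1 ϑ))| ^ 2}

/-- One-step predicted reachable set `Γ(𝒳)`. -/
def Γ (sys : Sys n m q d) (uMax : ℝ) (𝒳 : Set (Vec n)) : Set (Vec n) :=
  {y | ∃ x ∈ 𝒳, ∃ u ∈ sys.𝕌, ‖u‖ ≤ uMax ∧ y = sys.g x u 0}

/-- `𝒳` is robustly positive invariant with error constant `ϑbar`. -/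
def IsRPI (sys : Sys n m q d) (𝒳 : Set (Vec n)) (ϑbar : ℝ) : Prop :=
  ∀ x ∈ 𝒳, ∀ w ∈ sys.𝕎, ∀ s ∈ sys.𝕊, ∀ ϑ : Param d n, specNorm (ϑ - sys.θstar) ≤ ϑbar →
    sys.g x (sys.α x s ϑ) w ∈ 𝒳

end Sys

/-! ### The bounds appearing in the result -/

/-- Process noise bound `w̄(t, δ)`. -/
def wBar (n : ℕ) (b : Bounds) (t : ℕ) (δ : ℝ) : ℝ :=
  if t = 0 then 0
  else b.σw * Real.sqrt (2 * n * Real.log (n * Real.pi ^ 2 * (t : ℝ) ^ 2 / (3 * δ)))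

/-- State bound `x̄(t, δ, x₀)`. -/
def xBar {n : ℕ} (b : Bounds) (t : ℕ) (δ : ℝ) (x₀ : Vec n) : ℝ :=
  b.χ₁ t + b.χ₂ ‖x₀‖ + b.χ₃ (t * b.σ₁ b.uMax) + b.χ₄ (t * b.σ₂ (wBar n b t δ)) + b.c₁

/-- Regressor bound `z̄(t, δ, x₀)`, for `t ≥ 1`. -/
def zBar {n : ℕ} (b : Bounds) (t : ℕ) (δ : ℝ) (x₀ : Vec n) : ℝ :=
  b.χ₅ (Real.sqrt (xBar b (t - 1) δ x₀ ^ 2 + b.uMax ^ 2))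

/-- Gramian upper bound `β_max(t, δ, x₀)`. -/
def betaMax {n : ℕ} (b : Bounds) (γ : ℝ) (t : ℕ) (δ : ℝ) (x₀ : Vec n) : ℝ :=
  ∑ i ∈ Finset.Icc 1 t, zBar b i δ x₀ ^ 2 + γ

/-- Estimation error bound `e(t, δ, x₀)`, for `t ≥ 1`. -/
def errBound {n m q d : ℕ} (sys : Sys n m q d) (b : Bounds) (cPE pPE : ℝ)
    (t : ℕ) (δ : ℝ) (x₀ : Vec n) : ℝ :=
  1 / Real.sqrt (cPE * pPE / 4 * ((t : ℝ) - 1) + sys.γ) *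
    (Real.sqrt sys.γ * frobNorm sys.θstar +
      b.σw * Real.sqrt (2 * n * (Real.log (3 * n / δ) +
        (d : ℝ) / 2 * Real.log (betaMax b sys.γ t (δ / 3) x₀ * sys.γ⁻¹))))

/-- Contained time bound (a supremum in `ℕ ∪ {∞}`). -/
def Tcontained {n m q d : ℕ} (sys : Sys n m q d) (b : Bounds) (XRPI : Set (Vec n))
    (δ : ℝ) (x₀ : Vec n) : ℕ∞ :=
  sSup {N : ℕ∞ | ∃ T : ℕ, N = T ∧ 1 ≤ T ∧
    Metric.closedBall 0 (xBar b T (δ / 3) x₀) ∩ sys.𝕏 ⊆ XRPI}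

/-- The burn-in inequality at time `t` with candidate burn-in time `T`. It fails for `t = T = 1`
and `0 < δ < 1`, so the quotient by `t - 1 = 0` plays no role in `TburnIn`. -/
def BurnInIneq {n : ℕ} (d : ℕ) (b : Bounds) (cPE pPE : ℝ) (T t : ℕ) (δ : ℝ) (x₀ : Vec n) : Prop :=
  (t : ℝ) ≥ 2 / ((1 - Real.log 2) * pPE) *
      (d * Real.log (1 + 16 * (∑ i ∈ Finset.Icc 1 t, zBar b i (δ / 3) x₀ ^ 2) /
          (cPE * pPE * ((t : ℝ) - 1)))
        + Real.log (Real.pi ^ 2 * ((t : ℝ) - T + 1) ^ 2 / (2 * δ))) + 1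

/-- Burn-in time bound (an infimum in `ℕ ∪ {∞}`, equal to `∞` if there is no such time). -/
def TburnIn {n : ℕ} (d : ℕ) (b : Bounds) (cPE pPE : ℝ) (δ : ℝ) (x₀ : Vec n) : ℕ∞ :=
  sInf {N : ℕ∞ | ∃ T : ℕ, N = T ∧ 1 ≤ T ∧ ∀ t : ℕ, T ≤ t → BurnInIneq d b cPE pPE T t δ x₀}

/-- Convergence time bound (in `ℕ ∪ {∞}`). -/
def Tconverge {n m q d : ℕ} (sys : Sys n m q d) (b : Bounds) (cPE pPE ϑbar : ℝ)
    (δ : ℝ) (x₀ : Vec n) : ℕ∞ :=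
  max (TburnIn d b cPE pPE δ x₀)
    (sInf {N : ℕ∞ | ∃ T : ℕ, N = T ∧ 1 ≤ T ∧
      ∀ t : ℕ, T ≤ t → errBound sys b cPE pPE t δ x₀ ≤ ϑbar})

end AdaptiveControl

end

open AdaptiveControl

set_option linter.unusedSectionVars false

/-! Three failure events, each of probability at most δ/3, are discarded; the rest is deterministic.
Off the first, |W(t)| ≤ w̄(t, δ/3) for all t, so `xBar` bounds the states and the squares of `zBar`
bound the energy of the regressors. Off the second, the noise part b of the least-squares error
satisfies a bound on bᵀG⁻¹b that is logarithmic in the determinant of the Gram matrix G. Off the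
third, after burn-in, the regressors are excited at a linear rate in every direction for as long as
the states have stayed in `XRPI`. Combined in the normal equations, these give `errBound`.

Second event: √(γ^d / det G_t) · exp(b_tᵀG_t⁻¹b_t / 2σ²) is a supermartingale, because each of its
factors is a Gaussian mixture of the variables exp(aw - a²/2), which have mean at most 1
(`lintegral_selfNormIncr_le_one`). Ville's inequality (`measure_exists_ge_le`) makes the bound
uniform in time.

Third event: in a fixed direction, excitation has conditional probability at least p at each step,
so a Chernoff bound (`measure_card_le_half_le`) controls the number of excited times. A net of the
sphere passes to all directions (`mul_dotProduct_le_sum_sq_of_net`). The burn-in inequality is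
exactly what makes the union over net and times cost δ/3.

Excitation needs states in `XRPI`, and invariance of `XRPI` needs an accurate estimate. Induction on
time breaks the circle: at first x̄ keeps the state in `XRPI` whatever the estimate, and later the
control uses θ̂(t-1), whose error bound depends only on earlier states.

Finiteness and convergence are growth statements: x̄, hence also Σ z̄², is sub-exponential in t
(`isSubExpSeq_sum_zBar_sq`), so all the logarithms are o(t). -/

namespace AdaptiveControl

/-! ### Rank-one updates, Gram matrices and the least-squares error -/

section LinearAlgebra

variable {ι : Type*} [Fintype ι] [DecidableEq ι]

theorem det_add_vecMulVec_self {G : Matrix ι ι ℝ} (hG : G.PosDef) (z : ι → ℝ) :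
    (G + Matrix.vecMulVec z z).det = G.det * (1 + z ⬝ᵥ (G⁻¹ *ᵥ z)) := by
  have h := Matrix.det_add_replicateCol_mul_replicateRow (ι := Unit) (A := G)
    (isUnit_iff_ne_zero.mpr hG.det_pos.ne') z z
  rw [← Matrix.vecMulVec_eq] at h
  rw [h]
  congr 1
  simp [Matrix.mul_apply, Matrix.mulVec, dotProduct, Finset.sum_mul, Finset.mul_sum]
  rw [Finset.sum_comm]
  refine Finset.sum_congr rfl fun i _ => Finset.sum_congr rfl fun j _ => by ring

theorem posDef_add_vecMulVec_self {G : Matrix ι ι ℝ} (hG : G.PosDef) (z : ι → ℝ) :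
    (G + Matrix.vecMulVec z z).PosDef := by
  have := Matrix.posSemidef_vecMulVec_self_star z
  rw [star_trivial] at this
  exact hG.add_posSemidef this

theorem mulVec_inv_mulVec {G : Matrix ι ι ℝ} (hG : G.PosDef) (b : ι → ℝ) :
    G *ᵥ (G⁻¹ *ᵥ b) = b := by
  rw [Matrix.mulVec_mulVec, Matrix.mul_nonsing_inv _ (isUnit_iff_ne_zero.mpr hG.det_pos.ne'),
    Matrix.one_mulVec]

theorem inv_mulVec_mulVec {G : Matrix ι ι ℝ} (hG : G.PosDef) (b : ι → ℝ) :
    G⁻¹ *ᵥ (G *ᵥ b) = b := by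
  rw [Matrix.mulVec_mulVec, Matrix.nonsing_inv_mul _ (isUnit_iff_ne_zero.mpr hG.det_pos.ne'),
    Matrix.one_mulVec]

theorem dotProduct_mulVec_comm {G : Matrix ι ι ℝ} (hG : G.IsHermitian) (a b : ι → ℝ) :
    a ⬝ᵥ (G *ᵥ b) = b ⬝ᵥ (G *ᵥ a) := by
  have h : Gᵀ = G := by simpa using hG.eq
  rw [Matrix.dotProduct_mulVec, ← Matrix.mulVec_transpose, h, dotProduct_comm]

/-- Rank-one update of the quadratic form of the inverse. -/
theorem quadForm_inv_update {G : Matrix ι ι ℝ} (hG : G.PosDef) (z b : ι → ℝ) (w : ℝ) :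
    (b + w • z) ⬝ᵥ ((G + Matrix.vecMulVec z z)⁻¹ *ᵥ (b + w • z)) =
      b ⬝ᵥ (G⁻¹ *ᵥ b) + (2 * w * (z ⬝ᵥ (G⁻¹ *ᵥ b)) + w ^ 2 * (z ⬝ᵥ (G⁻¹ *ᵥ z))
        - (z ⬝ᵥ (G⁻¹ *ᵥ b)) ^ 2) / (1 + z ⬝ᵥ (G⁻¹ *ᵥ z)) := by
  have hG' := posDef_add_vecMulVec_self hG z
  have hv : 0 ≤ z ⬝ᵥ (G⁻¹ *ᵥ z) := by
    simpa using hG.inv.posSemidef.dotProduct_mulVec_nonneg z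
  have hsym : b ⬝ᵥ (G⁻¹ *ᵥ z) = z ⬝ᵥ (G⁻¹ *ᵥ b) := dotProduct_mulVec_comm hG.inv.1 b z
  have hGz := mulVec_inv_mulVec hG z
  have hGb := mulVec_inv_mulVec hG b
  set u := G⁻¹ *ᵥ z
  set y := G⁻¹ *ᵥ b
  set v := z ⬝ᵥ u
  set s := z ⬝ᵥ y
  have hv1 : 1 + v ≠ 0 := by positivity
  -- Instead of inverting the updated matrix, exhibit the solution of the linear system suggested by
  -- Sherman–Morrison; the quadratic form can then be read off.
  have key : (G + Matrix.vecMulVec z z) *ᵥ (y + ((w - s) / (1 + v)) • u) = b + w • z := by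
    rw [Matrix.mulVec_add, Matrix.mulVec_smul, Matrix.add_mulVec, Matrix.add_mulVec, hGz, hGb]
    have e1 : Matrix.vecMulVec z z *ᵥ y = s • z := by
      rw [Matrix.vecMulVec_mulVec]; ext i; simp [s, mul_comm]
    have e2 : Matrix.vecMulVec z z *ᵥ u = v • z := by
      rw [Matrix.vecMulVec_mulVec]; ext i; simp [v, mul_comm]
    rw [e1, e2]
    ext i
    simp only [Pi.add_apply, Pi.smul_apply, smul_eq_mul]
    field_simp
    ring
  rw [← key, inv_mulVec_mulVec hG', key]
  simp only [add_dotProduct, dotProduct_add, smul_dotProduct, dotProduct_smul, smul_eq_mul, hsym]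
  change b ⬝ᵥ y + w * s + (w - s) / (1 + v) * (s + w * v) = _
  field_simp
  ring

/-- Cauchy–Schwarz in the inner product of `G`, for `e` and `G⁻¹ b`: the form of `e - x • G⁻¹ b` is
a nonnegative quadratic in `x`, so its discriminant is at most 0. -/
theorem dotProduct_sq_le_quadForm {G : Matrix ι ι ℝ} (hG : G.PosDef) (e b : ι → ℝ) :
    (e ⬝ᵥ b) ^ 2 ≤ (e ⬝ᵥ (G *ᵥ e)) * (b ⬝ᵥ (G⁻¹ *ᵥ b)) := by
  have hGb := mulVec_inv_mulVec hG b
  set y := G⁻¹ *ᵥ b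
  have h : ∀ x : ℝ, 0 ≤ (b ⬝ᵥ y) * (x * x) + (-2 * (e ⬝ᵥ b)) * x + e ⬝ᵥ (G *ᵥ e) := by
    intro x
    have h0 := hG.posSemidef.dotProduct_mulVec_nonneg (e - x • y)
    have h1 := dotProduct_mulVec_comm hG.1 y e
    rw [hGb] at h1
    rw [star_trivial, Matrix.mulVec_sub, Matrix.mulVec_smul, hGb] at h0
    simp only [sub_dotProduct, dotProduct_sub, smul_dotProduct, dotProduct_smul, smul_eq_mul, h1,
      dotProduct_comm y b] at h0
    linarith
  have := discrim_le_zero h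
  unfold discrim at this
  nlinarith

/-- Regularised Gram matrix of the first `t` regressors. -/
def gram (γ : ℝ) (z : ℕ → ι → ℝ) (t : ℕ) : Matrix ι ι ℝ :=
  γ • (1 : Matrix ι ι ℝ) + ∑ s ∈ Finset.range t, Matrix.vecMulVec (z s) (z s)

/-- Sum of the first `t` regressors weighted by the noise. -/
def noiseSum (z : ℕ → ι → ℝ) (w : ℕ → ℝ) (t : ℕ) : ι → ℝ :=
  ∑ s ∈ Finset.range t, w s • z s

theorem gram_zero (γ : ℝ) (z : ℕ → ι → ℝ) : gram γ z 0 = γ • (1 : Matrix ι ι ℝ) := by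
  simp [gram]

theorem gram_succ (γ : ℝ) (z : ℕ → ι → ℝ) (t : ℕ) :
    gram γ z (t + 1) = gram γ z t + Matrix.vecMulVec (z t) (z t) := by
  simp [gram, Finset.sum_range_succ, add_assoc]

theorem noiseSum_succ (z : ℕ → ι → ℝ) (w : ℕ → ℝ) (t : ℕ) :
    noiseSum z w (t + 1) = noiseSum z w t + w t • z t := by
  simp [noiseSum, Finset.sum_range_succ]

theorem gram_posDef {γ : ℝ} (hγ : 0 < γ) (z : ℕ → ι → ℝ) (t : ℕ) : (gram γ z t).PosDef := by
  induction t with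
  | zero => rw [gram_zero]; exact Matrix.PosDef.one.smul hγ
  | succ t ih => rw [gram_succ]; exact posDef_add_vecMulVec_self ih _

theorem quadForm_gram (γ : ℝ) (z : ℕ → ι → ℝ) (t : ℕ) (x : ι → ℝ) :
    x ⬝ᵥ (gram γ z t *ᵥ x) = γ * (x ⬝ᵥ x) + ∑ s ∈ Finset.range t, (x ⬝ᵥ z s) ^ 2 := by
  induction t with
  | zero => simp [gram_zero, Matrix.smul_mulVec, dotProduct_smul]
  | succ t ih =>
    rw [gram_succ, Matrix.add_mulVec, dotProduct_add, ih, Finset.sum_range_succ,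
      Matrix.vecMulVec_mulVec, add_assoc]
    congr 2
    rw [dotProduct_comm (z t) x, dotProduct_smul, sq, MulOpposite.smul_eq_mul_unop,
      MulOpposite.unop_op]

/-- Each eigenvalue is the Rayleigh quotient `γ + ∑ (x ⬝ᵥ z s)²` at a unit eigenvector `x`, which
Cauchy–Schwarz bounds by `β`. -/
theorem det_gram_le {γ : ℝ} (hγ : 0 < γ) (z : ℕ → ι → ℝ) (t : ℕ) {β : ℝ}
    (hβ : ∑ s ∈ Finset.range t, (z s ⬝ᵥ z s) + γ ≤ β) :
    (gram γ z t).det ≤ β ^ Fintype.card ι := by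
  have hG := gram_posDef hγ z t
  rw [hG.1.det_eq_prod_eigenvalues]
  simp only [RCLike.ofReal_real_eq_id, id_eq]
  rw [← Finset.card_univ, ← Finset.prod_const]
  refine Finset.prod_le_prod (fun i _ => (hG.eigenvalues_pos i).le) fun i _ => ?_
  have h1 := hG.1.mulVec_eigenvectorBasis i
  set x : ι → ℝ := ⇑(hG.1.eigenvectorBasis i)
  have hx : x ⬝ᵥ x = 1 := by
    have := (hG.1.eigenvectorBasis).orthonormal.1 i
    have h2 : ‖hG.1.eigenvectorBasis i‖ ^ 2 = 1 := by rw [this]; norm_num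
    rw [EuclideanSpace.norm_sq_eq] at h2
    simpa [x, dotProduct, sq] using h2
  have h3 : x ⬝ᵥ (gram γ z t *ᵥ x) = hG.1.eigenvalues i := by
    rw [h1, dotProduct_smul, hx]; simp
  rw [← h3, quadForm_gram, hx]
  refine le_trans ?_ hβ
  have : ∑ s ∈ Finset.range t, (x ⬝ᵥ z s) ^ 2 ≤ ∑ s ∈ Finset.range t, (z s ⬝ᵥ z s) := by
    refine Finset.sum_le_sum fun s _ => ?_
    have := Finset.sum_mul_sq_le_sq_mul_sq Finset.univ x (z s)
    have e1 : ∑ i, x i ^ 2 = 1 := by rw [← hx]; simp [dotProduct, sq]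
    rw [e1, one_mul] at this
    simpa [dotProduct, sq] using this
  linarith

/-- Pair the normal equations with the error. With `N² = ∑ eⱼᵀ G eⱼ`, Cauchy–Schwarz bounds the
noise term by `N √(card κ · K)` and the regularisation term by `√γ Θ N`, since `√γ E ≤ N`. Divide by
`N` and use `√l E ≤ N`. The index `κ` runs over the columns of the parameter. -/
theorem le_div_sqrt_of_normal_equations {κ : Type*} [Fintype κ] {G : Matrix ι ι ℝ} (hG : G.PosDef)
    {γ l K : ℝ} (hγ : 0 < γ) (hl : 0 < l) (e b θ : κ → ι → ℝ)
    (heq : ∀ j, G *ᵥ e j = b j - γ • θ j)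
    (hGγ : ∀ x : ι → ℝ, γ * (x ⬝ᵥ x) ≤ x ⬝ᵥ (G *ᵥ x))
    (hGl : ∀ x : ι → ℝ, l * (x ⬝ᵥ x) ≤ x ⬝ᵥ (G *ᵥ x))
    (hK : ∀ j, b j ⬝ᵥ (G⁻¹ *ᵥ b j) ≤ K) :
    Real.sqrt (∑ j, e j ⬝ᵥ e j) ≤ 1 / Real.sqrt l *
      (Real.sqrt γ * Real.sqrt (∑ j, θ j ⬝ᵥ θ j) + Real.sqrt (Fintype.card κ * K)) := by
  have hself : ∀ x : ι → ℝ, 0 ≤ x ⬝ᵥ x := fun x => by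
    simpa using dotProduct_star_self_nonneg x
  have hq : ∀ x : ι → ℝ, 0 ≤ x ⬝ᵥ (G *ᵥ x) := fun x => by
    simpa using hG.posSemidef.dotProduct_mulVec_nonneg x
  have hE0 : 0 ≤ ∑ j, e j ⬝ᵥ e j := Finset.sum_nonneg fun j _ => hself _
  have hT0 : 0 ≤ ∑ j, θ j ⬝ᵥ θ j := Finset.sum_nonneg fun j _ => hself _
  have hM0 : 0 ≤ ∑ j, e j ⬝ᵥ (G *ᵥ e j) := Finset.sum_nonneg fun j _ => hq _
  set E := Real.sqrt (∑ j, e j ⬝ᵥ e j) with hE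
  set Θ := Real.sqrt (∑ j, θ j ⬝ᵥ θ j) with hΘ
  set N := Real.sqrt (∑ j, e j ⬝ᵥ (G *ᵥ e j)) with hN
  have hN0 : 0 ≤ N := Real.sqrt_nonneg _
  have hNsq : N ^ 2 = ∑ j, e j ⬝ᵥ (G *ᵥ e j) := Real.sq_sqrt hM0
  have hγE : Real.sqrt γ * E ≤ N := by
    rw [hE, hN, ← Real.sqrt_mul hγ.le]
    refine Real.sqrt_le_sqrt ?_
    rw [Finset.mul_sum]
    exact Finset.sum_le_sum fun j _ => hGγ _
  have hlE : Real.sqrt l * E ≤ N := by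
    rw [hE, hN, ← Real.sqrt_mul hl.le]
    refine Real.sqrt_le_sqrt ?_
    rw [Finset.mul_sum]
    exact Finset.sum_le_sum fun j _ => hGl _
  have h1 : ∑ j, e j ⬝ᵥ b j ≤ N * Real.sqrt (Fintype.card κ * K) := by
    have : ∀ j, e j ⬝ᵥ b j ≤ Real.sqrt (e j ⬝ᵥ (G *ᵥ e j)) * Real.sqrt (b j ⬝ᵥ (G⁻¹ *ᵥ b j)) := by
      intro j
      rw [← Real.sqrt_mul (hq _)]
      exact Real.le_sqrt_of_sq_le (dotProduct_sq_le_quadForm hG _ _)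
    refine (Finset.sum_le_sum fun j _ => this j).trans ?_
    refine (Real.sum_sqrt_mul_sqrt_le Finset.univ (fun j => hq _) fun j => ?_).trans ?_
    · simpa using hG.inv.posSemidef.dotProduct_mulVec_nonneg (b j)
    · refine mul_le_mul_of_nonneg_left (Real.sqrt_le_sqrt ?_) hN0
      refine (Finset.sum_le_sum fun j _ => hK j).trans ?_
      simp
  have h2 : -∑ j, e j ⬝ᵥ θ j ≤ E * Θ := by
    have : ∀ j, -(e j ⬝ᵥ θ j) ≤ Real.sqrt (e j ⬝ᵥ e j) * Real.sqrt (θ j ⬝ᵥ θ j) := by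
      intro j
      rw [← Real.sqrt_mul (hself _)]
      refine Real.le_sqrt_of_sq_le ?_
      have := Finset.sum_mul_sq_le_sq_mul_sq Finset.univ (e j) (θ j)
      rw [neg_sq]
      simpa [dotProduct, sq] using this
    rw [← Finset.sum_neg_distrib]
    refine (Finset.sum_le_sum fun j _ => this j).trans ?_
    exact Real.sum_sqrt_mul_sqrt_le Finset.univ (fun j => hself _) fun j => hself _
  have h3 : N ^ 2 = ∑ j, e j ⬝ᵥ b j + γ * (-∑ j, e j ⬝ᵥ θ j) := by
    rw [hNsq]
    simp only [heq, dotProduct_sub, dotProduct_smul, smul_eq_mul, Finset.sum_sub_distrib,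
      ← Finset.mul_sum]
    ring
  have hsl : 0 < Real.sqrt l := Real.sqrt_pos.mpr hl
  rw [one_div, ← div_eq_inv_mul, le_div_iff₀ hsl, mul_comm]
  refine hlE.trans ?_
  rcases hN0.eq_or_lt with h | hpos
  · rw [← h]; positivity
  · have h4 : N ^ 2 ≤ N * (Real.sqrt γ * Θ + Real.sqrt (Fintype.card κ * K)) := by
      have hs := Real.mul_self_sqrt hγ.le
      have h5 : γ * (-∑ j, e j ⬝ᵥ θ j) ≤ Real.sqrt γ * Θ * N := by
        calc γ * (-∑ j, e j ⬝ᵥ θ j) ≤ γ * (E * Θ) := mul_le_mul_of_nonneg_left h2 hγ.le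
          _ = Real.sqrt γ * Θ * (Real.sqrt γ * E) := by rw [← hs]; simp only [Real.sqrt_mul_self (Real.sqrt_nonneg γ)]; ring
          _ ≤ _ := mul_le_mul_of_nonneg_left hγE (by positivity)
      rw [h3]; linarith
    rw [sq] at h4
    exact le_of_mul_le_mul_left h4 hpos

end LinearAlgebra

/-! ### Finite nets of the unit sphere -/

section Covering

variable {E : Type*} [NormedAddCommGroup E] [NormedSpace ℝ E] [FiniteDimensional ℝ E]

/-- Volume comparison: the balls of radius `ε / 2` about the points are disjoint and lie in the ball
of radius `1 + ε / 2` about the origin. -/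
theorem card_le_of_separated {ε : ℝ} (hε : 0 < ε) (s : Finset E) (hs : ∀ c ∈ s, ‖c‖ = 1)
    (h : ∀ c ∈ s, ∀ e ∈ s, c ≠ e → ε ≤ ‖c - e‖) :
    (s.card : ℝ) ≤ (1 + 2 / ε) ^ Module.finrank ℝ E := by
  borelize E
  let μ : Measure E := Measure.addHaar
  have hε2 : 0 < ε / 2 := by positivity
  have hρ : 0 < 1 + ε / 2 := by positivity
  have D : Set.Pairwise (s : Set E) (Function.onFun Disjoint fun c => Metric.ball (c : E) (ε / 2)) := by
    rintro c hc e he hce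
    apply Metric.ball_disjoint_ball
    rw [dist_eq_norm, add_halves]
    exact h c hc e he hce
  have hsub : (⋃ c ∈ s, Metric.ball (c : E) (ε / 2)) ⊆ Metric.ball (0 : E) (1 + ε / 2) := by
    refine iUnion₂_subset fun x hx => Metric.ball_subset_ball' ?_
    rw [dist_zero_right, hs x hx, add_comm]
  have I : (s.card : ℝ≥0∞) * ENNReal.ofReal ((ε / 2) ^ Module.finrank ℝ E) * μ (Metric.ball 0 1) ≤
      ENNReal.ofReal ((1 + ε / 2) ^ Module.finrank ℝ E) * μ (Metric.ball 0 1) :=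
    calc
      _ = μ (⋃ c ∈ s, Metric.ball (c : E) (ε / 2)) := by
        rw [measure_biUnion_finset D fun c _ => measurableSet_ball]
        simp only [μ.addHaar_ball_of_pos _ hε2]
        simp only [Finset.sum_const, nsmul_eq_mul, mul_assoc]
      _ ≤ μ (Metric.ball (0 : E) (1 + ε / 2)) := measure_mono hsub
      _ = _ := by simp only [μ.addHaar_ball_of_pos _ hρ]
  have J := (ENNReal.mul_le_mul_iff_left (Metric.measure_ball_pos μ (0 : E) zero_lt_one).ne'
    measure_ball_lt_top.ne).1 I
  have K := ENNReal.toReal_le_of_le_ofReal (by positivity) J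
  rw [ENNReal.toReal_mul, ENNReal.toReal_natCast, ENNReal.toReal_ofReal (by positivity),
    ← le_div_iff₀ (by positivity), ← div_pow] at K
  refine K.trans_eq ?_
  congr 1
  field_simp
  ring

/-- A separated set of maximal size is a net, since a unit vector far from it could be adjoined. The
mesh is `a / R`; writing the covering property as a product admits `R = 0`, where a single unit
vector suffices. -/
theorem exists_finset_unit_net [Nontrivial E] {R a : ℝ} (hR : 0 ≤ R) (ha : 0 < a) :
    ∃ N : Finset E, (∀ ζ ∈ N, ‖ζ‖ = 1) ∧ (N.card : ℝ) ≤ (1 + 2 * R / a) ^ Module.finrank ℝ E ∧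
      ∀ ζ : E, ‖ζ‖ = 1 → ∃ ζ' ∈ N, R * ‖ζ - ζ'‖ ≤ a := by
  classical
  rcases hR.eq_or_lt with rfl | hR
  · obtain ⟨e, he⟩ := exists_norm_eq E (zero_le_one (α := ℝ))
    refine ⟨{e}, by simpa using he, by simp, fun ζ _ => ⟨e, by simp, by simpa using ha.le⟩⟩
  have hε : 0 < a / R := by positivity
  let Q : ℕ → Prop := fun k => ∃ s : Finset E, s.card = k ∧ (∀ c ∈ s, ‖c‖ = 1) ∧
    ∀ c ∈ s, ∀ e ∈ s, c ≠ e → a / R ≤ ‖c - e‖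
  have hbd : ∀ k, Q k → (k : ℝ) ≤ (1 + 2 * R / a) ^ Module.finrank ℝ E := by
    rintro k ⟨s, rfl, h1, h2⟩
    refine (card_le_of_separated hε s h1 h2).trans_eq ?_
    congr 2
    field_simp
  set B := ⌈(1 + 2 * R / a) ^ Module.finrank ℝ E⌉₊
  have h0 : Q 0 := ⟨∅, by simp⟩
  have hm := Nat.findGreatest_spec (P := Q) (Nat.zero_le B) h0
  set k := Nat.findGreatest Q B
  obtain ⟨s, hs, h1, h2⟩ := hm
  refine ⟨s, h1, hs ▸ hbd k ⟨s, hs, h1, h2⟩, fun ζ hζ => ?_⟩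
  by_contra! hcon
  have hcon' : ∀ c ∈ s, a / R ≤ ‖ζ - c‖ := fun c hc => by
    rw [div_le_iff₀ hR, mul_comm]; exact (hcon c hc).le
  have hnot : ζ ∉ s := fun hmem => by
    have := hcon ζ hmem
    simp at this
    linarith
  have hQ : Q (k + 1) := by
    refine ⟨insert ζ s, by rw [Finset.card_insert_of_notMem hnot, hs], ?_, ?_⟩
    · intro c hc
      rcases Finset.mem_insert.1 hc with rfl | hc
      · exact hζ
      · exact h1 c hc
    · intro c hc e he hce
      rcases Finset.mem_insert.1 hc with h3 | h3 <;> rcases Finset.mem_insert.1 he with h4 | h4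
      · exact absurd (h3.trans h4.symm) hce
      · rw [h3]; exact hcon' e h4
      · rw [h4, norm_sub_rev]; exact hcon' c h3
      · exact h2 c h3 e h4 hce
  have hle : k + 1 ≤ B := by
    have := (hbd _ hQ).trans (Nat.le_ceil _)
    exact_mod_cast this
  have := Nat.le_findGreatest hle hQ
  change k + 1 ≤ k at this
  omega

end Covering

/-! ### Gaussian mixtures, maximal inequality, Chernoff bound -/

section Probability

/-- The increment of the self-normalised supermartingale. -/
noncomputable def selfNormIncr (w s v : ℝ) : ℝ :=
  1 / Real.sqrt (1 + v) * Real.exp ((2 * w * s + w ^ 2 * v - s ^ 2) / (2 * (1 + v)))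

/-- Completing the square in `a`. Integrating over `a` then shows that `selfNormIncr` is the mixture
of `exp (a w - a² / 2)` over a Gaussian `a` of mean `s` and variance `v`. -/
theorem exp_mul_gaussianPDFReal (w s : ℝ) {v : ℝ≥0} (hv : v ≠ 0) (a : ℝ) :
    Real.exp (a * w - a ^ 2 / 2) * gaussianPDFReal s v a =
      selfNormIncr w s v * gaussianPDFReal ((s + w * v) / (1 + v)) (v / (1 + v)) a := by
  have hv0 : (0 : ℝ) < v := lt_of_le_of_ne v.2 (by exact_mod_cast hv.symm)
  have h1 : (0 : ℝ) < 1 + v := by positivity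
  simp only [gaussianPDFReal, selfNormIncr, NNReal.coe_div, NNReal.coe_add, NNReal.coe_one]
  have e1 : Real.sqrt (2 * Real.pi * (v / (1 + v))) * Real.sqrt (1 + v) =
      Real.sqrt (2 * Real.pi * v) := by
    rw [← Real.sqrt_mul (by positivity)]
    congr 1; field_simp
  rw [← e1]
  rw [mul_inv, mul_left_comm, ← Real.exp_add,
    show ∀ A B C D : ℝ, 1 / A * B * (C * D) = C * A⁻¹ * (B * D) from fun A B C D => by ring,
    ← Real.exp_add]
  congr 2
  field_simp
  ring

/-- By Tonelli the mixture over `a` inherits the bound 1. For `v = 0` there is no Gaussian density,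
but then `s = 0` and the increment is constantly 1. -/
theorem lintegral_selfNormIncr_le_one (μ : Measure ℝ) [IsProbabilityMeasure μ]
    (hμ : ∀ a : ℝ, ∫⁻ w, ENNReal.ofReal (Real.exp (a * w - a ^ 2 / 2)) ∂μ ≤ 1)
    {s v : ℝ} (hv : 0 ≤ v) (hs : v = 0 → s = 0) :
    ∫⁻ w, ENNReal.ofReal (selfNormIncr w s v) ∂μ ≤ 1 := by
  rcases hv.eq_or_lt with h0 | hv
  · simp [selfNormIncr, ← h0, hs h0.symm]
  lift v to ℝ≥0 using hv.le
  have hv' : v ≠ 0 := by rintro rfl; simp at hv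
  have hv'' : v / (1 + v) ≠ 0 := div_ne_zero hv' (by positivity)
  have hpos : ∀ w, 0 ≤ selfNormIncr w s v := fun w => by unfold selfNormIncr; positivity
  have hmain : ∀ w, ENNReal.ofReal (selfNormIncr w s v) =
      ∫⁻ a, ENNReal.ofReal (Real.exp (a * w - a ^ 2 / 2)) * gaussianPDF s v a := by
    intro w
    simp only [gaussianPDF, ← ENNReal.ofReal_mul (Real.exp_nonneg _),
      exp_mul_gaussianPDFReal w s hv']
    simp only [ENNReal.ofReal_mul (hpos w)]
    rw [lintegral_const_mul _ (by fun_prop), lintegral_gaussianPDFReal_eq_one _ hv'', mul_one]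
  simp only [hmain]
  rw [lintegral_lintegral_swap (by fun_prop)]
  have : ∀ a : ℝ, ∫⁻ w, ENNReal.ofReal (Real.exp (a * w - a ^ 2 / 2)) * gaussianPDF s v a ∂μ ≤
      gaussianPDF s v a := fun a => by
    rw [lintegral_mul_const _ (by fun_prop)]
    exact mul_le_of_le_one_left' (hμ a)
  exact (lintegral_mono this).trans (lintegral_gaussianPDF_eq_one s hv').le

variable {Ω : Type*} [MeasurableSpace Ω] {P : Measure Ω}

/-- Ville's maximal inequality. -/
theorem measure_exists_ge_le [IsProbabilityMeasure P] (M : ℕ → Ω → ℝ≥0∞) (hM : ∀ t, Measurable (M t))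
    (h0 : ∫⁻ ω, M 0 ω ∂P ≤ 1) (a : ℝ≥0∞)
    (hstep : ∀ t, ∫⁻ ω in {ω | ∀ s ≤ t, M s ω < a}, M (t + 1) ω ∂P ≤
      ∫⁻ ω in {ω | ∀ s ≤ t, M s ω < a}, M t ω ∂P) :
    a * P {ω | ∃ t, a ≤ M t ω} ≤ 1 := by
  have hmeas : ∀ t, MeasurableSet {ω | ∀ s ≤ t, M s ω < a} := fun t => by
    have : {ω | ∀ s ≤ t, M s ω < a} = ⋂ s, ⋂ (_ : s ≤ t), {ω | M s ω < a} := by ext; simp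
    rw [this]
    exact MeasurableSet.iInter fun s => MeasurableSet.iInter fun _ =>
      measurableSet_lt (hM s) measurable_const
  -- The integral over the paths that have not reached `a`, plus `a` times the probability of having
  -- reached it, stays at most 1: paths that newly reach `a` give up at least `a` per unit of
  -- probability. The supermartingale property is needed only before the crossing.
  have key : ∀ t, ∫⁻ ω in {ω | ∀ s ≤ t, M s ω < a}, M t ω ∂P +
      a * P {ω | ∃ s ≤ t, a ≤ M s ω} ≤ 1 := by
    intro t
    induction t with
    | zero =>
      refine le_trans ?_ h0
      refine le_trans (add_le_add_right ?_ _)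
        (lintegral_add_compl (μ := P) (fun ω => M 0 ω) (hmeas 0)).le
      rw [← setLIntegral_const]
      have : {ω | ∃ s ≤ 0, a ≤ M s ω} = {ω | ∀ s ≤ 0, M s ω < a}ᶜ := by ext; simp
      rw [this]
      exact setLIntegral_mono' (hmeas 0).compl fun ω hω => by simpa using hω
    | succ t ih =>
      refine le_trans ?_ ih
      refine le_trans ?_ (add_le_add (hstep t) le_rfl)
      set A := {ω | ∀ s ≤ t, M s ω < a}
      set A' := {ω | ∀ s ≤ t + 1, M s ω < a}
      have hsub : A' ⊆ A := fun ω hω s hs => hω s (hs.trans t.le_succ)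
      have e1 : ∫⁻ ω in A, M (t + 1) ω ∂P =
          ∫⁻ ω in A', M (t + 1) ω ∂P + ∫⁻ ω in A \ A', M (t + 1) ω ∂P := by
        rw [← lintegral_inter_add_sdiff _ A (hmeas (t + 1)), inter_eq_self_of_subset_right hsub]
      have e2 : {ω | ∃ s ≤ t + 1, a ≤ M s ω} ⊆ (A \ A') ∪ {ω | ∃ s ≤ t, a ≤ M s ω} := by
        intro ω hω
        by_cases h : ω ∈ A
        · left
          refine ⟨h, fun h' => ?_⟩
          obtain ⟨s, hs, hs'⟩ := hω
          exact absurd (h' s hs) (not_lt.2 hs')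
        · right
          simpa [A] using h
      have e3 : a * P (A \ A') ≤ ∫⁻ ω in A \ A', M (t + 1) ω ∂P := by
        rw [← setLIntegral_const]
        refine setLIntegral_mono' ((hmeas t).diff (hmeas (t + 1))) fun ω hω => ?_
        by_contra! hlt
        refine hω.2 fun s hs => ?_
        rcases Nat.le_succ_iff.1 hs with h | rfl
        · exact hω.1 s h
        · exact hlt
      calc _ ≤ ∫⁻ ω in A', M (t + 1) ω ∂P +
            a * (P (A \ A') + P {ω | ∃ s ≤ t, a ≤ M s ω}) := by
            gcongr
            exact (measure_mono e2).trans (measure_union_le _ _)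
        _ ≤ _ := by rw [e1, mul_add, add_assoc]; gcongr
  have hU : {ω | ∃ t, a ≤ M t ω} = ⋃ t, {ω | ∃ s ≤ t, a ≤ M s ω} := by
    ext ω
    simp only [mem_ofPred_eq, mem_iUnion]
    exact ⟨fun ⟨t, h⟩ => ⟨t, t, le_rfl, h⟩, fun ⟨_, t, _, h⟩ => ⟨t, h⟩⟩
  have hmono : Monotone fun t => {ω | ∃ s ≤ t, a ≤ M s ω} :=
    fun t u htu ω ⟨s, hs, h⟩ => ⟨s, hs.trans htu, h⟩
  rw [hU, hmono.measure_iUnion, ENNReal.mul_iSup]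
  exact iSup_le fun t => le_add_self.trans (key t)

/-- Takes the place of conditional expectation: with the past `H` frozen, the fresh variable `ξ` is
integrated out first. -/
theorem lintegral_comp_prodMk_of_indepFun [IsProbabilityMeasure P] {α β : Type*}
    [MeasurableSpace α] [MeasurableSpace β] {H : Ω → α} {ξ : Ω → β} (hH : Measurable H)
    (hξ : Measurable ξ) (hind : IndepFun H ξ P) {F : α × β → ℝ≥0∞} (hF : Measurable F) :
    ∫⁻ ω, F (H ω, ξ ω) ∂P = ∫⁻ ω, ∫⁻ y, F (H ω, y) ∂(P.map ξ) ∂P := by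
  have : IsProbabilityMeasure (P.map ξ) := Measure.isProbabilityMeasure_map hξ.aemeasurable
  rw [← lintegral_map hF (hH.prodMk hξ),
    (indepFun_iff_map_prod_eq_prod_map_map hH.aemeasurable hξ.aemeasurable).1 hind,
    lintegral_prod _ hF.aemeasurable, lintegral_map hF.lintegral_prod_right' hH]

open Classical in
/-- Lower tail of a sum of indicators whose conditional probabilities are at least `p`. -/
theorem measure_card_le_half_le [IsProbabilityMeasure P] (B : ℕ → Set Ω)
    (hB : ∀ k, MeasurableSet (B k)) {p : ℝ}
    (hstep : ∀ k, ∫⁻ ω, (∏ i ∈ Finset.range k, if ω ∈ B i then (2 : ℝ≥0∞)⁻¹ else 1) *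
        (if ω ∈ B k then (2 : ℝ≥0∞)⁻¹ else 1) ∂P ≤
      ENNReal.ofReal (Real.exp (-(p / 2))) *
        ∫⁻ ω, ∏ i ∈ Finset.range k, (if ω ∈ B i then (2 : ℝ≥0∞)⁻¹ else 1) ∂P)
    (N : ℕ) :
    P {ω | (((Finset.range N).filter fun i => ω ∈ B i).card : ℝ) ≤ N * (p / 2)} ≤
      ENNReal.ofReal (Real.exp (-(N * ((1 - Real.log 2) * p / 2)))) := by
  have hprod : ∀ N, ∫⁻ ω, ∏ i ∈ Finset.range N, (if ω ∈ B i then (2 : ℝ≥0∞)⁻¹ else 1) ∂P ≤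
      ENNReal.ofReal (Real.exp (-(N * (p / 2)))) := by
    intro N
    induction N with
    | zero => simp
    | succ N ih =>
      simp only [Finset.prod_range_succ]
      refine (hstep N).trans ?_
      refine (mul_le_mul_right ih _).trans_eq ?_
      rw [← ENNReal.ofReal_mul (Real.exp_nonneg _), ← Real.exp_add]
      congr 2
      push_cast; ring
  have hmeas : Measurable fun ω => ∏ i ∈ Finset.range N, (if ω ∈ B i then (2 : ℝ≥0∞)⁻¹ else 1) :=
    Finset.measurable_prod _ fun i _ => Measurable.ite (hB i) measurable_const measurable_const
  -- The threshold is `2 ^ (-N p / 2)`, the least value of the product when at most `N p / 2` events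
  -- occur. Markov's inequality divides `exp (-N p / 2)` by it, whence the factor `1 - log 2`.
  set c := ENNReal.ofReal (Real.exp (-(Real.log 2 * (N * (p / 2))))) with hc
  have hmarkov := mul_meas_ge_le_lintegral hmeas (μ := P) c
  have hsub : {ω | (((Finset.range N).filter fun i => ω ∈ B i).card : ℝ) ≤ N * (p / 2)} ⊆
      {ω | c ≤ ∏ i ∈ Finset.range N, (if ω ∈ B i then (2 : ℝ≥0∞)⁻¹ else 1)} := by
    intro ω hω
    simp only [mem_ofPred_eq] at hω ⊢
    rw [Finset.prod_ite, Finset.prod_const, Finset.prod_const_one, mul_one, hc]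
    have h2 : (2 : ℝ≥0∞)⁻¹ = ENNReal.ofReal (Real.exp (-Real.log 2)) := by
      rw [Real.exp_neg, Real.exp_log two_pos, ENNReal.ofReal_inv_of_pos two_pos]
      simp
    rw [h2, ← ENNReal.ofReal_pow (Real.exp_nonneg _), ← Real.exp_nat_mul]
    refine ENNReal.ofReal_le_ofReal (Real.exp_le_exp.2 ?_)
    have := mul_le_mul_of_nonneg_left hω (Real.log_nonneg one_le_two)
    linarith
  have h1 : c * P {ω | (((Finset.range N).filter fun i => ω ∈ B i).card : ℝ) ≤ N * (p / 2)} ≤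
      ENNReal.ofReal (Real.exp (-(N * (p / 2)))) :=
    (mul_le_mul_right (measure_mono hsub) c).trans (hmarkov.trans (hprod N))
  have hc0 : c ≠ 0 := by simp [hc, Real.exp_pos]
  have hctop : c ≠ ⊤ := ENNReal.ofReal_ne_top
  rw [mul_comm, ← ENNReal.le_div_iff_mul_le (Or.inl hc0) (Or.inl hctop)] at h1
  refine h1.trans_eq ?_
  rw [hc, ← ENNReal.ofReal_div_of_pos (Real.exp_pos _), ← Real.exp_sub]
  congr 2
  ring

end Probability

/-! ### Independence of fresh noise from the past -/

section Independence

variable {Ω : Type*} {mΩ : MeasurableSpace Ω} {P : Measure Ω}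

theorem isPiSystem_inter_measurableSet (m₁ m₂ : MeasurableSpace Ω) :
    IsPiSystem {s | ∃ a b, MeasurableSet[m₁] a ∧ MeasurableSet[m₂] b ∧ s = a ∩ b} := by
  rintro _ ⟨a, b, ha, hb, rfl⟩ _ ⟨a', b', ha', hb', rfl⟩ _
  exact ⟨a ∩ a', b ∩ b', ha.inter ha', hb.inter hb', inter_inter_inter_comm a b a' b'⟩

theorem sup_eq_generateFrom_inter (m₁ m₂ : MeasurableSpace Ω) :
    m₁ ⊔ m₂ = MeasurableSpace.generateFrom
      {s | ∃ a b, MeasurableSet[m₁] a ∧ MeasurableSet[m₂] b ∧ s = a ∩ b} := by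
  apply le_antisymm
  · refine sup_le (fun s hs => ?_) (fun s hs => ?_)
    · exact MeasurableSpace.measurableSet_generateFrom ⟨s, univ, hs, .univ, by simp⟩
    · exact MeasurableSpace.measurableSet_generateFrom ⟨univ, s, .univ, hs, by simp⟩
  · refine MeasurableSpace.generateFrom_le ?_
    rintro _ ⟨a, b, ha, hb, rfl⟩
    exact MeasurableSet.inter ((le_sup_left : m₁ ≤ m₁ ⊔ m₂) _ ha) ((le_sup_right : m₂ ≤ m₁ ⊔ m₂) _ hb)

/-- On the π-systems of intersections, first separate the `A` part from the `B` part, then factor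
within each. -/
theorem indep_sup_sup [IsProbabilityMeasure P] {A B m₁ m₁' m₂ m₂' : MeasurableSpace Ω}
    (hA : A ≤ mΩ) (hB : B ≤ mΩ) (h₁ : m₁ ≤ A) (h₁' : m₁' ≤ A) (h₂ : m₂ ≤ B) (h₂' : m₂' ≤ B)
    (hAB : Indep A B P) (hi₁ : Indep m₁ m₁' P) (hi₂ : Indep m₂ m₂' P) :
    Indep (m₁ ⊔ m₂) (m₁' ⊔ m₂') P := by
  refine IndepSets.indep (sup_le (h₁.trans hA) (h₂.trans hB)) (sup_le (h₁'.trans hA) (h₂'.trans hB))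
    (isPiSystem_inter_measurableSet m₁ m₂) (isPiSystem_inter_measurableSet m₁' m₂')
    (sup_eq_generateFrom_inter _ _) (sup_eq_generateFrom_inter _ _) ?_
  rw [IndepSets_iff]
  rintro _ _ ⟨a, b, ha, hb, rfl⟩ ⟨a', b', ha', hb', rfl⟩
  rw [Indep_iff] at hAB hi₁ hi₂
  rw [inter_inter_inter_comm, hAB _ _ (MeasurableSet.inter (h₁ _ ha) (h₁' _ ha'))
    (MeasurableSet.inter (h₂ _ hb) (h₂' _ hb')), hi₁ _ _ ha ha', hi₂ _ _ hb hb',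
    hAB _ _ (h₁ _ ha) (h₂ _ hb), hAB _ _ (h₁' _ ha') (h₂' _ hb')]
  ring

/-- The information in `V 1, …, V t` and `S 0, …, S t`. -/
abbrev noisePast {α β : Type*} [MeasurableSpace α] [MeasurableSpace β] (V : ℕ → Ω → α)
    (S : ℕ → Ω → β) (t : ℕ) : MeasurableSpace Ω :=
  (⨆ k ∈ {k | k < t}, MeasurableSpace.comap (V (k + 1)) inferInstance) ⊔
    ⨆ k ∈ {k | k < t + 1}, MeasurableSpace.comap (S k) inferInstance

variable {α β : Type*} [MeasurableSpace α] [MeasurableSpace β] {V : ℕ → Ω → α} {S : ℕ → Ω → β}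

theorem measurable_noisePast_left {t k : ℕ} (hk : k < t) :
    Measurable[noisePast V S t] (V (k + 1)) := by
  have h : MeasurableSpace.comap (V (k + 1)) inferInstance ≤ noisePast V S t :=
    le_trans (le_iSup₂ (f := fun k (_ : k ∈ {k | k < t}) =>
      MeasurableSpace.comap (V (k + 1)) inferInstance) k hk) le_sup_left
  exact (comap_measurable (V (k + 1))).mono h le_rfl

theorem measurable_noisePast_right {t k : ℕ} (hk : k ≤ t) :
    Measurable[noisePast V S t] (S k) := by
  have h : MeasurableSpace.comap (S k) inferInstance ≤ noisePast V S t :=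
    le_trans (le_iSup₂ (f := fun k (_ : k ∈ {k | k < t + 1}) =>
      MeasurableSpace.comap (S k) inferInstance) k (Nat.lt_succ_of_le hk)) le_sup_right
  exact (comap_measurable (S k)).mono h le_rfl

theorem noisePast_le (hV : ∀ k, Measurable (V (k + 1))) (hS : ∀ k, Measurable (S k)) (t : ℕ) :
    noisePast V S t ≤ mΩ :=
  sup_le (iSup₂_le fun k _ => (hV k).comap_le) (iSup₂_le fun k _ => (hS k).comap_le)

/-- The past holds one more `S` than `V`: the control at time `t` already uses `S t`, while the next
state is driven by `V (t + 1)`. So the regressor at time `t` is known, and the pair at `t + 1` is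
fresh. -/
theorem indep_noisePast [IsProbabilityMeasure P] (hV : ∀ k, Measurable (V (k + 1)))
    (hS : ∀ k, Measurable (S k)) (hiV : iIndepFun (fun k => V (k + 1)) P) (hiS : iIndepFun S P)
    (hVS : IndepFun (fun ω (t : ℕ) => V (t + 1) ω) (fun ω (t : ℕ) => S t ω) P) (t : ℕ) :
    Indep (noisePast V S t)
      (MeasurableSpace.comap (fun ω => (S (t + 1) ω, V (t + 1) ω)) inferInstance) P := by
  have e : MeasurableSpace.comap (fun ω => (S (t + 1) ω, V (t + 1) ω)) inferInstance =
      MeasurableSpace.comap (V (t + 1)) inferInstance ⊔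
        MeasurableSpace.comap (S (t + 1)) inferInstance := by
    rw [sup_comm]
    exact MeasurableSpace.comap_prodMk _ _
  rw [e]
  have hA : ∀ k, MeasurableSpace.comap (V (k + 1)) inferInstance ≤
      MeasurableSpace.comap (fun ω (t : ℕ) => V (t + 1) ω) inferInstance := fun k =>
    ((measurable_pi_apply k).comp
      (comap_measurable (fun ω (t : ℕ) => V (t + 1) ω))).comap_le
  have hB : ∀ k, MeasurableSpace.comap (S k) inferInstance ≤
      MeasurableSpace.comap (fun ω (t : ℕ) => S t ω) inferInstance := fun k =>
    ((measurable_pi_apply k).comp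
      (comap_measurable (fun ω (t : ℕ) => S t ω))).comap_le
  refine indep_sup_sup (measurable_pi_lambda _ hV).comap_le (measurable_pi_lambda _ hS).comap_le
    (iSup₂_le fun k _ => hA k) (hA t) (iSup₂_le fun k _ => hB k) (hB (t + 1)) hVS ?_ ?_
  · have := indep_iSup_of_disjoint (fun k => (hV k).comap_le) hiV
      (S := {k | k < t}) (T := {t}) (by simp)
    simpa only [iSup_singleton] using this
  · have := indep_iSup_of_disjoint (fun k => (hS k).comap_le) hiS
      (S := {k | k < t + 1}) (T := {t + 1}) (by simp)
    simpa only [iSup_singleton] using this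

end Independence

/-! ### Measurability of matrix expressions -/

section MatrixMeasurability

variable {Ω : Type*} {mΩ : MeasurableSpace Ω} {ι : Type*} [Fintype ι] [DecidableEq ι]

/-- Adjugate over determinant, both continuous in the entries; singular matrices are covered by the
convention that 0 has inverse 0. -/
theorem measurable_inv_apply {G : Ω → Matrix ι ι ℝ} (hG : ∀ i j, Measurable fun ω => G ω i j)
    (i j : ι) : Measurable fun ω => (G ω)⁻¹ i j := by
  have h : Measurable fun ω => (fun i j => G ω i j : ι → ι → ℝ) :=
    measurable_pi_lambda _ fun i => measurable_pi_lambda _ fun j => hG i j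
  have hdet : Continuous fun A : ι → ι → ℝ => (Matrix.of A).det :=
    Continuous.matrix_det (continuous_id (X := ι → ι → ℝ))
  have hadj : Continuous fun A : ι → ι → ℝ => (Matrix.of A).adjugate i j :=
    (Continuous.matrix_adjugate (continuous_id (X := ι → ι → ℝ))).matrix_elem i j
  have e : ∀ ω, (G ω)⁻¹ i j = ((G ω).det)⁻¹ * (G ω).adjugate i j := fun ω => by
    rw [Matrix.inv_def, Matrix.smul_apply, Ring.inverse_eq_inv', smul_eq_mul]
  simp only [e]
  exact (hdet.measurable.comp h).inv.mul (hadj.measurable.comp h)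

theorem measurable_det {G : Ω → Matrix ι ι ℝ} (hG : ∀ i j, Measurable fun ω => G ω i j) :
    Measurable fun ω => (G ω).det := by
  have h : Measurable fun ω => (fun i j => G ω i j : ι → ι → ℝ) :=
    measurable_pi_lambda _ fun i => measurable_pi_lambda _ fun j => hG i j
  have hdet : Continuous fun A : ι → ι → ℝ => (Matrix.of A).det :=
    Continuous.matrix_det (continuous_id (X := ι → ι → ℝ))
  exact hdet.measurable.comp h

theorem measurable_gram_apply (γ : ℝ) {z : Ω → ℕ → ι → ℝ} {t : ℕ}
    (hz : ∀ s < t, Measurable fun ω => z ω s) (i j : ι) :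
    Measurable fun ω => gram γ (z ω) t i j := by
  simp only [gram, Matrix.add_apply, Matrix.sum_apply, Matrix.vecMulVec_apply]
  refine measurable_const.add (Finset.measurable_fun_sum _ fun s hs => ?_)
  have := measurable_pi_iff.1 (hz s (Finset.mem_range.1 hs))
  exact (this i).mul (this j)

theorem measurable_noiseSum {z : Ω → ℕ → ι → ℝ} {w : Ω → ℕ → ℝ} {t : ℕ}
    (hz : ∀ s < t, Measurable fun ω => z ω s) (hw : ∀ s < t, Measurable fun ω => w ω s) :
    Measurable fun ω => noiseSum (z ω) (w ω) t := by
  simp only [noiseSum]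
  refine Finset.measurable_fun_sum _ fun s hs => ?_
  exact (hw s (Finset.mem_range.1 hs)).smul (hz s (Finset.mem_range.1 hs))

theorem measurable_inv_mulVec {G : Ω → Matrix ι ι ℝ} (hG : ∀ i j, Measurable fun ω => G ω i j)
    {b : Ω → ι → ℝ} (hb : Measurable b) : Measurable fun ω => (G ω)⁻¹ *ᵥ b ω := by
  refine measurable_pi_lambda _ fun i => ?_
  simp only [Matrix.mulVec, dotProduct]
  exact Finset.measurable_fun_sum _ fun j _ =>
    (measurable_inv_apply hG i j).mul (measurable_pi_iff.1 hb j)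

theorem measurable_dotProduct {a b : Ω → ι → ℝ} (ha : Measurable a) (hb : Measurable b) :
    Measurable fun ω => a ω ⬝ᵥ b ω := by
  simp only [dotProduct]
  exact Finset.measurable_fun_sum _ fun j _ =>
    (measurable_pi_iff.1 ha j).mul (measurable_pi_iff.1 hb j)

end MatrixMeasurability

theorem sum_Icc_one_eq_sum_range {M : Type*} [AddCommMonoid M] (f : ℕ → M) (t : ℕ) :
    ∑ s ∈ Finset.Icc 1 t, f s = ∑ s ∈ Finset.range t, f (s + 1) := by
  induction t with
  | zero => simp
  | succ t ih => rw [Finset.sum_Icc_succ_top (by omega), ih, Finset.sum_range_succ]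

variable {n m q d : ℕ}

/-! ### Normal equations -/

section LeastSquares

theorem applyT_apply (θ : Param d n) (z : Vec d) (j : Fin n) :
    applyT θ z j = (fun i => θ i j) ⬝ᵥ z.ofLp := by
  simp [applyT, Matrix.toLpLin_apply, Matrix.mulVec, dotProduct]

theorem rlsCost_eq (sys : Sys n m q d) (x : ℕ → Vec n) (u : ℕ → Vec m) (t : ℕ) (θ : Param d n) :
    sys.rlsCost x u t θ = ∑ s ∈ Finset.range t, ∑ j,
      ((x (s + 1) - sys.f (x s) (u s)) j - ∑ i, θ i j * sys.ψ (x s) (u s) i) ^ 2 +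
      sys.γ * ∑ i, ∑ j, θ i j ^ 2 := by
  have h1 : frobNorm θ ^ 2 = ∑ i, ∑ j, θ i j ^ 2 :=
    Real.sq_sqrt (Finset.sum_nonneg fun i _ => Finset.sum_nonneg fun j _ => sq_nonneg _)
  rw [Sys.rlsCost, h1, sum_Icc_one_eq_sum_range]
  congr 1
  refine Finset.sum_congr rfl fun s _ => ?_
  rw [EuclideanSpace.norm_sq_eq]
  refine Finset.sum_congr rfl fun j _ => ?_
  rw [Real.norm_eq_abs, sq_abs]
  simp only [Nat.add_sub_cancel, PiLp.sub_apply, applyT_apply, dotProduct]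
  ring

/-- Along a line `θ + ε H` the cost is a quadratic in `ε` with linear coefficient `-2 L`. Minimality
at `ε = 0` forces the discriminant `4 L²` to be at most 0, so `L = 0`. -/
theorem normal_equations (sys : Sys n m q d) (x : ℕ → Vec n) (u : ℕ → Vec m) (t : ℕ)
    (θ : Param d n) (hθ : IsMinOn (sys.rlsCost x u t) univ θ) (j : Fin n) :
    gram sys.γ (fun s => (sys.ψ (x s) (u s)).ofLp) t *ᵥ (fun i => θ i j) =
      noiseSum (fun s => (sys.ψ (x s) (u s)).ofLp) (fun s => (x (s + 1) - sys.f (x s) (u s)) j) t := by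
  set z : ℕ → Fin d → ℝ := fun s => (sys.ψ (x s) (u s)).ofLp with hz
  set y : ℕ → Fin n → ℝ := fun s => (x (s + 1) - sys.f (x s) (u s)).ofLp with hy
  have hcost : ∀ θ, sys.rlsCost x u t θ = ∑ s ∈ Finset.range t, ∑ j,
      (y s j - ∑ i, θ i j * z s i) ^ 2 + sys.γ * ∑ i, ∑ j, θ i j ^ 2 := rlsCost_eq sys x u t
  ext i
  have hlin : ∀ H : Param d n, ∑ s ∈ Finset.range t, ∑ j, (y s j - ∑ i, θ i j * z s i) *
      (∑ i, H i j * z s i) - sys.γ * ∑ i, ∑ j, θ i j * H i j = 0 := by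
    intro H
    set L := ∑ s ∈ Finset.range t, ∑ j, (y s j - ∑ i, θ i j * z s i) *
      (∑ i, H i j * z s i) - sys.γ * ∑ i, ∑ j, θ i j * H i j with hL
    set Q := ∑ s ∈ Finset.range t, ∑ j, (∑ i, H i j * z s i) ^ 2 + sys.γ * ∑ i, ∑ j, H i j ^ 2
      with hQ
    have hexp : ∀ ε : ℝ, sys.rlsCost x u t (θ + ε • H) =
        sys.rlsCost x u t θ + (-2 * L * ε + Q * (ε * ε)) := by
      intro ε
      rw [hcost, hcost, hL, hQ]
      have e1 : ∀ s j, (y s j - ∑ i, (θ + ε • H) i j * z s i) ^ 2 =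
          (y s j - ∑ i, θ i j * z s i) ^ 2 + (-2 * ε) * ((y s j - ∑ i, θ i j * z s i) *
            (∑ i, H i j * z s i)) + ε * ε * (∑ i, H i j * z s i) ^ 2 := by
        intro s j
        have : ∑ i, (θ + ε • H) i j * z s i = ∑ i, θ i j * z s i + ε * ∑ i, H i j * z s i := by
          rw [Finset.mul_sum, ← Finset.sum_add_distrib]
          refine Finset.sum_congr rfl fun i _ => ?_
          simp only [Matrix.add_apply, Matrix.smul_apply, smul_eq_mul]; ring
        rw [this]; ring
      have e2 : ∀ i j, (θ + ε • H) i j ^ 2 =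
          θ i j ^ 2 + 2 * ε * (θ i j * H i j) + ε * ε * H i j ^ 2 := by
        intro i j
        simp only [Matrix.add_apply, Matrix.smul_apply, smul_eq_mul]; ring
      simp only [e1, e2, Finset.sum_add_distrib, ← Finset.mul_sum]
      ring
    have hd : ∀ ε : ℝ, 0 ≤ Q * (ε * ε) + (-2 * L) * ε + 0 := by
      intro ε
      have h1 := hθ (mem_univ (θ + ε • H))
      simp only [mem_ofPred_eq] at h1
      rw [hexp] at h1
      linarith
    have := discrim_le_zero hd
    unfold discrim at this
    have : L ^ 2 ≤ 0 := by nlinarith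
    exact pow_eq_zero_iff two_ne_zero |>.1 (le_antisymm this (sq_nonneg L))
  -- Testing against an elementary matrix extracts a single entry.
  have h := hlin (Matrix.single i j 1)
  have e1 : ∀ s j', ∑ i', Matrix.single i j (1 : ℝ) i' j' * z s i' = if j = j' then z s i else 0 := by
    intro s j'
    by_cases hj : j = j' <;> simp [Matrix.single_apply, hj]
  have e2 : ∑ i', ∑ j', θ i' j' * Matrix.single i j (1 : ℝ) i' j' = θ i j := by
    simp [Matrix.single_apply, ite_and]
  simp only [e1, e2, mul_ite, mul_zero, Finset.sum_ite_eq, Finset.mem_univ, if_true] at h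
  have h3 : (gram sys.γ z t *ᵥ fun i => θ i j) i =
      sys.γ * θ i j + ∑ s ∈ Finset.range t, (∑ i', θ i' j * z s i') * z s i := by
    rw [gram, Matrix.add_mulVec, Matrix.smul_mulVec, Matrix.one_mulVec, Matrix.sum_mulVec]
    simp [Matrix.vecMulVec_mulVec, Finset.sum_apply, dotProduct, mul_comm]
  rw [h3, noiseSum, Finset.sum_apply]
  simp only [Pi.smul_apply, smul_eq_mul]
  simp only [sub_mul, Finset.sum_sub_distrib] at h
  linarith

end LeastSquares

/-- The regressors `ψ(X(s), U(s))` along a trajectory. -/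
abbrev regressor {Ω : Type*} (sys : Sys n m q d) (X : ℕ → Ω → Vec n) (U : ℕ → Ω → Vec m) (ω : Ω)
    (s : ℕ) : Fin d → ℝ := (sys.ψ (X s ω) (U s ω)).ofLp

/-- The `j`-th coordinate of the process noise, shifted to start at index `0`. -/
abbrev noiseCoord {Ω : Type*} {sys : Sys n m q d} (W : ℕ → Ω → sys.𝕎) (j : Fin n) (ω : Ω)
    (s : ℕ) : ℝ := (W (s + 1) ω : Vec n) j

/-! ### Closed-loop identities and the deterministic error bound -/

section ClosedLoop

variable {Ω : Type*} {sys : Sys n m q d} {x₀ : Vec n}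
    {W : ℕ → Ω → sys.𝕎} {S : ℕ → Ω → sys.𝕊}
    {X : ℕ → Ω → Vec n} {U : ℕ → Ω → Vec m} {est : ℕ → Ω → Param d n}

theorem Sys.IsClosedLoop.state_mem (h : sys.IsClosedLoop x₀ W S X U est) (hsys : sys.WellPosed)
    (hx₀ : x₀ ∈ sys.𝕏) (t : ℕ) (ω : Ω) : X t ω ∈ sys.𝕏 := by
  induction t with
  | zero => rw [h.init]; exact hx₀
  | succ t ih =>
    rw [h.step]
    refine hsys.g_mem _ ih _ ?_ _ (W (t + 1) ω).2
    rw [h.control]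
    exact hsys.α_mem _ ih _ (S t ω).2 _

theorem Sys.IsClosedLoop.control_mem (h : sys.IsClosedLoop x₀ W S X U est) (hsys : sys.WellPosed)
    (hx₀ : x₀ ∈ sys.𝕏) (t : ℕ) (ω : Ω) : U t ω ∈ sys.𝕌 := by
  rw [h.control]
  exact hsys.α_mem _ (h.state_mem hsys hx₀ t ω) _ (S t ω).2 _

theorem Sys.IsClosedLoop.state_eq_φ (h : sys.IsClosedLoop x₀ W S X U est) (t : ℕ) (ω : Ω) :
    X t ω = sys.φ x₀ (fun s => U s ω) (fun s => W s ω) t := by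
  induction t with
  | zero => rw [h.init]; rfl
  | succ t ih => rw [h.step, ih]; rfl

theorem Sys.IsClosedLoop.gram_mulVec_est (h : sys.IsClosedLoop x₀ W S X U est) {t : ℕ}
    (ht : 1 ≤ t) (ω : Ω) (j : Fin n) :
    gram sys.γ (regressor sys X U ω) t *ᵥ (fun i => est t ω i j) =
      noiseSum (regressor sys X U ω)
        (fun s => (X (s + 1) ω - sys.f (X s ω) (U s ω)) j) t :=
  normal_equations sys _ _ t _ (h.est_min t ht ω) j

/-- Makes the minimiser an explicit function of the data, from which its measurability follows. -/
theorem Sys.IsClosedLoop.est_apply (h : sys.IsClosedLoop x₀ W S X U est) (hγ : 0 < sys.γ) {t : ℕ}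
    (ht : 1 ≤ t) (ω : Ω) (i : Fin d) (j : Fin n) :
    est t ω i j = ((gram sys.γ (regressor sys X U ω) t)⁻¹ *ᵥ noiseSum (regressor sys X U ω)
        (fun s => (X (s + 1) ω - sys.f (X s ω) (U s ω)) j) t) i := by
  rw [← h.gram_mulVec_est ht, inv_mulVec_mulVec (gram_posDef hγ _ _)]

/-- Since `X (s + 1) - f = θ_*ᵀ ψ + W (s + 1)`, the true parameter contributes `(G - γ I) θ_*` to
the right-hand side of the normal equations; subtracting `G θ_*` leaves the noise and the bias `-γ
θ_*`. -/
theorem Sys.IsClosedLoop.gram_mulVec_error (h : sys.IsClosedLoop x₀ W S X U est) {t : ℕ}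
    (ht : 1 ≤ t) (ω : Ω) (j : Fin n) :
    gram sys.γ (regressor sys X U ω) t *ᵥ (fun i => (est t ω - sys.θstar) i j) =
      noiseSum (regressor sys X U ω) (noiseCoord W j ω) t -
        sys.γ • fun i => sys.θstar i j := by
  have e : (fun i => (est t ω - sys.θstar) i j) =
      (fun i => est t ω i j) - fun i => sys.θstar i j := rfl
  rw [e, Matrix.mulVec_sub, h.gram_mulVec_est ht]
  have e2 : gram sys.γ (regressor sys X U ω) t *ᵥ (fun i => sys.θstar i j) =
      sys.γ • (fun i => sys.θstar i j) + ∑ s ∈ Finset.range t,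
        ((fun i => sys.θstar i j) ⬝ᵥ regressor sys X U ω s) • regressor sys X U ω s := by
    rw [gram, Matrix.add_mulVec, Matrix.smul_mulVec, Matrix.one_mulVec, Matrix.sum_mulVec]
    congr 1
    refine Finset.sum_congr rfl fun s _ => ?_
    rw [Matrix.vecMulVec_mulVec, dotProduct_comm]
    ext i
    simp [mul_comm]
  rw [e2, sub_add_eq_sub_sub, sub_right_comm]
  congr 1
  rw [noiseSum, noiseSum, ← Finset.sum_sub_distrib]
  refine Finset.sum_congr rfl fun s _ => ?_
  rw [← sub_smul]
  congr 1
  rw [h.step]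
  simp only [Sys.g, PiLp.sub_apply, PiLp.add_apply, applyT_apply]
  ring

theorem specNorm_le_sqrt_sum (A : Param d n) :
    specNorm A ≤ Real.sqrt (∑ j, (fun i => A i j) ⬝ᵥ fun i => A i j) := by
  refine ContinuousLinearMap.opNorm_le_bound _ (Real.sqrt_nonneg _) fun x => ?_
  rw [EuclideanSpace.norm_eq, EuclideanSpace.norm_eq, ← Real.sqrt_mul
    (Finset.sum_nonneg fun j _ => by simpa using dotProduct_star_self_nonneg (fun i => A i j))]
  refine Real.sqrt_le_sqrt ?_
  have h : ∀ i, ‖(LinearMap.toContinuousLinearMap (Matrix.toEuclideanLin A) x) i‖ ^ 2 ≤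
      (∑ j, A i j ^ 2) * ∑ j, ‖x j‖ ^ 2 := by
    intro i
    have := Finset.sum_mul_sq_le_sq_mul_sq Finset.univ (A i) x.ofLp
    simpa [Matrix.toLpLin_apply, Matrix.mulVec, dotProduct] using this
  refine (Finset.sum_le_sum fun i _ => h i).trans_eq ?_
  rw [← Finset.sum_mul, Finset.sum_comm]
  simp [dotProduct, sq]

theorem frobNorm_eq_sqrt_sum (A : Param d n) :
    frobNorm A = Real.sqrt (∑ j, (fun i => A i j) ⬝ᵥ fun i => A i j) := by
  rw [frobNorm, Finset.sum_comm]
  simp [dotProduct, sq]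

theorem Sys.IsClosedLoop.specNorm_error_le (h : sys.IsClosedLoop x₀ W S X U est) (hγ : 0 < sys.γ)
    {t : ℕ} (ht : 1 ≤ t) (ω : Ω) {l K : ℝ} (hl : 0 ≤ l)
    (hexc : ∀ x : Fin d → ℝ, l * (x ⬝ᵥ x) ≤
      ∑ s ∈ Finset.range t, (x ⬝ᵥ regressor sys X U ω s) ^ 2)
    (hK : ∀ j, noiseSum (regressor sys X U ω) (noiseCoord W j ω) t ⬝ᵥ
      ((gram sys.γ (regressor sys X U ω) t)⁻¹ *ᵥ
        noiseSum (regressor sys X U ω) (noiseCoord W j ω) t) ≤ K) :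
    specNorm (est t ω - sys.θstar) ≤ 1 / Real.sqrt (l + sys.γ) *
      (Real.sqrt sys.γ * frobNorm sys.θstar + Real.sqrt (n * K)) := by
  refine (specNorm_le_sqrt_sum _).trans ?_
  rw [frobNorm_eq_sqrt_sum]
  have := le_div_sqrt_of_normal_equations (gram_posDef hγ (regressor sys X U ω) t) hγ
    (l := l + sys.γ) (by positivity) _ _ (fun j i => sys.θstar i j)
    (fun j => h.gram_mulVec_error ht ω j) (fun x => ?_) (fun x => ?_) hK
  · simpa using this
  · rw [quadForm_gram]
    exact le_add_of_nonneg_right (Finset.sum_nonneg fun s _ => sq_nonneg _)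
  · rw [quadForm_gram]
    linarith [hexc x]

end ClosedLoop

/-! ### Measurability and adaptedness of the closed loop -/

section Measurability

variable {Ω : Type*} {mΩ : MeasurableSpace Ω} {sys : Sys n m q d} {x₀ : Vec n}
    {W : ℕ → Ω → sys.𝕎} {S : ℕ → Ω → sys.𝕊}
    {X : ℕ → Ω → Vec n} {U : ℕ → Ω → Vec m} {est : ℕ → Ω → Param d n}

theorem Sys.MeasurableMaps.comp_f (hmeas : sys.MeasurableMaps) {x : Ω → Vec n} {u : Ω → Vec m}
    (hx : Measurable x) (hu : Measurable u) (hx' : ∀ ω, x ω ∈ sys.𝕏) (hu' : ∀ ω, u ω ∈ sys.𝕌) :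
    Measurable fun ω => sys.f (x ω) (u ω) :=
  hmeas.f.comp ((hx.subtype_mk (h := hx')).prodMk (hu.subtype_mk (h := hu')))

theorem Sys.MeasurableMaps.comp_ψ (hmeas : sys.MeasurableMaps) {x : Ω → Vec n} {u : Ω → Vec m}
    (hx : Measurable x) (hu : Measurable u) (hx' : ∀ ω, x ω ∈ sys.𝕏) (hu' : ∀ ω, u ω ∈ sys.𝕌) :
    Measurable fun ω => sys.ψ (x ω) (u ω) :=
  hmeas.ψ.comp ((hx.subtype_mk (h := hx')).prodMk (hu.subtype_mk (h := hu')))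

theorem Sys.MeasurableMaps.comp_α (hmeas : sys.MeasurableMaps) {x : Ω → Vec n} {s : Ω → sys.𝕊}
    {ϑ : Ω → Param d n} (hx : Measurable x) (hs : Measurable s) (hϑ : Measurable ϑ)
    (hx' : ∀ ω, x ω ∈ sys.𝕏) :
    Measurable fun ω => sys.α (x ω) (s ω) (ϑ ω) :=
  hmeas.α.comp ((hx.subtype_mk (h := hx')).prodMk (hs.prodMk hϑ))

theorem measurable_applyT (θ : Param d n) : Measurable (applyT θ) :=
  (LinearMap.continuous_of_finiteDimensional (Matrix.toEuclideanLin θᵀ)).measurable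

theorem Sys.MeasurableMaps.comp_g (hmeas : sys.MeasurableMaps) {x : Ω → Vec n} {u : Ω → Vec m}
    {w : Ω → Vec n} (hx : Measurable x) (hu : Measurable u) (hw : Measurable w)
    (hx' : ∀ ω, x ω ∈ sys.𝕏) (hu' : ∀ ω, u ω ∈ sys.𝕌) :
    Measurable fun ω => sys.g (x ω) (u ω) (w ω) :=
  ((hmeas.comp_f hx hu hx' hu').add
    ((measurable_applyT _).comp (hmeas.comp_ψ hx hu hx' hu'))).add hw

/-- States, controls and estimates feed each other, hence the joint induction. The σ-algebra on `Ω`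
is arbitrary: taking it to be `noisePast` yields adaptedness. -/
theorem Sys.IsClosedLoop.measurable_aux (h : sys.IsClosedLoop x₀ W S X U est)
    (hsys : sys.WellPosed) (hmeas : sys.MeasurableMaps) (hx₀ : x₀ ∈ sys.𝕏) (t : ℕ)
    (hW : ∀ k < t, Measurable (W (k + 1))) (hS : ∀ k < t, Measurable (S k)) :
    (∀ s ≤ t, Measurable (X s)) ∧ (∀ s < t, Measurable (U s)) ∧ ∀ s ≤ t, Measurable (est s) := by
  have hXm := h.state_mem hsys hx₀
  have hUm := h.control_mem hsys hx₀
  induction t with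
  | zero =>
    refine ⟨fun s hs => ?_, fun s hs => absurd hs (by omega), fun s hs => ?_⟩
    · obtain rfl : s = 0 := by omega
      rw [show X 0 = fun _ => x₀ from funext h.init]
      exact measurable_const
    · obtain rfl : s = 0 := by omega
      rw [show est 0 = fun _ => sys.ϑ₀ from funext h.est_zero]
      exact measurable_const
  | succ t ih =>
    obtain ⟨hX, hU, hest⟩ := ih (fun k hk => hW k (by omega)) (fun k hk => hS k (by omega))
    have hUt : Measurable (U t) := by
      rw [show U t = fun ω => sys.α (X t ω) (S t ω) (est (t - 1) ω) from funext (h.control t)]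
      exact hmeas.comp_α (hX t le_rfl) (hS t (by omega)) (hest (t - 1) (by omega)) (hXm t)
    have hU' : ∀ s < t + 1, Measurable (U s) := fun s hs => by
      rcases Nat.lt_succ_iff_lt_or_eq.1 hs with h1 | rfl
      · exact hU s h1
      · exact hUt
    have hXt : Measurable (X (t + 1)) := by
      rw [show X (t + 1) = fun ω => sys.g (X t ω) (U t ω) (W (t + 1) ω) from funext (h.step t)]
      exact hmeas.comp_g (hX t le_rfl) hUt (measurable_subtype_coe.comp (hW t (by omega)))
        (hXm t) (hUm t)
    have hX' : ∀ s ≤ t + 1, Measurable (X s) := fun s hs => by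
      rcases Nat.le_succ_iff.1 hs with h1 | rfl
      · exact hX s h1
      · exact hXt
    refine ⟨hX', hU', fun s hs => ?_⟩
    rcases Nat.le_succ_iff.1 hs with h1 | rfl
    · exact hest s h1
    · refine measurable_pi_lambda (X := fun _ : Fin d => Fin n → ℝ) _ fun i =>
        measurable_pi_lambda _ fun j => ?_
      simp only [h.est_apply hsys.γ_pos (Nat.succ_le_succ (Nat.zero_le t))]
      have hz : ∀ s < t + 1, Measurable fun ω => regressor sys X U ω s := fun s hs =>
        (WithLp.measurable_ofLp 2 _).comp (hmeas.comp_ψ (hX' s hs.le) (hU' s hs) (hXm s) (hUm s))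
      refine measurable_pi_iff.1 (measurable_inv_mulVec
        (measurable_gram_apply _ hz) (measurable_noiseSum hz fun s hs => ?_)) i
      exact measurable_pi_iff.1 ((WithLp.measurable_ofLp 2 _).comp
        ((hX' (s + 1) hs).sub (hmeas.comp_f (hX' s hs.le) (hU' s hs) (hXm s) (hUm s)))) j

theorem Sys.IsClosedLoop.measurable_control (h : sys.IsClosedLoop x₀ W S X U est)
    (hsys : sys.WellPosed) (hmeas : sys.MeasurableMaps) (hx₀ : x₀ ∈ sys.𝕏) (t : ℕ)
    (hW : ∀ k < t, Measurable (W (k + 1))) (hS : ∀ k ≤ t, Measurable (S k)) :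
    Measurable (U t) := by
  obtain ⟨hX, -, hest⟩ := h.measurable_aux hsys hmeas hx₀ t hW fun k hk => hS k hk.le
  rw [show U t = fun ω => sys.α (X t ω) (S t ω) (est (t - 1) ω) from funext (h.control t)]
  exact hmeas.comp_α (hX t le_rfl) (hS t le_rfl) (hest (t - 1) (by omega))
    (h.state_mem hsys hx₀ t)

theorem Sys.IsClosedLoop.measurable_regressor (h : sys.IsClosedLoop x₀ W S X U est)
    (hsys : sys.WellPosed) (hmeas : sys.MeasurableMaps) (hx₀ : x₀ ∈ sys.𝕏) (t : ℕ)
    (hW : ∀ k < t, Measurable (W (k + 1))) (hS : ∀ k ≤ t, Measurable (S k)) :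
    Measurable fun ω => regressor sys X U ω t :=
  (WithLp.measurable_ofLp 2 _).comp (hmeas.comp_ψ
    ((h.measurable_aux hsys hmeas hx₀ t hW fun k hk => hS k hk.le).1 t le_rfl)
    (h.measurable_control hsys hmeas hx₀ t hW hS) (h.state_mem hsys hx₀ t)
    (h.control_mem hsys hx₀ t))

end Measurability

/-! ### Self-normalised and counting bounds for adapted processes -/

section Concentration

variable {Ω : Type*} {mΩ : MeasurableSpace Ω} {P : Measure Ω} [IsProbabilityMeasure P]

theorem indepFun_of_indep {α β : Type*} [MeasurableSpace α] [MeasurableSpace β]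
    {F : MeasurableSpace Ω} {H : Ω → α} {ξ : Ω → β}
    (hind : Indep F (MeasurableSpace.comap ξ inferInstance) P) (hH : Measurable[F] H) :
    IndepFun H ξ P := by
  rw [IndepFun_iff_Indep]
  exact indep_of_indep_of_le_left hind hH.comap_le

theorem lintegral_exp_le_one_of_subgaussian {Y : Ω → ℝ} {σ : ℝ≥0} (hσ : σ ≠ 0)
    (h : HasSubgaussianMGF Y (σ ^ 2) P) (a : ℝ) :
    ∫⁻ ω, ENNReal.ofReal (Real.exp (a * (Y ω / σ) - a ^ 2 / 2)) ∂P ≤ 1 := by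
  have hσ' : (σ : ℝ) ≠ 0 := by exact_mod_cast hσ
  have e : ∀ ω, Real.exp (a * (Y ω / σ) - a ^ 2 / 2) =
      Real.exp (a / σ * Y ω) * Real.exp (-(a ^ 2 / 2)) := fun ω => by
    rw [← Real.exp_add]; congr 1; ring
  simp only [e]
  have hint := (h.integrable_exp_mul (a / σ)).mul_const (Real.exp (-(a ^ 2 / 2)))
  rw [← ofReal_integral_eq_lintegral_ofReal hint (ae_of_all _ fun ω => by positivity),
    integral_mul_const]
  refine ENNReal.ofReal_le_one.2 ?_
  have h1 := h.mgf_le (a / σ)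
  unfold mgf at h1
  refine (mul_le_mul_of_nonneg_right h1 (Real.exp_nonneg _)).trans_eq ?_
  rw [← Real.exp_add, Real.exp_eq_one_iff]
  push_cast
  field_simp
  ring

/-- Self-normalised bound, uniformly in time, for a scalar noise sequence. -/
theorem measure_exists_quadForm_gt_le {ι : Type*} [Fintype ι] [DecidableEq ι]
    {F : ℕ → MeasurableSpace Ω} (hF : ∀ t, F t ≤ mΩ) {z : Ω → ℕ → ι → ℝ} {w : Ω → ℕ → ℝ}
    (hz : ∀ t, ∀ s ≤ t, Measurable[F t] fun ω => z ω s)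
    (hw : ∀ t, ∀ s < t, Measurable[F t] fun ω => w ω s)
    (hind : ∀ t, Indep (F t) (MeasurableSpace.comap (fun ω => w ω t) inferInstance) P)
    {σ : ℝ≥0} (hsub : ∀ t, HasSubgaussianMGF (fun ω => w ω t) (σ ^ 2) P) {γ δ : ℝ} (hγ : 0 < γ)
    (hδ : 0 < δ) :
    P {ω | ∃ t, 2 * (σ : ℝ) ^ 2 * (Real.log (1 / δ) +
        1 / 2 * Real.log ((gram γ (z ω) t).det / γ ^ Fintype.card ι)) <
      noiseSum (z ω) (w ω) t ⬝ᵥ ((gram γ (z ω) t)⁻¹ *ᵥ noiseSum (z ω) (w ω) t)} ≤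
      ENNReal.ofReal δ := by
  -- Scaling by `σ` is impossible here, but the noise vanishes almost surely and both sides of the
  -- inequality are 0.
  rcases eq_or_ne σ 0 with rfl | hσ
  · have h0 : ∀ᵐ ω ∂P, ∀ t, w ω t = 0 := ae_all_iff.2 fun t => by
      have h1 := hsub t
      rw [zero_pow two_ne_zero] at h1
      exact h1.ae_eq_zero_of_hasSubgaussianMGF_zero
    refine le_of_eq_of_le ?_ zero_le
    refine measure_mono_null ?_ (ae_iff.1 h0)
    rintro ω ⟨t, ht⟩ hω
    have : noiseSum (z ω) (w ω) t = 0 := by simp [noiseSum, hω]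
    simp [this] at ht
  have hσ' : (0 : ℝ) < σ := by positivity
  set q : ℕ → Ω → ℝ := fun t ω =>
    noiseSum (z ω) (w ω) t ⬝ᵥ ((gram γ (z ω) t)⁻¹ *ᵥ noiseSum (z ω) (w ω) t) with hq
  set s : ℕ → Ω → ℝ := fun t ω => z ω t ⬝ᵥ ((gram γ (z ω) t)⁻¹ *ᵥ noiseSum (z ω) (w ω) t) with hs
  set v : ℕ → Ω → ℝ := fun t ω => z ω t ⬝ᵥ ((gram γ (z ω) t)⁻¹ *ᵥ z ω t) with hv
  -- The supermartingale. It equals 1 at time 0, and the rank-one update formulas turn its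
  -- successive ratios into `selfNormIncr` of the noise scaled by `σ`.
  set M' : ℕ → Ω → ℝ := fun t ω => Real.sqrt (γ ^ Fintype.card ι / (gram γ (z ω) t).det) *
    Real.exp (q t ω / (2 * σ ^ 2)) with hM'
  set M : ℕ → Ω → ℝ≥0∞ := fun t ω => ENNReal.ofReal (M' t ω) with hM
  have hpd : ∀ t ω, (gram γ (z ω) t).PosDef := fun t ω => gram_posDef hγ _ _
  have hvnn : ∀ t ω, 0 ≤ v t ω := fun t ω => by
    simpa using (hpd t ω).inv.posSemidef.dotProduct_mulVec_nonneg (z ω t)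
  have hv0 : ∀ t ω, v t ω = 0 → s t ω = 0 := by
    intro t ω h
    have hz0 : z ω t = 0 := by
      by_contra hne
      have := (hpd t ω).inv.dotProduct_mulVec_pos hne
      rw [star_trivial] at this
      exact this.ne' h
    simp [hs, hz0]
  have hrec : ∀ t ω, M (t + 1) ω =
      M t ω * ENNReal.ofReal (selfNormIncr (w ω t / σ) (s t ω / σ) (v t ω)) := by
    intro t ω
    have hdet := (hpd t ω).det_pos
    have hv1 : 0 < 1 + v t ω := by linarith [hvnn t ω]
    rw [hM]
    simp only
    rw [← ENNReal.ofReal_mul (by positivity)]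
    congr 1
    simp only [hM', selfNormIncr]
    have e1 : q (t + 1) ω = q t ω + (2 * w ω t * s t ω + w ω t ^ 2 * v t ω - s t ω ^ 2) /
        (1 + v t ω) := by
      simp only [hq, gram_succ, noiseSum_succ]
      exact quadForm_inv_update (hpd t ω) _ _ _
    have e2 : (gram γ (z ω) (t + 1)).det = (gram γ (z ω) t).det * (1 + v t ω) := by
      rw [gram_succ]
      exact det_add_vecMulVec_self (hpd t ω) _
    have e3 : ∀ A B C D E : ℝ, D = B + E → A * (1 / C) * Real.exp D =
        A * Real.exp B * (1 / C * Real.exp E) := by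
      rintro A B C _ E rfl
      rw [Real.exp_add]; ring
    rw [e1, e2, ← div_div, Real.sqrt_div' _ hv1.le, div_eq_mul_one_div _ (Real.sqrt _)]
    refine e3 _ _ _ _ _ ?_
    field_simp

  have hz' : ∀ t, ∀ s < t, Measurable[F t] fun ω => z ω s := fun t s hs => hz t s hs.le
  have hG : ∀ t i j, Measurable[F t] fun ω => gram γ (z ω) t i j := fun t =>
    measurable_gram_apply γ (hz' t)
  have hb : ∀ t, Measurable[F t] fun ω => noiseSum (z ω) (w ω) t := fun t =>
    measurable_noiseSum (hz' t) (hw t)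
  have hsM : ∀ t, Measurable[F t] (s t) := fun t =>
    measurable_dotProduct (hz t t le_rfl) (measurable_inv_mulVec (hG t) (hb t))
  have hvM : ∀ t, Measurable[F t] (v t) := fun t =>
    measurable_dotProduct (hz t t le_rfl) (measurable_inv_mulVec (hG t) (hz t t le_rfl))
  have hqM : ∀ t, Measurable[F t] (q t) := fun t =>
    measurable_dotProduct (hb t) (measurable_inv_mulVec (hG t) (hb t))
  have hMM : ∀ t, Measurable[F t] (M t) := fun t =>
    (((measurable_const.div (measurable_det (hG t))).sqrt).mul
      ((hqM t).div_const _).exp).ennreal_ofReal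
  have hmono : ∀ t, ∀ r ≤ t, Measurable[F t] (M r) := fun t r hr => by
    have hz'' : ∀ s < r, Measurable[F t] fun ω => z ω s := fun s hs => hz t s (hs.le.trans hr)
    have hw'' : ∀ s < r, Measurable[F t] fun ω => w ω s := fun s hs => hw t s (hs.trans_le hr)
    have hG' : ∀ i j, Measurable[F t] fun ω => gram γ (z ω) r i j := measurable_gram_apply γ hz''
    have hb' := measurable_noiseSum hz'' hw''
    exact (((measurable_const.div (measurable_det hG')).sqrt).mul
      ((measurable_dotProduct hb' (measurable_inv_mulVec hG' hb')).div_const _).exp).ennreal_ofReal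
  have hwm : ∀ t, Measurable fun ω => w ω t := fun t =>
    (hw (t + 1) t t.lt_succ_self).mono (hF (t + 1)) le_rfl
  set a : ℝ≥0∞ := ENNReal.ofReal (1 / δ) with ha
  have hville := measure_exists_ge_le (P := P) M (fun t => (hMM t).mono (hF t) le_rfl)
    (by
      have : ∀ ω, M 0 ω = 1 := fun ω => by
        simp only [hM, hM', hq, gram_zero, noiseSum]
        simp [hγ.ne']
      simp [this]) a (fun t => by
      set A := {ω | ∀ s ≤ t, M s ω < a} with hA
      have hAm : MeasurableSet[F t] A := by
        have : A = ⋂ s, ⋂ (_ : s ≤ t), {ω | M s ω < a} := by ext; simp [hA]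
        rw [this]
        exact MeasurableSet.iInter fun s => MeasurableSet.iInter fun hs =>
          measurableSet_lt (hmono t s hs) measurable_const
      have hAm' : MeasurableSet A := hF t _ hAm
      rw [← lintegral_indicator hAm', ← lintegral_indicator hAm']
      -- All that the increment needs from the past, including the restriction to paths still below
      -- `a`; the scaled noise is independent of it.
      set H : Ω → ℝ≥0∞ × ℝ × ℝ := fun ω => (A.indicator (M t) ω, s t ω / σ, v t ω)
      have hH : Measurable[F t] H :=
        ((hMM t).indicator hAm).prodMk (((hsM t).div_const _).prodMk (hvM t))
      have hξ : Measurable fun ω => w ω t / σ := (hwm t).div_const _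
      have hindep : IndepFun H (fun ω => w ω t / σ) P :=
        (indepFun_of_indep (hind t) hH).comp measurable_id (measurable_id.div_const _)
      have hFm : Measurable fun x : (ℝ≥0∞ × ℝ × ℝ) × ℝ =>
          x.1.1 * ENNReal.ofReal (selfNormIncr x.2 x.1.2.1 x.1.2.2) := by
        unfold selfNormIncr; fun_prop
      have e1 : ∀ ω, A.indicator (M (t + 1)) ω = (H ω).1 * ENNReal.ofReal
          (selfNormIncr (w ω t / σ) (H ω).2.1 (H ω).2.2) := fun ω => by
        by_cases hω : ω ∈ A
        · simp [H, hω, hrec]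
        · simp [H, hω]
      simp only [e1]
      rw [lintegral_comp_prodMk_of_indepFun (hH.mono (hF t) le_rfl) hξ hindep hFm]
      refine lintegral_mono fun ω => ?_
      have hm1 : Measurable fun y => ENNReal.ofReal (selfNormIncr y (H ω).2.1 (H ω).2.2) := by
        unfold selfNormIncr; fun_prop
      simp only
      rw [lintegral_const_mul _ hm1]
      refine mul_le_of_le_one_right' ?_
      have : IsProbabilityMeasure (P.map fun ω => w ω t / σ) :=
        Measure.isProbabilityMeasure_map hξ.aemeasurable
      refine lintegral_selfNormIncr_le_one _ (fun b => ?_) (hvnn t ω) fun h => ?_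
      · rw [lintegral_map (by fun_prop) hξ]
        exact lintegral_exp_le_one_of_subgaussian hσ (hsub t) b
      · simp [H, hv0 t ω h])
  have ha0 : a ≠ 0 := by simp [ha, hδ]
  rw [mul_comm, ← ENNReal.le_div_iff_mul_le (Or.inl ha0) (Or.inl ENNReal.ofReal_ne_top)] at hville
  refine (measure_mono ?_).trans (hville.trans_eq ?_)
  · rintro ω ⟨t, ht⟩
    refine ⟨t, ENNReal.ofReal_le_ofReal ?_⟩
    have hdet := (hpd t ω).det_pos
    have hpow : 0 < γ ^ Fintype.card ι := by positivity
    set D := (gram γ (z ω) t).det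
    -- On exponentiation the term in the determinant becomes `√(D / γ^d)`, which cancels the
    -- prefactor of `M'` and leaves `M' ≥ 1 / δ`.
    have h1 : Real.log (1 / δ) + 1 / 2 * Real.log (D / γ ^ Fintype.card ι) ≤
        q t ω / (2 * σ ^ 2) := by
      rw [le_div_iff₀ (by positivity), mul_comm]
      exact ht.le
    have h2 := Real.exp_le_exp.2 h1
    rw [Real.exp_add, Real.exp_log (by positivity), mul_comm (1 / 2 : ℝ),
      ← div_eq_mul_one_div, ← Real.log_sqrt (by positivity), Real.exp_log (by positivity)] at h2
    have h3 : Real.sqrt (γ ^ Fintype.card ι / D) * Real.sqrt (D / γ ^ Fintype.card ι) = 1 := by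
      rw [← Real.sqrt_mul (by positivity), div_mul_div_comm, mul_comm D, div_self (by positivity),
        Real.sqrt_one]
    calc 1 / δ = Real.sqrt (γ ^ Fintype.card ι / D) *
          (1 / δ * Real.sqrt (D / γ ^ Fintype.card ι)) := by
          rw [mul_left_comm, h3, mul_one]
      _ ≤ M' t ω := mul_le_mul_of_nonneg_left h2 (Real.sqrt_nonneg _)
  · rw [ha, one_div, one_div, ENNReal.ofReal_inv_of_pos hδ, inv_inv]

open Classical in
/-- Lower tail bound for the number of times an event of conditional probability at least `p`
occurs. -/
theorem measure_card_le_half_le_of_indep {α β : Type*} [MeasurableSpace α] [MeasurableSpace β]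
    {F : ℕ → MeasurableSpace Ω} (hF : ∀ t, F t ≤ mΩ) {H : ℕ → Ω → α} {ξ : ℕ → Ω → β}
    (hH : ∀ t, Measurable[F t] (H t)) (hξ : ∀ t, Measurable (ξ t))
    (hξF : ∀ t, ∀ s < t, MeasurableSpace.comap (ξ s) inferInstance ≤ F t)
    (hHF : ∀ t, ∀ s ≤ t, Measurable[F t] (H s))
    (hind : ∀ t, Indep (F t) (MeasurableSpace.comap (ξ t) inferInstance) P)
    {D : Set (α × β)} (hD : MeasurableSet D) {p : ℝ}
    (hp : ∀ t a, ENNReal.ofReal p ≤ P.map (ξ t) {y | (a, y) ∈ D}) (N : ℕ) :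
    P {ω | (((Finset.range N).filter fun i => (H i ω, ξ i ω) ∈ D).card : ℝ) ≤ N * (p / 2)} ≤
      ENNReal.ofReal (Real.exp (-(N * ((1 - Real.log 2) * p / 2)))) := by
  have hmB : ∀ t, ∀ s < t, MeasurableSet[F t] {ω | (H s ω, ξ s ω) ∈ D} := fun t s hs =>
    ((hHF t s hs.le).prodMk ((comap_measurable (ξ s)).mono (hξF t s hs) le_rfl)) hD
  have hmeas : ∀ t, MeasurableSet {ω | (H t ω, ξ t ω) ∈ D} := fun t =>
    (((hH t).mono (hF t) le_rfl).prodMk (hξ t)) hD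
  refine measure_card_le_half_le (fun k => {ω | (H k ω, ξ k ω) ∈ D}) hmeas (fun k => ?_) N
  set Q : Ω → ℝ≥0∞ := fun ω => ∏ i ∈ Finset.range k,
    if ω ∈ {ω | (H i ω, ξ i ω) ∈ D} then (2 : ℝ≥0∞)⁻¹ else 1 with hQ
  have hQm : Measurable[F k] Q := Finset.measurable_fun_prod _ fun i hi =>
    Measurable.ite (hmB k i (Finset.mem_range.1 hi)) measurable_const measurable_const
  have hpair : Measurable[F k] fun ω => (Q ω, H k ω) := hQm.prodMk (hH k)
  have hFm : Measurable fun x : (ℝ≥0∞ × α) × β =>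
      x.1.1 * if (x.1.2, x.2) ∈ D then (2 : ℝ≥0∞)⁻¹ else 1 := by
    refine measurable_fst.fst.mul (Measurable.ite ?_ measurable_const measurable_const)
    exact (measurable_fst.snd.prodMk measurable_snd) hD
  have := lintegral_comp_prodMk_of_indepFun (hpair.mono (hF k) le_rfl) (hξ k)
    (indepFun_of_indep (hind k) hpair) hFm
  refine this.le.trans ?_
  rw [← lintegral_const_mul _ (hQm.mono (hF k) le_rfl)]
  refine lintegral_mono fun ω => ?_
  have hDa : MeasurableSet {y | (H k ω, y) ∈ D} := measurable_prodMk_left hD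
  have hpm : IsProbabilityMeasure (P.map (ξ k)) := Measure.isProbabilityMeasure_map (hξ k).aemeasurable
  rw [lintegral_const_mul _ (Measurable.ite hDa measurable_const measurable_const),
    mul_comm (ENNReal.ofReal _)]
  refine mul_le_mul_right ?_ _
  have hle := hp k (H k ω)
  set ν := P.map (ξ k)
  set E := {y | (H k ω, y) ∈ D} with hE
  have e : ∀ y, (if (H k ω, y) ∈ D then (2 : ℝ≥0∞)⁻¹ else 1) =
      E.indicator (fun _ => (2 : ℝ≥0∞)⁻¹) y + Eᶜ.indicator 1 y := fun y => by
    by_cases hy : (H k ω, y) ∈ D <;> simp [hE, hy]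
  simp only [e]
  rw [lintegral_add_left (measurable_const.indicator hDa), lintegral_indicator_const hDa,
    lintegral_indicator_one hDa.compl, prob_compl_eq_one_sub hDa]
  have hx1 : ν E ≤ 1 := prob_le_one
  have hxt : ν E ≠ ⊤ := measure_ne_top _ _
  lift ν E to ℝ≥0 using hxt with x
  have hx1' : (x : ℝ) ≤ 1 := by exact_mod_cast hx1
  have hle' : p ≤ x := by
    have := ENNReal.toReal_mono ENNReal.coe_ne_top hle
    rcases le_total 0 p with h | h
    · rwa [ENNReal.toReal_ofReal h, ENNReal.coe_toReal] at this
    · exact h.trans x.2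
  -- The conditional mean of the new factor is `1 - x / 2 ≤ 1 - p / 2 ≤ exp (-p / 2)`.
  have e2 : (2 : ℝ≥0∞)⁻¹ * x + (1 - x) = ENNReal.ofReal (1 - x / 2) := by
    rw [← ENNReal.ofReal_coe_nnreal, ← ENNReal.ofReal_one, ← ENNReal.ofReal_sub _ x.coe_nonneg,
      show (2 : ℝ≥0∞)⁻¹ = ENNReal.ofReal (1 / 2) by
        rw [one_div, ENNReal.ofReal_inv_of_pos two_pos]; simp,
      ← ENNReal.ofReal_mul (by norm_num), ← ENNReal.ofReal_add (by positivity) (by linarith)]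
    congr 1; ring
  rw [e2]
  refine ENNReal.ofReal_le_ofReal ?_
  have := Real.add_one_le_exp (-(p / 2))
  linarith

end Concentration

/-! ### Uniform bound on the process noise -/

section NoiseBound

variable {Ω : Type*} {mΩ : MeasurableSpace Ω} {P : Measure Ω} [IsProbabilityMeasure P]

theorem hasSubgaussianMGF_coord {w : Ω → Vec n} {σ : ℝ≥0}
    (h : ∀ ζ : Vec n, ‖ζ‖ = 1 → HasSubgaussianMGF (fun ω => inner ℝ ζ (w ω)) (σ ^ 2) P) (j : Fin n) :
    HasSubgaussianMGF (fun ω => w ω j) (σ ^ 2) P := by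
  simpa [EuclideanSpace.inner_single_left] using h (EuclideanSpace.single j 1) (by simp)

/-- If all coordinates are below `r` in absolute value, the norm is at most `√n r`. Each of the `2
n` one-sided tails at `r` has probability at most `η / n`. -/
theorem measure_norm_gt_le (hn : 1 ≤ n) {w : Ω → Vec n} {σ : ℝ≥0}
    (h : ∀ ζ : Vec n, ‖ζ‖ = 1 → HasSubgaussianMGF (fun ω => inner ℝ ζ (w ω)) (σ ^ 2) P)
    {η : ℝ} (hη : 0 < η) (hη' : η ≤ n) :
    P {ω | σ * Real.sqrt (2 * n * Real.log (n / η)) < ‖w ω‖} ≤ ENNReal.ofReal (2 * η) := by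
  have hn0 : (0 : ℝ) < n := by exact_mod_cast hn
  rcases eq_or_ne σ 0 with rfl | hσ
  · have h0 : ∀ᵐ ω ∂P, ∀ j, w ω j = 0 := ae_all_iff.2 fun j => by
      have h1 := hasSubgaussianMGF_coord h j
      rw [zero_pow two_ne_zero] at h1
      exact h1.ae_eq_zero_of_hasSubgaussianMGF_zero
    refine le_of_eq_of_le ?_ zero_le
    refine measure_mono_null ?_ (ae_iff.1 h0)
    intro ω hω hw
    have : w ω = 0 := by ext j; simpa using hw j
    simp [this] at hω
  have hσ' : (0 : ℝ) < σ := by positivity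
  have hlog : 0 ≤ Real.log (n / η) := Real.log_nonneg ((one_le_div hη).2 hη')
  set r := (σ : ℝ) * Real.sqrt (2 * Real.log (n / η)) with hr
  have hr0 : 0 ≤ r := by positivity
  have hexp : Real.exp (-r ^ 2 / (2 * (σ ^ 2 : ℝ≥0))) = η / n := by
    have : -r ^ 2 / (2 * (σ ^ 2 : ℝ≥0)) = -Real.log (n / η) := by
      rw [hr, mul_pow, Real.sq_sqrt (by positivity)]
      push_cast
      field_simp
    rw [this, Real.exp_neg, Real.exp_log (by positivity), inv_div]
  have hsub : {ω | σ * Real.sqrt (2 * n * Real.log (n / η)) < ‖w ω‖} ⊆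
      ⋃ j, ({ω | r ≤ w ω j} ∪ {ω | r ≤ -w ω j}) := by
    intro ω hω
    by_contra hcon
    simp only [mem_iUnion, mem_union, mem_ofPred_eq, not_exists, not_or, not_le] at hcon
    have h1 : ‖w ω‖ ^ 2 ≤ n * r ^ 2 := by
      rw [EuclideanSpace.norm_sq_eq]
      have : ∀ j ∈ Finset.univ, ‖w ω j‖ ^ 2 ≤ r ^ 2 := fun j _ => by
        refine pow_le_pow_left₀ (norm_nonneg _) ?_ 2
        exact abs_le.2 ⟨by linarith [(hcon j).2], (hcon j).1.le⟩
      refine (Finset.sum_le_sum this).trans_eq ?_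
      simp
    have h2 : ‖w ω‖ ≤ σ * Real.sqrt (2 * n * Real.log (n / η)) := by
      refine (pow_le_pow_iff_left₀ (norm_nonneg _) (by positivity) two_ne_zero).1 ?_
      refine h1.trans_eq ?_
      rw [hr, mul_pow, mul_pow, Real.sq_sqrt (by positivity), Real.sq_sqrt (by positivity)]
      ring
    exact absurd hω (not_lt.2 h2)
  have hone : ∀ Y : Ω → ℝ, HasSubgaussianMGF Y (σ ^ 2) P → P {ω | r ≤ Y ω} ≤
      ENNReal.ofReal (η / n) := fun Y hY => by
    rw [← hexp, ← ofReal_measureReal]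
    exact ENNReal.ofReal_le_ofReal (hY.measure_ge_le hr0)
  refine (measure_mono hsub).trans ((measure_iUnion_le _).trans ?_)
  rw [tsum_fintype]
  have : ∀ j ∈ Finset.univ, P ({ω | r ≤ w ω j} ∪ {ω | r ≤ -w ω j}) ≤
      ENNReal.ofReal (2 * (η / n)) := fun j _ => by
    have hj := hasSubgaussianMGF_coord h j
    refine (measure_union_le _ _).trans ((add_le_add (hone _ hj) (hone _ hj.neg)).trans_eq ?_)
    rw [← ENNReal.ofReal_add (by positivity) (by positivity)]
    congr 1; ring
  refine (Finset.sum_le_sum this).trans_eq ?_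
  rw [Finset.sum_const, Finset.card_univ, Fintype.card_fin, nsmul_eq_mul,
    ← ENNReal.ofReal_natCast, ← ENNReal.ofReal_mul hn0.le]
  congr 1
  field_simp

/-- The Basel sum, source of `π²` in `wBar` and in the burn-in inequality. -/
theorem tsum_ofReal_div_sq {c : ℝ} (hc : 0 ≤ c) :
    ∑' k : ℕ, ENNReal.ofReal (c / ((k : ℝ) + 1) ^ 2) = ENNReal.ofReal (c * (Real.pi ^ 2 / 6)) := by
  have h1 := (hasSum_nat_add_iff' (f := fun k : ℕ => 1 / (k : ℝ) ^ 2) 1).2 hasSum_zeta_two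
  simp only [Finset.range_one, Finset.sum_singleton] at h1
  norm_num at h1
  have h2 := h1.mul_left c
  have h3 : ∀ k : ℕ, c / ((k : ℝ) + 1) ^ 2 = c * (((k : ℝ) + 1) ^ 2)⁻¹ := fun k => div_eq_mul_inv _ _
  simp only [h3]
  rw [← ENNReal.ofReal_tsum_of_nonneg (fun k => by positivity) h2.summable, h2.tsum_eq]

theorem measure_exists_norm_gt_wBar_le (hn : 1 ≤ n) {w : ℕ → Ω → Vec n} (b : Bounds)
    (h : ∀ t, 1 ≤ t → ∀ ζ : Vec n, ‖ζ‖ = 1 →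
      HasSubgaussianMGF (fun ω => inner ℝ ζ (w t ω)) (b.σw ^ 2) P)
    {δ : ℝ} (hδ : 0 < δ) (hδ' : δ ≤ 1) :
    P {ω | ∃ t, 1 ≤ t ∧ wBar n b t δ < ‖w t ω‖} ≤ ENNReal.ofReal δ := by
  have hn0 : (1 : ℝ) ≤ n := by exact_mod_cast hn
  have hpi : (9 : ℝ) < Real.pi ^ 2 := by nlinarith [Real.pi_gt_three]
  have hsub : {ω | ∃ t, 1 ≤ t ∧ wBar n b t δ < ‖w t ω‖} ⊆
      ⋃ k : ℕ, {ω | wBar n b (k + 1) δ < ‖w (k + 1) ω‖} := by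
    rintro ω ⟨t, ht, hω⟩
    obtain ⟨k, rfl⟩ := Nat.exists_eq_add_of_le' ht
    exact mem_iUnion.2 ⟨k, hω⟩
  refine (measure_mono hsub).trans ((measure_iUnion_le _).trans ?_)
  have hk : ∀ k : ℕ, P {ω | wBar n b (k + 1) δ < ‖w (k + 1) ω‖} ≤
      ENNReal.ofReal ((6 * δ / Real.pi ^ 2) / ((k : ℝ) + 1) ^ 2) := by
    intro k
    have hk1 : (1 : ℝ) ≤ ((k : ℝ) + 1) ^ 2 := one_le_pow₀ (by linarith [k.cast_nonneg (α := ℝ)])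
    -- At time `t = k + 1` the choice is `η = 3 δ / (π² t²)`: the tails `2 η` then sum to `δ`, and
    -- `η ≤ n` because `π² > 9` and `δ ≤ 1`.
    have hη : 3 * δ / (Real.pi ^ 2 * ((k : ℝ) + 1) ^ 2) ≤ n := by
      rw [div_le_iff₀ (by positivity)]
      nlinarith [mul_le_mul hn0 (mul_le_mul hpi.le hk1 zero_le_one (by positivity)) (by positivity) (by positivity)]
    have := measure_norm_gt_le hn (h (k + 1) (by omega)) (by positivity) hη
    have e : (n : ℝ) / (3 * δ / (Real.pi ^ 2 * ((k : ℝ) + 1) ^ 2)) =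
        n * Real.pi ^ 2 * ((k : ℝ) + 1) ^ 2 / (3 * δ) := by field_simp
    rw [e] at this
    simp only [wBar, Nat.add_eq_zero_iff, one_ne_zero, and_false, if_false]
    push_cast
    refine this.trans_eq ?_
    congr 1
    field_simp
    ring
  refine (ENNReal.tsum_le_tsum hk).trans_eq ?_
  rw [tsum_ofReal_div_sq (by positivity)]
  congr 1
  field_simp

theorem wBar_nonneg (b : Bounds) (t : ℕ) (δ : ℝ) : 0 ≤ wBar n b t δ := by
  unfold wBar
  split_ifs <;> positivity

theorem wBar_mono (hn : 1 ≤ n) (b : Bounds) {δ : ℝ} (hδ : 0 < δ) :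
    Monotone fun t => wBar n b t δ := by
  have hn0 : (0 : ℝ) < n := by exact_mod_cast hn
  intro s t hst
  rcases Nat.eq_zero_or_pos s with rfl | hs
  · simpa [wBar] using wBar_nonneg b t δ
  · have ht : t ≠ 0 := by omega
    simp only [wBar, hs.ne', ht, if_false]
    have hs0 : (0 : ℝ) < s := by exact_mod_cast hs
    have : (s : ℝ) ≤ t := by exact_mod_cast hst
    gcongr

end NoiseBound

/-! ### Bounds on states and regressors -/

section StateBound

theorem IsKInf.monoOn {h : ℝ → ℝ} (hh : IsKInf h) {a c : ℝ} (ha : 0 ≤ a) (hac : a ≤ c) :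
    h a ≤ h c := hh.strictMonoOn.monotoneOn ha (ha.trans hac) hac

theorem IsKInf.nonneg {h : ℝ → ℝ} (hh : IsKInf h) {a : ℝ} (ha : 0 ≤ a) : 0 ≤ h a := by
  rw [← hh.map_zero]; exact hh.monoOn le_rfl ha

theorem xBar_nonneg {sys : Sys n m q d} {b : Bounds} (hr : sys.ReachAssumption b)
    (hu : 0 ≤ b.uMax) (t : ℕ) (δ : ℝ) (x₀ : Vec n) : 0 ≤ xBar b t δ x₀ := by
  have h1 := hr.χ₁.1.nonneg (Nat.cast_nonneg (α := ℝ) t)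
  have h2 := hr.χ₂.nonneg (norm_nonneg x₀)
  have h3 := hr.χ₃.1.nonneg (mul_nonneg (Nat.cast_nonneg (α := ℝ) t) (hr.σ₁.nonneg hu))
  have h4 := hr.χ₄.1.nonneg (mul_nonneg (Nat.cast_nonneg (α := ℝ) t)
    (hr.σ₂.1.nonneg (wBar_nonneg (n := n) b t δ)))
  have := hr.c₁
  unfold xBar
  linarith

theorem xBar_mono {sys : Sys n m q d} {b : Bounds} (hn : 1 ≤ n) (hr : sys.ReachAssumption b)
    (hu : 0 ≤ b.uMax) {δ : ℝ} (hδ : 0 < δ) (x₀ : Vec n) : Monotone fun t => xBar b t δ x₀ := by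
  intro s t hst
  have hst' : (s : ℝ) ≤ t := by exact_mod_cast hst
  have hs : (0 : ℝ) ≤ s := s.cast_nonneg
  have hw := wBar_nonneg (n := n) b s δ
  have h1 := hr.χ₁.1.monoOn hs hst'
  have h3 := hr.χ₃.1.monoOn (mul_nonneg hs (hr.σ₁.nonneg hu))
    (mul_le_mul_of_nonneg_right hst' (hr.σ₁.nonneg hu))
  have h4 := hr.χ₄.1.monoOn (mul_nonneg hs (hr.σ₂.1.nonneg hw))
    (mul_le_mul hst' (hr.σ₂.1.monoOn hw (wBar_mono hn b hδ hst)) (hr.σ₂.1.nonneg hw)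
      (hs.trans hst'))
  simp only [xBar]
  linarith

theorem zBar_nonneg {sys : Sys n m q d} {b : Bounds} (hb : sys.BasisAssumption b) (t : ℕ) (δ : ℝ)
    (x₀ : Vec n) : 0 ≤ zBar b t δ x₀ := hb.apb.1 _ (Real.sqrt_nonneg _)

variable {Ω : Type*} {sys : Sys n m q d} {x₀ : Vec n} {b : Bounds}
    {W : ℕ → Ω → sys.𝕎} {S : ℕ → Ω → sys.𝕊}
    {X : ℕ → Ω → Vec n} {U : ℕ → Ω → Vec m} {est : ℕ → Ω → Param d n}

theorem Sys.IsClosedLoop.norm_control_le (h : sys.IsClosedLoop x₀ W S X U est)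
    (hsys : sys.WellPosed) (hx₀ : x₀ ∈ sys.𝕏) (hc : sys.ControlAssumption b) (t : ℕ) (ω : Ω) :
    ‖U t ω‖ ≤ b.uMax := by
  rw [h.control]
  exact hc.bound _ (h.state_mem hsys hx₀ t ω) _ (S t ω).2 _

/-- As `wBar` is monotone in time, each sum in the reachability bound is at most `t` times its bound
at the final time. -/
theorem Sys.IsClosedLoop.norm_state_le (h : sys.IsClosedLoop x₀ W S X U est) (hn : 1 ≤ n)
    (hsys : sys.WellPosed) (hx₀ : x₀ ∈ sys.𝕏) (hr : sys.ReachAssumption b)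
    (hc : sys.ControlAssumption b) {δ : ℝ} (hδ : 0 < δ) {ω : Ω}
    (hω : ∀ t, 1 ≤ t → ‖(W t ω : Vec n)‖ ≤ wBar n b t δ) (t : ℕ) :
    ‖X t ω‖ ≤ xBar b t δ x₀ := by
  have hb := hr.bound t x₀ hx₀ (fun s => U s ω) (fun s => W s ω)
    (fun i _ => h.control_mem hsys hx₀ i ω) (fun i _ => (W i ω).2)
  rw [← h.state_eq_φ] at hb
  have hu := hc.uMax_nonneg
  have h3 : b.χ₃ (∑ i ∈ Finset.range t, b.σ₁ ‖U i ω‖) ≤ b.χ₃ (t * b.σ₁ b.uMax) := by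
    refine hr.χ₃.1.monoOn (Finset.sum_nonneg fun i _ => hr.σ₁.nonneg (norm_nonneg _)) ?_
    refine (Finset.sum_le_sum fun i _ => hr.σ₁.monoOn (norm_nonneg _)
      (h.norm_control_le hsys hx₀ hc i ω)).trans_eq ?_
    simp
  have h4 : b.χ₄ (∑ i ∈ Finset.Icc 1 t, b.σ₂ ‖(W i ω : Vec n)‖) ≤
      b.χ₄ (t * b.σ₂ (wBar n b t δ)) := by
    refine hr.χ₄.1.monoOn (Finset.sum_nonneg fun i _ => hr.σ₂.1.nonneg (norm_nonneg _)) ?_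
    refine (Finset.sum_le_sum fun i hi => hr.σ₂.1.monoOn (norm_nonneg _)
      ((hω i (Finset.mem_Icc.1 hi).1).trans (wBar_mono hn b hδ (Finset.mem_Icc.1 hi).2))).trans_eq ?_
    simp
  simp only [xBar]
  linarith

theorem Sys.IsClosedLoop.norm_basis_le (h : sys.IsClosedLoop x₀ W S X U est) (hn : 1 ≤ n)
    (hsys : sys.WellPosed) (hx₀ : x₀ ∈ sys.𝕏) (hr : sys.ReachAssumption b)
    (hc : sys.ControlAssumption b) (hb : sys.BasisAssumption b) {δ : ℝ} (hδ : 0 < δ) {ω : Ω}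
    (hω : ∀ t, 1 ≤ t → ‖(W t ω : Vec n)‖ ≤ wBar n b t δ) (s : ℕ) :
    ‖sys.ψ (X s ω) (U s ω)‖ ≤ zBar b (s + 1) δ x₀ := by
  refine (hb.bound _ (h.state_mem hsys hx₀ s ω) _ (h.control_mem hsys hx₀ s ω)).trans ?_
  refine hb.mono (Real.sqrt_nonneg _) (Real.sqrt_nonneg _) (Real.sqrt_le_sqrt ?_)
  have h1 := h.norm_state_le hn hsys hx₀ hr hc hδ hω s
  have h2 := h.norm_control_le hsys hx₀ hc s ω
  rw [Nat.add_sub_cancel]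
  gcongr

theorem Sys.IsClosedLoop.sum_regressor_sq_le (h : sys.IsClosedLoop x₀ W S X U est) (hn : 1 ≤ n)
    (hsys : sys.WellPosed) (hx₀ : x₀ ∈ sys.𝕏) (hr : sys.ReachAssumption b)
    (hc : sys.ControlAssumption b) (hb : sys.BasisAssumption b) {δ : ℝ} (hδ : 0 < δ) {ω : Ω}
    (hω : ∀ t, 1 ≤ t → ‖(W t ω : Vec n)‖ ≤ wBar n b t δ) (t : ℕ) :
    ∑ s ∈ Finset.range t, regressor sys X U ω s ⬝ᵥ regressor sys X U ω s ≤
      ∑ i ∈ Finset.Icc 1 t, zBar b i δ x₀ ^ 2 := by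
  rw [sum_Icc_one_eq_sum_range]
  refine Finset.sum_le_sum fun s _ => ?_
  have h1 := h.norm_basis_le hn hsys hx₀ hr hc hb hδ hω s
  have h2 : regressor sys X U ω s ⬝ᵥ regressor sys X U ω s = ‖sys.ψ (X s ω) (U s ω)‖ ^ 2 := by
    rw [EuclideanSpace.norm_sq_eq]
    simp [dotProduct, sq]
  rw [h2]
  gcongr

end StateBound

/-! ### Calculus of sub-exponential sequences -/

/-- A real sequence of sub-exponential growth. -/
def IsSubExpSeq (a : ℕ → ℝ) : Prop :=
  ∀ ε : ℝ, 0 < ε → ∀ᶠ t : ℕ in atTop, a t ≤ Real.exp (ε * t)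

namespace IsSubExpSeq

variable {a b : ℕ → ℝ}

theorem mono (hb : IsSubExpSeq b) (h : ∀ᶠ t in atTop, a t ≤ b t) : IsSubExpSeq a := fun ε hε => by
  filter_upwards [hb ε hε, h] with t h1 h2 using h2.trans h1

theorem const (c : ℝ) : IsSubExpSeq fun _ => c := fun _ hε =>
  (Real.tendsto_exp_atTop.comp
    ((tendsto_natCast_atTop_atTop (R := ℝ)).const_mul_atTop hε)).eventually_ge_atTop c

theorem natCast : IsSubExpSeq fun t => (t : ℝ) := fun ε hε => by
  have h := (isLittleO_pow_exp_pos_mul_atTop 1 hε).bound zero_lt_one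
  filter_upwards [tendsto_natCast_atTop_atTop.eventually h] with t ht
  simpa using ht

theorem mul (ha : IsSubExpSeq a) (hb : IsSubExpSeq b) (hb0 : ∀ t, 0 ≤ b t) :
    IsSubExpSeq fun t => a t * b t := fun ε hε => by
  filter_upwards [ha (ε / 2) (by positivity), hb (ε / 2) (by positivity)] with t h1 h2
  refine (mul_le_mul h1 h2 (hb0 t) (Real.exp_nonneg _)).trans_eq ?_
  rw [← Real.exp_add]; congr 1; ring

theorem add (ha : IsSubExpSeq a) (hb : IsSubExpSeq b) : IsSubExpSeq fun t => a t + b t :=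
  fun ε hε => by
  filter_upwards [ha (ε / 2) (by positivity), hb (ε / 2) (by positivity),
    const 2 (ε / 2) (by positivity)] with t h1 h2 h3
  -- Once `exp (ε t / 2) ≥ 2`, twice this number is at most its square.
  have : Real.exp (ε * t) = Real.exp (ε / 2 * t) * Real.exp (ε / 2 * t) := by
    rw [← Real.exp_add]; congr 1; ring
  rw [this]
  nlinarith [Real.exp_pos (ε / 2 * t)]

theorem pow (ha : IsSubExpSeq a) (ha0 : ∀ t, 0 ≤ a t) (k : ℕ) : IsSubExpSeq fun t => a t ^ k := by
  induction k with
  | zero => simpa using const 1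
  | succ k ih => simpa only [pow_succ] using ih.mul ha ha0

theorem log_le (ha : IsSubExpSeq a) (ha0 : ∀ t, 0 < a t) {ε : ℝ} (hε : 0 < ε) :
    ∀ᶠ t in atTop, Real.log (a t) ≤ ε * t := by
  filter_upwards [ha ε hε] with t h
  rw [Real.log_le_iff_le_exp (ha0 t)]
  exact h

theorem tendsto_log_div (ha : IsSubExpSeq a) (ha0 : ∀ t, 1 ≤ a t) :
    Tendsto (fun t : ℕ => Real.log (a t) / t) atTop (𝓝 0) := by
  rw [Metric.tendsto_nhds]
  intro ε hε
  filter_upwards [ha.log_le (fun t => zero_lt_one.trans_le (ha0 t)) (half_pos hε),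
    eventually_gt_atTop 0] with t h ht
  have ht' : (0 : ℝ) < t := by exact_mod_cast ht
  rw [Real.dist_eq, sub_zero, abs_of_nonneg (div_nonneg (Real.log_nonneg (ha0 t)) ht'.le),
    div_lt_iff₀ ht']
  nlinarith

end IsSubExpSeq

theorem IsSubExp.eventually_le_exp {k : ℕ} {h : ℝ → ℝ} (hh : IsSubExp k h) {ε : ℝ} (hε : 0 < ε) :
    ∀ᶠ r : ℝ in atTop, h (r ^ k) ≤ Real.exp (ε * r) := by
  filter_upwards [hh.bound hε, eventually_ge_atTop 0] with r h1 h0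
  rw [Real.norm_eq_abs, Real.norm_eq_abs, abs_of_nonneg h0] at h1
  exact (Real.le_exp_log _).trans (Real.exp_le_exp.2 ((le_abs_self _).trans h1))

theorem IsKInfSE.isSubExpSeq_pow {k : ℕ} {h : ℝ → ℝ} (hh : IsKInfSE k h) :
    IsSubExpSeq fun t => h ((t : ℝ) ^ k) := fun _ hε =>
  tendsto_natCast_atTop_atTop.eventually (hh.2.eventually_le_exp hε)

theorem IsKInfSE.isSubExpSeq_mul_const {h : ℝ → ℝ} (hh : IsKInfSE 1 h) {c : ℝ} (hc : 0 ≤ c) :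
    IsSubExpSeq fun t => h (t * c) := by
  rcases hc.eq_or_lt with rfl | hc
  · simpa [hh.1.map_zero] using IsSubExpSeq.const 0
  intro ε hε
  have h1 : Tendsto (fun t : ℕ => (t : ℝ) * c) atTop atTop :=
    tendsto_natCast_atTop_atTop.atTop_mul_const hc
  filter_upwards [h1.eventually (hh.2.eventually_le_exp (div_pos hε hc))] with t ht
  rw [pow_one] at ht
  refine ht.trans_eq ?_
  congr 1
  field_simp

/-- Applied with `y = log t`, where the square root is the one in `wBar`. -/
theorem eventually_const_mul_sqrt_add_le (C a R : ℝ) (hC : 0 ≤ C) :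
    ∀ᶠ y : ℝ in atTop, C * Real.sqrt (a + 2 * y) + R ≤ y := by
  filter_upwards [eventually_ge_atTop (2 * R), eventually_ge_atTop a,
    eventually_ge_atTop (12 * C ^ 2), eventually_ge_atTop 0] with y h1 h2 h3 h4
  have : C * Real.sqrt (a + 2 * y) ≤ y / 2 := by
    calc C * Real.sqrt (a + 2 * y) ≤ C * Real.sqrt (3 * y) := by
          gcongr; linarith
      _ ≤ y / 2 := by
          refine (pow_le_pow_iff_left₀ (by positivity) (by positivity) two_ne_zero).1 ?_
          rw [mul_pow, Real.sq_sqrt (by positivity)]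
          nlinarith
  linarith

/-- `wBar` grows like `√(log t)`, so `exp (wBar + R) ≤ t` eventually, while `σ₂ r ≤ exp r` for large
`r`. The argument of `χ₄` in `xBar` is thus at most `t²`, which is why `χ₄` has to be
sub-exponential of order 2. -/
theorem eventually_comp_wBar_le (hn : 1 ≤ n) (b : Bounds) (hσ : IsKInfSE 1 b.σ₂) {δ : ℝ}
    (hδ : 0 < δ) : ∀ᶠ t : ℕ in atTop, b.σ₂ (wBar n b t δ) ≤ t := by
  have hn0 : (0 : ℝ) < n := by exact_mod_cast hn
  obtain ⟨R, hR0, hR⟩ : ∃ R : ℝ, 0 ≤ R ∧ ∀ r ≥ R, b.σ₂ r ≤ Real.exp r := by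
    obtain ⟨R, hR⟩ := eventually_atTop.1 (hσ.2.eventually_le_exp zero_lt_one)
    refine ⟨max R 0, le_max_right _ _, fun r hr => ?_⟩
    simpa using hR r ((le_max_left _ _).trans hr)
  set A : ℝ := n * Real.pi ^ 2 / (3 * δ) with hA
  have hA0 : 0 < A := by positivity
  have h1 := (Real.tendsto_log_atTop.comp tendsto_natCast_atTop_atTop).eventually
    (eventually_const_mul_sqrt_add_le (b.σw * Real.sqrt (2 * n)) (Real.log A) R (by positivity))
  filter_upwards [h1, eventually_gt_atTop 0] with t ht ht0
  have ht' : (0 : ℝ) < t := by exact_mod_cast ht0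
  have e : wBar n b t δ = b.σw * Real.sqrt (2 * n) * Real.sqrt (Real.log A + 2 * Real.log t) := by
    rw [wBar, if_neg ht0.ne', mul_assoc (b.σw : ℝ), ← Real.sqrt_mul (by positivity)]
    have : (n : ℝ) * Real.pi ^ 2 * (t : ℝ) ^ 2 / (3 * δ) = A * (t : ℝ) ^ 2 := by
      rw [hA]; ring
    rw [this, Real.log_mul hA0.ne' (by positivity), Real.log_pow]
    push_cast
    rfl
  simp only [Function.comp] at ht
  rw [← e] at ht
  have hw := wBar_nonneg (n := n) b t δ
  calc b.σ₂ (wBar n b t δ) ≤ b.σ₂ (wBar n b t δ + R) := hσ.1.monoOn hw (by linarith)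
    _ ≤ Real.exp (wBar n b t δ + R) := hR _ (by linarith)
    _ ≤ Real.exp (Real.log t) := Real.exp_le_exp.2 ht
    _ = t := Real.exp_log ht'

/-! ### Growth of the bounds; convergence and finiteness of the burn-in time -/

section Growth

variable {sys : Sys n m q d} {b : Bounds} {x₀ : Vec n} {δ : ℝ}

theorem isSubExpSeq_xBar (hn : 1 ≤ n) (hr : sys.ReachAssumption b) (hu : 0 ≤ b.uMax) (hδ : 0 < δ)
    (x₀ : Vec n) : IsSubExpSeq fun t => xBar b t δ x₀ := by
  have h4 : IsSubExpSeq fun t => b.χ₄ (t * b.σ₂ (wBar n b t δ)) := by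
    refine hr.χ₄.isSubExpSeq_pow.mono ?_
    filter_upwards [eventually_comp_wBar_le hn b hr.σ₂ hδ] with t ht
    have ht0 : (0 : ℝ) ≤ t := t.cast_nonneg
    refine hr.χ₄.1.monoOn (mul_nonneg ht0 (hr.σ₂.1.nonneg (wBar_nonneg b t δ))) ?_
    rw [sq]
    exact mul_le_mul_of_nonneg_left ht ht0
  have h1 := hr.χ₁.isSubExpSeq_pow
  simp only [pow_one] at h1
  exact ((((h1.add (.const _)).add (hr.χ₃.isSubExpSeq_mul_const (hr.σ₁.nonneg hu))).add h4).add
    (.const _))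

theorem isSubExpSeq_sum_zBar_sq (hn : 1 ≤ n) (hr : sys.ReachAssumption b) (hu : 0 ≤ b.uMax)
    (hb : sys.BasisAssumption b) (hδ : 0 < δ) (x₀ : Vec n) :
    IsSubExpSeq fun t => ∑ i ∈ Finset.Icc 1 t, zBar b i δ x₀ ^ 2 := by
  obtain ⟨k, hk⟩ := hb.apb.2
  obtain ⟨C, hC0, hC⟩ := hk.exists_nonneg
  obtain ⟨R, hR0, hR⟩ : ∃ R : ℝ, 0 ≤ R ∧ ∀ r ≥ R, b.χ₅ r ≤ C * r ^ k := by
    obtain ⟨R, hR⟩ := eventually_atTop.1 hC.bound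
    refine ⟨max R 0, le_max_right _ _, fun r hr => ?_⟩
    have h0 : 0 ≤ r := (le_max_right _ _).trans hr
    have := hR r ((le_max_left _ _).trans hr)
    rw [Real.norm_of_nonneg (pow_nonneg h0 k)] at this
    exact (Real.le_norm_self _).trans this
  have hx0 := fun t => xBar_nonneg hr hu t δ x₀
  -- Adding `R` moves the argument of `χ₅` into the range where its polynomial bound holds; the
  -- other two terms dominate the square root.
  have hbound : ∀ t, ∀ i ∈ Finset.Icc 1 t, zBar b i δ x₀ ≤
      C * (xBar b t δ x₀ + (b.uMax + R)) ^ k := by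
    intro t i hi
    have hx : xBar b (i - 1) δ x₀ ≤ xBar b t δ x₀ :=
      xBar_mono hn hr hu hδ x₀ ((Nat.sub_le i 1).trans (Finset.mem_Icc.1 hi).2)
    have hs : Real.sqrt (xBar b (i - 1) δ x₀ ^ 2 + b.uMax ^ 2) ≤
        xBar b t δ x₀ + (b.uMax + R) := by
      rw [Real.sqrt_le_left (by linarith [hx0 t])]
      nlinarith [hx0 (i - 1), hx0 t]
    refine (hb.mono (Real.sqrt_nonneg _) ((Real.sqrt_nonneg _).trans hs) hs).trans ?_
    exact hR _ (by linarith [hx0 t])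
  have hpos : ∀ t, 0 ≤ C * (xBar b t δ x₀ + (b.uMax + R)) ^ k := fun t =>
    mul_nonneg hC0 (pow_nonneg (by linarith [hx0 t]) k)
  have hC' : IsSubExpSeq fun t => C * (xBar b t δ x₀ + (b.uMax + R)) ^ k :=
    (IsSubExpSeq.const C).mul (((isSubExpSeq_xBar hn hr hu hδ x₀).add (.const _)).pow
      (fun t => by linarith [hx0 t]) k) (fun t => pow_nonneg (by linarith [hx0 t]) k)
  refine (IsSubExpSeq.natCast.mul (hC'.pow hpos 2) fun t => sq_nonneg _).mono
    (Eventually.of_forall fun t => ?_)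
  refine (Finset.sum_le_sum fun i hi => pow_le_pow_left₀ (zBar_nonneg hb i δ x₀)
    (hbound t i hi) 2).trans_eq ?_
  simp

/-- `log β_max = o(t)` by sub-exponential growth, whereas the squared denominator is linear in `t`.
-/
theorem tendsto_errBound (hn : 1 ≤ n) (hγ : 0 < sys.γ) (hr : sys.ReachAssumption b)
    (hu : 0 ≤ b.uMax) (hb : sys.BasisAssumption b) (hδ : 0 < δ) {cPE pPE : ℝ} (hc : 0 < cPE)
    (hp : 0 < pPE) (x₀ : Vec n) :
    Tendsto (fun t : ℕ => errBound sys b cPE pPE t δ x₀) atTop (𝓝 0) := by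
  have hδ3 : 0 < δ / 3 := by positivity
  have hsum := isSubExpSeq_sum_zBar_sq hn hr hu hb hδ3 x₀
  have hnn : ∀ t : ℕ, 0 ≤ ∑ i ∈ Finset.Icc 1 t, zBar b i (δ / 3) x₀ ^ 2 := fun t =>
    Finset.sum_nonneg fun i _ => sq_nonneg _
  have hβ : IsSubExpSeq fun t => betaMax b sys.γ t (δ / 3) x₀ * sys.γ⁻¹ :=
    (hsum.add (.const _)).mul (.const _) fun _ => by positivity
  have hβ1 : ∀ t, 1 ≤ betaMax b sys.γ t (δ / 3) x₀ * sys.γ⁻¹ := fun t => by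
    rw [← div_eq_mul_inv, one_le_div hγ, betaMax]
    linarith [hnn t]
  have hlog := hβ.tendsto_log_div hβ1
  set a := cPE * pPE / 4 with ha
  have ha0 : 0 < a := by positivity
  have hden : Tendsto (fun t : ℕ => a * ((t : ℝ) - 1) + sys.γ) atTop atTop :=
    tendsto_atTop_add_const_right _ _ ((tendsto_atTop_add_const_right _ (-1)
      tendsto_natCast_atTop_atTop).const_mul_atTop ha0)
  have hinv : Tendsto (fun t : ℕ => (a * ((t : ℝ) - 1) + sys.γ)⁻¹) atTop (𝓝 0) :=
    tendsto_inv_atTop_zero.comp hden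
  have hinvs : Tendsto (fun t : ℕ => 1 / Real.sqrt (a * ((t : ℝ) - 1) + sys.γ)) atTop (𝓝 0) := by
    have := hinv.sqrt
    rw [Real.sqrt_zero] at this
    refine this.congr fun t => ?_
    rw [Real.sqrt_inv, one_div]
  have hratio : Tendsto (fun t : ℕ => (t : ℝ) * (a * ((t : ℝ) - 1) + sys.γ)⁻¹) atTop
      (𝓝 (1 / a)) := by
    have h1 : Tendsto (fun t : ℕ => 1 / a + (1 - sys.γ / a) * (a * ((t : ℝ) - 1) + sys.γ)⁻¹) atTop
        (𝓝 (1 / a + (1 - sys.γ / a) * 0)) := tendsto_const_nhds.add (hinv.const_mul _)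
    rw [mul_zero, add_zero] at h1
    refine h1.congr' ?_
    filter_upwards [hden.eventually_gt_atTop 0] with t ht
    field_simp
    ring
  have hin : Tendsto (fun t : ℕ => 2 * (n : ℝ) * (Real.log (3 * n / δ) +
      (d : ℝ) / 2 * Real.log (betaMax b sys.γ t (δ / 3) x₀ * sys.γ⁻¹)) *
        (a * ((t : ℝ) - 1) + sys.γ)⁻¹) atTop (𝓝 0) := by
    have h1 := ((hinv.const_mul (Real.log (3 * n / δ))).add
      ((hlog.mul hratio).const_mul ((d : ℝ) / 2))).const_mul (2 * (n : ℝ))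
    simp only [mul_zero, zero_mul, add_zero] at h1
    refine h1.congr' ?_
    filter_upwards [eventually_gt_atTop 0] with t ht
    have ht' : (t : ℝ) ≠ 0 := by positivity
    field_simp
  have hs := (hin.sqrt).const_mul (b.σw : ℝ)
  rw [Real.sqrt_zero, mul_zero] at hs
  have htot := (hinvs.mul_const (Real.sqrt sys.γ * frobNorm sys.θstar)).add hs
  rw [zero_mul, add_zero] at htot
  refine htot.congr' ?_
  filter_upwards [hden.eventually_gt_atTop 0] with t ht
  rw [errBound, ← ha, Real.sqrt_mul' _ (inv_nonneg.2 ht.le), Real.sqrt_inv]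
  ring

theorem one_sub_log_two_pos : 0 < 1 - Real.log 2 := by
  have := Real.log_two_lt_d9
  linarith

theorem exists_burnInIneq (hn : 1 ≤ n) (hr : sys.ReachAssumption b)
    (hu : 0 ≤ b.uMax) (hb : sys.BasisAssumption b) (hδ : 0 < δ) {cPE pPE : ℝ} (hc : 0 < cPE)
    (hp : 0 < pPE) (x₀ : Vec n) :
    ∃ T : ℕ, 1 ≤ T ∧ ∀ t : ℕ, T ≤ t → BurnInIneq d b cPE pPE T t δ x₀ := by
  have hδ3 : 0 < δ / 3 := by positivity
  have hsum := isSubExpSeq_sum_zBar_sq hn hr hu hb hδ3 x₀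
  have hnn : ∀ t : ℕ, 0 ≤ ∑ i ∈ Finset.Icc 1 t, zBar b i (δ / 3) x₀ ^ 2 := fun t =>
    Finset.sum_nonneg fun i _ => sq_nonneg _
  have h2 := one_sub_log_two_pos
  set K := 2 / ((1 - Real.log 2) * pPE) with hK
  have hK0 : 0 < K := by positivity
  -- Chosen so that the `d + 1` logarithms, each at most `ε t`, cost `t / 2` after multiplication by
  -- `K`.
  set ε := 1 / (2 * K * (d + 1)) with hε
  have hε0 : 0 < ε := by positivity
  have h1 : IsSubExpSeq fun t => 1 + 16 / (cPE * pPE) *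
      ∑ i ∈ Finset.Icc 1 t, zBar b i (δ / 3) x₀ ^ 2 :=
    (IsSubExpSeq.const 1).add ((IsSubExpSeq.const _).mul hsum hnn)
  have h1pos : ∀ t : ℕ, 1 ≤ 1 + 16 / (cPE * pPE) *
      ∑ i ∈ Finset.Icc 1 t, zBar b i (δ / 3) x₀ ^ 2 := fun t =>
    le_add_of_nonneg_right (mul_nonneg (by positivity) (hnn t))
  have h3 : IsSubExpSeq fun t => Real.pi ^ 2 / (2 * δ) * ((t : ℝ) + 1) ^ 2 :=
    (IsSubExpSeq.const _).mul ((IsSubExpSeq.natCast.add (.const 1)).pow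
      (fun t => by positivity) 2) fun t => by positivity
  obtain ⟨T, hT⟩ := eventually_atTop.1
    ((h1.log_le (fun t => zero_lt_one.trans_le (h1pos t)) hε0).and
      (h3.log_le (fun t => by positivity) hε0))
  -- From `t ≥ 2` follow `t / 2 + 1 ≤ t` and `t - 1 ≥ 1`. The candidate time also occurs inside the
  -- inequality, but harmlessly: `t - T + 1 ≤ t + 1`.
  refine ⟨max T 2, by omega, fun t ht => ?_⟩
  have hTt : T ≤ t := (le_max_left _ _).trans ht
  have h2t : 2 ≤ t := (le_max_right _ _).trans ht
  have h2t' : (2 : ℝ) ≤ t := by exact_mod_cast h2t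
  have hTt' : ((max T 2 : ℕ) : ℝ) ≤ t := by exact_mod_cast ht
  obtain ⟨hl1, hl2⟩ := hT t hTt
  have e1 : Real.log (1 + 16 * (∑ i ∈ Finset.Icc 1 t, zBar b i (δ / 3) x₀ ^ 2) /
      (cPE * pPE * ((t : ℝ) - 1))) ≤ ε * t := by
    refine le_trans (Real.log_le_log ?_ ?_) hl1
    · have : 0 ≤ 16 * (∑ i ∈ Finset.Icc 1 t, zBar b i (δ / 3) x₀ ^ 2) /
          (cPE * pPE * ((t : ℝ) - 1)) :=
        div_nonneg (mul_nonneg (by norm_num) (hnn t)) (mul_nonneg (by positivity) (by linarith))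
      linarith
    · gcongr 1 + ?_
      rw [div_mul_eq_mul_div]
      refine div_le_div_of_nonneg_left (mul_nonneg (by norm_num) (hnn t)) (by positivity) ?_
      exact le_mul_of_one_le_right (by positivity) (by linarith)
  have e2 : Real.log (Real.pi ^ 2 * ((t : ℝ) - (max T 2 : ℕ) + 1) ^ 2 / (2 * δ)) ≤ ε * t := by
    refine le_trans (Real.log_le_log ?_ ?_) hl2
    · have : 0 < (t : ℝ) - (max T 2 : ℕ) + 1 := by linarith
      positivity
    · rw [div_mul_eq_mul_div]
      have h0 : (0 : ℝ) ≤ (max T 2 : ℕ) := Nat.cast_nonneg _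
      gcongr
      linarith
  rw [BurnInIneq, ← hK]
  have e3 : K * (d * (ε * t) + ε * t) = t / 2 := by
    rw [hε]; field_simp
  have e4 : K * (d * Real.log (1 + 16 * (∑ i ∈ Finset.Icc 1 t, zBar b i (δ / 3) x₀ ^ 2) /
      (cPE * pPE * ((t : ℝ) - 1))) +
        Real.log (Real.pi ^ 2 * ((t : ℝ) - (max T 2 : ℕ) + 1) ^ 2 / (2 * δ))) ≤ t / 2 := by
    rw [← e3]
    gcongr
  linarith

end Growth

/-! ### Excitation in one direction and passage to all directions -/

section Excitation

variable {Ω : Type*} {mΩ : MeasurableSpace Ω} {P : Measure Ω} [IsProbabilityMeasure P]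
    {sys : Sys n m q d} {x₀ : Vec n} {b : Bounds}
    {W : ℕ → Ω → sys.𝕎} {S : ℕ → Ω → sys.𝕊}
    {X : ℕ → Ω → Vec n} {U : ℕ → Ω → Vec m} {est : ℕ → Ω → Param d n}
    {μw : Measure sys.𝕎} {μs : Measure sys.𝕊} {σw : ℝ≥0}

/-- The state, control, parameter and noise values for which the next regressor has a component
along `ζ` of squared size at least `c`. -/
def excitedSet (sys : Sys n m q d) (c : ℝ) (ζ : Vec d) :
    Set ((sys.𝕏 × sys.𝕌 × Param d n) × (sys.𝕊 × sys.𝕎)) :=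
  {p | c ≤ |inner ℝ ζ (sys.ψ (sys.g p.1.1 p.1.2.1 p.2.2)
    (sys.α (sys.g p.1.1 p.1.2.1 p.2.2) p.2.1 p.1.2.2))| ^ 2}

theorem measurableSet_excitedSet (hsys : sys.WellPosed) (hmeas : sys.MeasurableMaps) (c : ℝ)
    (ζ : Vec d) : MeasurableSet (excitedSet sys c ζ) := by
  have hg : Measurable fun p : (sys.𝕏 × sys.𝕌 × Param d n) × (sys.𝕊 × sys.𝕎) =>
      sys.g p.1.1 p.1.2.1 p.2.2 :=
    hmeas.comp_g (measurable_subtype_coe.comp measurable_fst.fst)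
      (measurable_subtype_coe.comp measurable_fst.snd.fst)
      (measurable_subtype_coe.comp measurable_snd.snd) (fun p => p.1.1.2) (fun p => p.1.2.1.2)
  have hgm : ∀ p : (sys.𝕏 × sys.𝕌 × Param d n) × (sys.𝕊 × sys.𝕎),
      sys.g p.1.1 p.1.2.1 p.2.2 ∈ sys.𝕏 := fun p =>
    hsys.g_mem _ p.1.1.2 _ p.1.2.1.2 _ p.2.2.2
  have hα : Measurable fun p : (sys.𝕏 × sys.𝕌 × Param d n) × (sys.𝕊 × sys.𝕎) =>
      sys.α (sys.g p.1.1 p.1.2.1 p.2.2) p.2.1 p.1.2.2 :=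
    hmeas.comp_α hg measurable_snd.fst measurable_fst.snd.snd hgm
  have hψ := hmeas.comp_ψ hg hα hgm fun p => hsys.α_mem _ (hgm p) _ p.2.1.2 _
  exact measurableSet_le measurable_const
    (((continuous_abs.measurable.comp ((measurable_const (a := ζ)).inner hψ))).pow_const 2)

theorem Sys.NoiseAssumption.map_prodMk (hnoise : sys.NoiseAssumption P W S μw μs σw) (t : ℕ) :
    P.map (fun ω => (S (t + 1) ω, W (t + 1) ω)) = μs.prod μw := by
  have hind : IndepFun (S (t + 1)) (W (t + 1)) P :=
    (hnoise.indep_WS.comp (measurable_pi_apply t) (measurable_pi_apply (t + 1))).symm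
  rw [(indepFun_iff_map_prod_eq_prod_map_map (hnoise.measurable_S _).aemeasurable
    (hnoise.measurable_W _ (by omega)).aemeasurable).1 hind, hnoise.law_S,
    hnoise.law_W _ (by omega)]

theorem Sys.NoiseAssumption.isProbabilityMeasure_prod
    (hnoise : sys.NoiseAssumption P W S μw μs σw) :
    IsProbabilityMeasure μs ∧ IsProbabilityMeasure μw := by
  constructor
  · rw [← hnoise.law_S 0]
    exact Measure.isProbabilityMeasure_map (hnoise.measurable_S 0).aemeasurable
  · rw [← hnoise.law_W 1 le_rfl]
    exact Measure.isProbabilityMeasure_map (hnoise.measurable_W 1 le_rfl).aemeasurable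

theorem Sys.NoiseAssumption.noisePast_le (hnoise : sys.NoiseAssumption P W S μw μs σw) (t : ℕ) :
    noisePast W S t ≤ mΩ :=
  AdaptiveControl.noisePast_le (fun k => hnoise.measurable_W (k + 1) (by omega))
    hnoise.measurable_S t

theorem Sys.NoiseAssumption.indep_noisePast (hnoise : sys.NoiseAssumption P W S μw μs σw) (t : ℕ) :
    Indep (noisePast W S t)
      (MeasurableSpace.comap (fun ω => (S (t + 1) ω, W (t + 1) ω)) inferInstance) P :=
  AdaptiveControl.indep_noisePast (fun k => hnoise.measurable_W (k + 1) (by omega))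
    hnoise.measurable_S hnoise.iIndep_W hnoise.iIndep_S hnoise.indep_WS t

/-- Along a fixed direction, insufficient excitation of the regressors while the state stays in
`XRPI` has exponentially small probability. -/
theorem Sys.IsClosedLoop.exists_excitation_failure (h : sys.IsClosedLoop x₀ W S X U est)
    (hsys : sys.WellPosed) (hmeas : sys.MeasurableMaps)
    (hnoise : sys.NoiseAssumption P W S μw μs σw) (hx₀ : x₀ ∈ sys.𝕏)
    (hcontrol : sys.ControlAssumption b) {XPE XRPI : Set (Vec n)} {c p : ℝ} (hc : 0 ≤ c)
    (hp1 : p ≤ 1) (hexc : sys.RegionallyExcited μw μs XPE c p) (hΓ : sys.Γ b.uMax XRPI ⊆ XPE)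
    (N : ℕ) {ζ : Vec d} (hζ : ‖ζ‖ = 1) :
    ∃ B : Set Ω, P B ≤ ENNReal.ofReal (Real.exp (-(N * ((1 - Real.log 2) * p / 2)))) ∧
      ∀ ω ∉ B, (∀ k < N, X k ω ∈ XRPI) →
        N * (p / 2) * c ≤
          ∑ k ∈ Finset.range N, (inner ℝ ζ (sys.ψ (X (k + 1) ω) (U (k + 1) ω))) ^ 2 := by
  have hXm := h.state_mem hsys hx₀
  have hUm := h.control_mem hsys hx₀
  obtain ⟨hps, hpw⟩ := hnoise.isProbabilityMeasure_prod
  have hE := measurableSet_excitedSet hsys hmeas c ζ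
  set E := excitedSet sys c ζ with hEdef
  -- Pasts with too little conditional probability of excitation count as successes, so the
  -- conditional probability is at least `p` for every past. Membership in `XRPI`, which need not be
  -- measurable, does not enter the event.
  set D : Set ((sys.𝕏 × sys.𝕌 × Param d n) × (sys.𝕊 × sys.𝕎)) :=
    E ∪ {x | (μs.prod μw) (Prod.mk x.1 ⁻¹' E) < ENNReal.ofReal p} with hD
  have hDm : MeasurableSet D := hE.union
    (measurableSet_lt ((measurable_measure_prodMk_left hE).comp measurable_fst) measurable_const)
  set H : ℕ → Ω → sys.𝕏 × sys.𝕌 × Param d n := fun t ω =>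
    (⟨X t ω, hXm t ω⟩, ⟨U t ω, hUm t ω⟩, est t ω)
  set ξ : ℕ → Ω → sys.𝕊 × sys.𝕎 := fun t ω => (S (t + 1) ω, W (t + 1) ω)
  have hHF : ∀ t, ∀ s ≤ t, Measurable[noisePast W S t] (H s) := fun t s hs => by
    have hW : ∀ k < s, Measurable[noisePast W S t] (W (k + 1)) := fun k hk =>
      measurable_noisePast_left (hk.trans_le hs)
    have hS : ∀ k ≤ s, Measurable[noisePast W S t] (S k) := fun k hk =>
      measurable_noisePast_right (hk.trans hs)
    obtain ⟨h1, -, h3⟩ := h.measurable_aux hsys hmeas hx₀ s hW fun k hk => hS k hk.le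
    exact (h1 s le_rfl).subtype_mk.prodMk
      ((h.measurable_control hsys hmeas hx₀ s hW hS).subtype_mk.prodMk (h3 s le_rfl))
  refine ⟨_, measure_card_le_half_le_of_indep hnoise.noisePast_le (fun t => hHF t t le_rfl)
    (fun t => (hnoise.measurable_S _).prodMk (hnoise.measurable_W _ (by omega)))
    (ξ := ξ) (fun t s hs => ?_) hHF hnoise.indep_noisePast hDm (fun t a => ?_) N, ?_⟩
  · exact ((measurable_noisePast_right (V := W) (S := S) (Nat.succ_le_of_lt hs)).prodMk
      (measurable_noisePast_left hs)).comap_le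
  · rw [hnoise.map_prodMk]
    by_cases hlt : (μs.prod μw) (Prod.mk a ⁻¹' E) < ENNReal.ofReal p
    · have : {y | (a, y) ∈ D} = univ := eq_univ_of_forall fun y => Or.inr hlt
      rw [this, measure_univ]
      exact ENNReal.ofReal_le_one.2 hp1
    · exact (not_lt.1 hlt).trans (measure_mono fun y hy => Or.inl hy)
  · intro ω hω hX
    simp only [mem_ofPred_eq, not_le] at hω
    have hmem : ∀ k < N, (H k ω, ξ k ω) ∈ D →
        c ≤ (inner ℝ ζ (sys.ψ (X (k + 1) ω) (U (k + 1) ω))) ^ 2 := by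
      intro k hk hk'
      rcases hk' with hk' | hk'
      · rw [h.control (k + 1), h.step, ← sq_abs]
        exact hk'
      · have hlt : (μs.prod μw) (Prod.mk (H k ω) ⁻¹' E) < ENNReal.ofReal p := hk'
        refine absurd hlt (not_lt.2 ?_)
        -- From a state in `XRPI` the noise-free prediction lies in `XPE`, so the artificial
        -- successes in `D` do not occur.
        have hPE : sys.g (X k ω) (U k ω) 0 ∈ XPE := hΓ ⟨X k ω, hX k hk, U k ω, hUm k ω,
          h.norm_control_le hsys hx₀ hcontrol k ω, rfl⟩
        refine (hexc (est k ω) _ hPE ζ hζ).trans (measure_mono ?_)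
        rintro y ⟨-, hy⟩
        have e : sys.g (X k ω) (U k ω) 0 + (y.2 : Vec n) = sys.g (X k ω) (U k ω) y.2 := by
          simp [Sys.g]
        rw [e] at hy
        exact hy
    refine (mul_le_mul_of_nonneg_right hω.le hc).trans ?_
    rw [← nsmul_eq_mul, ← Finset.sum_const]
    refine (Finset.sum_le_sum fun k hk => ?_).trans (Finset.sum_le_sum_of_subset_of_nonneg
      (fun k hk => by simp only [Finset.mem_filter] at hk; exact hk.1) fun k _ _ => sq_nonneg _)
    simp only [Finset.mem_filter, Finset.mem_range] at hk
    exact hmem k hk.1 hk.2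

theorem inner_eq_dotProduct (x y : Vec d) : inner ℝ x y = x.ofLp ⬝ᵥ y.ofLp := by
  rw [EuclideanSpace.inner_eq_star_dotProduct, star_trivial, dotProduct_comm]

/-- Lower bounds of a quadratic form on a net of the unit sphere extend to all vectors. -/
theorem mul_dotProduct_le_sum_sq_of_net (z : ℕ → Fin d → ℝ) (t : ℕ) {R a : ℝ}
    (hR : ∑ s ∈ Finset.range t, z s ⬝ᵥ z s ≤ R) {N : Set (Vec d)} (hN : ∀ ζ ∈ N, ‖ζ‖ = 1)
    (hnet : ∀ ζ : Vec d, ‖ζ‖ = 1 → ∃ ζ' ∈ N, R * ‖ζ - ζ'‖ ≤ a)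
    (hlow : ∀ ζ ∈ N, 4 * a ≤ ∑ s ∈ Finset.range t, (ζ.ofLp ⬝ᵥ z s) ^ 2) (x : Fin d → ℝ) :
    2 * a * (x ⬝ᵥ x) ≤ ∑ s ∈ Finset.range t, (x ⬝ᵥ z s) ^ 2 := by
  have hunit : ∀ ζ : Vec d, ‖ζ‖ = 1 → 2 * a ≤ ∑ s ∈ Finset.range t, (ζ.ofLp ⬝ᵥ z s) ^ 2 := by
    intro ζ hζ
    obtain ⟨ζ', hζ', hd⟩ := hnet ζ hζ
    have h1 := hlow ζ' hζ'
    -- Factor the difference of squares. Summed over `s`, replacing a net point by `ζ` loses at most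
    -- `2 a` of the available `4 a`.
    have h2 : ∀ s, (ζ'.ofLp ⬝ᵥ z s) ^ 2 - (ζ.ofLp ⬝ᵥ z s) ^ 2 ≤
        2 * ‖ζ - ζ'‖ * (z s ⬝ᵥ z s) := by
      intro s
      set y : Vec d := WithLp.toLp 2 (z s) with hy
      have e1 : ∀ u : Vec d, u.ofLp ⬝ᵥ z s = inner ℝ u y := fun u => (inner_eq_dotProduct u y).symm
      have e2 : z s ⬝ᵥ z s = ‖y‖ ^ 2 := by
        rw [← real_inner_self_eq_norm_sq]; exact (inner_eq_dotProduct y y).symm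
      rw [e1, e1, e2]
      have e3 : (inner ℝ ζ' y : ℝ) ^ 2 - (inner ℝ ζ y) ^ 2 =
          inner ℝ (ζ' - ζ) y * inner ℝ (ζ' + ζ) y := by
        rw [inner_sub_left, inner_add_left]; ring
      rw [e3]
      have h3 : |inner ℝ (ζ' - ζ) y| ≤ ‖ζ - ζ'‖ * ‖y‖ := by
        rw [norm_sub_rev]; exact abs_real_inner_le_norm _ _
      have h4 : |inner ℝ (ζ' + ζ) y| ≤ 2 * ‖y‖ := by
        refine (abs_real_inner_le_norm _ _).trans (mul_le_mul_of_nonneg_right ?_ (norm_nonneg _))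
        refine (norm_add_le _ _).trans ?_
        rw [hN ζ' hζ', hζ]; norm_num
      calc _ ≤ |inner ℝ (ζ' - ζ) y| * |inner ℝ (ζ' + ζ) y| := by
            rw [← abs_mul]; exact le_abs_self _
        _ ≤ (‖ζ - ζ'‖ * ‖y‖) * (2 * ‖y‖) := by gcongr
        _ = _ := by ring
    have h3 := Finset.sum_le_sum fun s (_ : s ∈ Finset.range t) => h2 s
    rw [Finset.sum_sub_distrib, ← Finset.mul_sum] at h3
    have h4 : ‖ζ - ζ'‖ * ∑ s ∈ Finset.range t, z s ⬝ᵥ z s ≤ a := by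
      refine le_trans ?_ hd
      rw [mul_comm]
      exact mul_le_mul_of_nonneg_right hR (norm_nonneg _)
    linarith
  set y : Vec d := WithLp.toLp 2 x with hy
  have e2 : x ⬝ᵥ x = ‖y‖ ^ 2 := by
    rw [← real_inner_self_eq_norm_sq]; exact (inner_eq_dotProduct y y).symm
  rcases eq_or_ne y 0 with h0 | h0
  · rw [e2, h0]
    simpa using Finset.sum_nonneg fun s _ => sq_nonneg (x ⬝ᵥ z s)
  have hn : 0 < ‖y‖ := norm_pos_iff.2 h0
  have := hunit (‖y‖⁻¹ • y) (by rw [norm_smul, norm_inv, norm_norm, inv_mul_cancel₀ hn.ne'])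
  have e3 : ∀ s, ((‖y‖⁻¹ • y).ofLp ⬝ᵥ z s) ^ 2 = (‖y‖ ^ 2)⁻¹ * (x ⬝ᵥ z s) ^ 2 := fun s => by
    rw [WithLp.ofLp_smul, smul_dotProduct, smul_eq_mul, mul_pow, inv_pow]
  simp only [e3, ← Finset.mul_sum] at this
  rw [← div_eq_inv_mul, le_div_iff₀ (by positivity)] at this
  rwa [e2]

end Excitation

/-! ### Infima and suprema of times in `ℕ∞` -/

theorem exists_eq_sInf_natCast {Q : ℕ → Prop} (h : sInf {N : ℕ∞ | ∃ T : ℕ, N = T ∧ Q T} ≠ ⊤) :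
    ∃ T : ℕ, sInf {N : ℕ∞ | ∃ T : ℕ, N = T ∧ Q T} = T ∧ Q T := by
  have hne : {N : ℕ∞ | ∃ T : ℕ, N = T ∧ Q T}.Nonempty := by
    rw [nonempty_iff_ne_empty]
    intro h0
    rw [h0, sInf_empty] at h
    exact h rfl
  exact csInf_mem hne

theorem sInf_natCast_lt_top {Q : ℕ → Prop} {T : ℕ} (hT : Q T) :
    sInf {N : ℕ∞ | ∃ T : ℕ, N = T ∧ Q T} < ⊤ :=
  (sInf_le (show (T : ℕ∞) ∈ {N : ℕ∞ | ∃ T : ℕ, N = T ∧ Q T} from ⟨T, rfl, hT⟩)).trans_lt (WithTop.coe_lt_top T)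

/-- The supremum may be an unattained `∞`; but if every member were at most `k`, so would be the
supremum. -/
theorem exists_le_of_le_sSup_natCast {Q : ℕ → Prop} {k : ℕ}
    (h : ((k + 1 : ℕ) : ℕ∞) ≤ sSup {N : ℕ∞ | ∃ T : ℕ, N = T ∧ Q T}) : ∃ T, k + 1 ≤ T ∧ Q T := by
  by_contra! hcon
  have : sSup {N : ℕ∞ | ∃ T : ℕ, N = T ∧ Q T} ≤ (k : ℕ) := sSup_le fun N hN => by
    obtain ⟨T, rfl, hT⟩ := hN
    by_contra! hlt
    exact hcon T (by exact_mod_cast hlt) hT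
  have := h.trans this
  rw [Nat.cast_le] at this
  omega

/-! ### High-probability events and the error bound -/

section HighProbability

variable {Ω : Type*} {mΩ : MeasurableSpace Ω} {P : Measure Ω} [IsProbabilityMeasure P]
    {sys : Sys n m q d} {x₀ : Vec n} {b : Bounds}
    {W : ℕ → Ω → sys.𝕎} {S : ℕ → Ω → sys.𝕊}
    {X : ℕ → Ω → Vec n} {U : ℕ → Ω → Vec m} {est : ℕ → Ω → Param d n}
    {μw : Measure sys.𝕎} {μs : Measure sys.𝕊}

/-- Uniformly in time and over coordinates, the noise is dominated by the Gram matrix. -/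
theorem Sys.IsClosedLoop.measure_quadForm_gt_le (h : sys.IsClosedLoop x₀ W S X U est)
    (hn : 1 ≤ n) (hsys : sys.WellPosed) (hmeas : sys.MeasurableMaps)
    (hnoise : sys.NoiseAssumption P W S μw μs b.σw) (hx₀ : x₀ ∈ sys.𝕏) {δ : ℝ} (hδ : 0 < δ) :
    P {ω | ∃ j t, 2 * (b.σw : ℝ) ^ 2 * (Real.log (3 * n / δ) + 1 / 2 *
        Real.log ((gram sys.γ (regressor sys X U ω) t).det / sys.γ ^ d)) <
      noiseSum (regressor sys X U ω) (noiseCoord W j ω) t ⬝ᵥ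
        ((gram sys.γ (regressor sys X U ω) t)⁻¹ *ᵥ
          noiseSum (regressor sys X U ω) (noiseCoord W j ω) t)} ≤ ENNReal.ofReal (δ / 3) := by
  have hn0 : (0 : ℝ) < n := by exact_mod_cast hn
  have hcoord : ∀ j : Fin n, Measurable fun w : sys.𝕎 => (w : Vec n) j := fun j =>
    (measurable_pi_apply j).comp ((WithLp.measurable_ofLp 2 _).comp measurable_subtype_coe)
  -- Each of the `n` coordinates receives the share `δ / (3 n)` of the budget `δ / 3`.
  have hj : ∀ j : Fin n, P {ω | ∃ t, 2 * (b.σw : ℝ) ^ 2 * (Real.log (1 / (δ / (3 * n))) + 1 / 2 *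
        Real.log ((gram sys.γ (regressor sys X U ω) t).det / sys.γ ^ Fintype.card (Fin d))) <
      noiseSum (regressor sys X U ω) (noiseCoord W j ω) t ⬝ᵥ
        ((gram sys.γ (regressor sys X U ω) t)⁻¹ *ᵥ
          noiseSum (regressor sys X U ω) (noiseCoord W j ω) t)} ≤
      ENNReal.ofReal (δ / (3 * n)) := fun j => by
    refine measure_exists_quadForm_gt_le (F := noisePast W S) hnoise.noisePast_le
      (fun t s hs => ?_) (fun t s hs => ?_) (fun t => ?_) (fun t => ?_) hsys.γ_pos (by positivity)
    · exact h.measurable_regressor hsys hmeas hx₀ s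
        (fun k hk => measurable_noisePast_left (hk.trans_le hs))
        (fun k hk => measurable_noisePast_right (hk.trans hs))
    · exact (hcoord j).comp (measurable_noisePast_left hs)
    · refine indep_of_indep_of_le_right (hnoise.indep_noisePast t) ?_
      exact ((hcoord j).comp (measurable_snd.comp
        (comap_measurable fun ω => (S (t + 1) ω, W (t + 1) ω)))).comap_le
    · exact hasSubgaussianMGF_coord (hnoise.subgaussian (t + 1) (by omega)) j
  refine (measure_mono (t := ⋃ j, {ω | ∃ t, 2 * (b.σw : ℝ) ^ 2 *
    (Real.log (1 / (δ / (3 * n))) + 1 / 2 *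
        Real.log ((gram sys.γ (regressor sys X U ω) t).det / sys.γ ^ Fintype.card (Fin d))) <
      noiseSum (regressor sys X U ω) (noiseCoord W j ω) t ⬝ᵥ
        ((gram sys.γ (regressor sys X U ω) t)⁻¹ *ᵥ
          noiseSum (regressor sys X U ω) (noiseCoord W j ω) t)}) ?_).trans ?_
  · rintro ω ⟨j, t, ht⟩
    refine mem_iUnion.2 ⟨j, t, ?_⟩
    rwa [one_div_div, Fintype.card_fin]
  · refine (measure_iUnion_le _).trans ?_
    rw [tsum_fintype]
    refine (Finset.sum_le_sum fun j _ => hj j).trans_eq ?_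
    rw [Finset.sum_const, Finset.card_univ, Fintype.card_fin, nsmul_eq_mul,
      ← ENNReal.ofReal_natCast, ← ENNReal.ofReal_mul hn0.le]
    congr 1
    field_simp

/-- The regressors are persistently exciting after the burn-in time, as long as the state has
stayed in `XRPI`. -/
theorem Sys.IsClosedLoop.exists_excitation_failure_uniform (h : sys.IsClosedLoop x₀ W S X U est)
    (hd : 1 ≤ d) (hsys : sys.WellPosed) (hmeas : sys.MeasurableMaps)
    (hnoise : sys.NoiseAssumption P W S μw μs b.σw) (hx₀ : x₀ ∈ sys.𝕏)
    (hcontrol : sys.ControlAssumption b) {XPE XRPI : Set (Vec n)} {c p : ℝ} (hc : 0 < c)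
    (hp : 0 < p) (hp1 : p ≤ 1) (hexc : sys.RegionallyExcited μw μs XPE c p)
    (hΓ : sys.Γ b.uMax XRPI ⊆ XPE) {δ : ℝ} (hδ : 0 < δ) {T : ℕ} (hT : 2 ≤ T)
    (hburn : ∀ t, T ≤ t → BurnInIneq d b c p T t δ x₀) :
    ∃ B : Set Ω, P B ≤ ENNReal.ofReal (δ / 3) ∧ ∀ ω ∉ B, ∀ t, T ≤ t →
      (∀ k < t - 1, X k ω ∈ XRPI) →
      ∑ s ∈ Finset.range t, regressor sys X U ω s ⬝ᵥ regressor sys X U ω s ≤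
        ∑ i ∈ Finset.Icc 1 t, zBar b i (δ / 3) x₀ ^ 2 →
      ∀ x : Fin d → ℝ, c * p / 4 * ((t : ℝ) - 1) * (x ⬝ᵥ x) ≤
        ∑ s ∈ Finset.range t, (x ⬝ᵥ regressor sys X U ω s) ^ 2 := by
  have : Nontrivial (Vec d) := by
    have : Nonempty (Fin d) := ⟨⟨0, hd⟩⟩
    infer_instance
  have htpos : ∀ k : ℕ, (0 : ℝ) < ((T + k : ℕ) : ℝ) - 1 := fun k => by
    have : (2 : ℝ) ≤ ((T + k : ℕ) : ℝ) := by exact_mod_cast (by omega : 2 ≤ T + k)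
    linarith
  -- For `t = T + k`, this `a` makes `4 a = (t - 1) (p / 2) c`, the lower bound in a fixed
  -- direction, and `2 a` the constant in the conclusion. The ratio `2 R / a` gives the factor 16 in
  -- the burn-in inequality.
  have hnet := fun k : ℕ => exists_finset_unit_net (E := Vec d)
    (R := ∑ i ∈ Finset.Icc 1 (T + k), zBar b i (δ / 3) x₀ ^ 2)
    (a := c * p * (((T + k : ℕ) : ℝ) - 1) / 8) (Finset.sum_nonneg fun i _ => sq_nonneg _)
    (by have := htpos k; positivity)
  choose N hN1 hNcard hNcov using hnet
  -- There are `t - 1` trials, for the regressors at times `1, …, t - 1`. The regressor at time 0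
  -- follows no prediction step; its nonnegative contribution is dropped.
  have hB := fun (k : ℕ) (ζ : {ζ // ζ ∈ N k}) => h.exists_excitation_failure hsys hmeas hnoise hx₀
    hcontrol hc.le hp1 hexc hΓ (T + k - 1) (hN1 k ζ ζ.2)
  choose B hBP hBω using hB
  refine ⟨⋃ k, ⋃ ζ, B k ζ, ?_, fun ω hω t ht hX hR x => ?_⟩
  · refine (measure_iUnion_le _).trans ?_
    -- Over `k` these shares sum to `δ / 3`.
    have hk : ∀ k, P (⋃ ζ, B k ζ) ≤
        ENNReal.ofReal ((2 * δ / Real.pi ^ 2) / ((k : ℝ) + 1) ^ 2) := by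
      intro k
      refine (measure_iUnion_le _).trans ?_
      rw [tsum_fintype]
      refine (Finset.sum_le_sum fun ζ _ => hBP k ζ).trans ?_
      rw [Finset.sum_const, Finset.card_univ, Fintype.card_coe, nsmul_eq_mul,
        ← ENNReal.ofReal_natCast, ← ENNReal.ofReal_mul (Nat.cast_nonneg _)]
      refine ENNReal.ofReal_le_ofReal ?_
      have hcard := hNcard k
      rw [finrank_euclideanSpace_fin] at hcard
      have hb := hburn (T + k) (by omega)
      have hpos := htpos k
      have hl2 := one_sub_log_two_pos
      rw [BurnInIneq] at hb
      rw [show 2 * (∑ i ∈ Finset.Icc 1 (T + k), zBar b i (δ / 3) x₀ ^ 2) /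
        (c * p * (((T + k : ℕ) : ℝ) - 1) / 8) =
        16 * (∑ i ∈ Finset.Icc 1 (T + k), zBar b i (δ / 3) x₀ ^ 2) /
          (c * p * (((T + k : ℕ) : ℝ) - 1)) by field_simp; ring] at hcard
      set Q := 1 + 16 * (∑ i ∈ Finset.Icc 1 (T + k), zBar b i (δ / 3) x₀ ^ 2) /
          (c * p * (((T + k : ℕ) : ℝ) - 1)) with hQ
      have hQ0 : 0 < Q := by
        have : 0 ≤ 16 * (∑ i ∈ Finset.Icc 1 (T + k), zBar b i (δ / 3) x₀ ^ 2) /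
          (c * p * (((T + k : ℕ) : ℝ) - 1)) := div_nonneg (mul_nonneg (by norm_num)
            (Finset.sum_nonneg fun i _ => sq_nonneg _)) (by positivity)
        linarith
      have e1 : ((T + k : ℕ) : ℝ) - T + 1 = (k : ℝ) + 1 := by push_cast; ring
      have e2 : ((T + k - 1 : ℕ) : ℝ) = ((T + k : ℕ) : ℝ) - 1 := by
        rw [Nat.cast_sub (by omega)]; simp
      rw [e1] at hb
      rw [e2]
      have h1 : d * Real.log Q + Real.log (Real.pi ^ 2 * ((k : ℝ) + 1) ^ 2 / (2 * δ)) ≤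
          (((T + k : ℕ) : ℝ) - 1) * ((1 - Real.log 2) * p / 2) := by
        have h2 : 2 / ((1 - Real.log 2) * p) *
            (d * Real.log Q + Real.log (Real.pi ^ 2 * ((k : ℝ) + 1) ^ 2 / (2 * δ))) ≤
            ((T + k : ℕ) : ℝ) - 1 := by linarith
        calc _ = 2 / ((1 - Real.log 2) * p) *
            (d * Real.log Q + Real.log (Real.pi ^ 2 * ((k : ℝ) + 1) ^ 2 / (2 * δ))) *
              ((1 - Real.log 2) * p / 2) := by field_simp
          _ ≤ _ := mul_le_mul_of_nonneg_right h2 (by positivity)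
      -- The burn-in inequality bounds the Chernoff exponent from below, so that `exp (-d log Q)`
      -- absorbs the net size `Q ^ d` and the share of time `T + k` remains.
      calc (N k).card * Real.exp (-((((T + k : ℕ) : ℝ) - 1) * ((1 - Real.log 2) * p / 2)))
          ≤ Q ^ d * Real.exp (-(d * Real.log Q +
            Real.log (Real.pi ^ 2 * ((k : ℝ) + 1) ^ 2 / (2 * δ)))) := by
            gcongr
        _ = _ := by
            rw [neg_add, Real.exp_add, Real.exp_neg, Real.exp_neg, Real.exp_nat_mul,
              Real.exp_log hQ0, Real.exp_log (by positivity)]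
            field_simp
    refine (ENNReal.tsum_le_tsum hk).trans_eq ?_
    rw [tsum_ofReal_div_sq (by positivity)]
    congr 1
    field_simp
    norm_num
  · obtain ⟨k, rfl⟩ := Nat.exists_eq_add_of_le ht
    have hpos := htpos k
    simp only [mem_iUnion, not_exists] at hω
    have := mul_dotProduct_le_sum_sq_of_net (regressor sys X U ω) (T + k) hR
      (N := {ζ | ζ ∈ N k}) (hN1 k) (hNcov k) (fun ζ hζ => ?_) x
    · refine le_of_eq_of_le ?_ this
      ring
    · have h1 := hBω k ⟨ζ, hζ⟩ ω (hω k ⟨ζ, hζ⟩) hX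
      have e2 : ((T + k - 1 : ℕ) : ℝ) = ((T + k : ℕ) : ℝ) - 1 := by
        rw [Nat.cast_sub (by omega)]; simp
      rw [e2] at h1
      simp only [inner_eq_dotProduct] at h1
      have h2 : ∑ s ∈ Finset.range (T + k), (ζ.ofLp ⬝ᵥ regressor sys X U ω s) ^ 2 =
          ∑ s ∈ Finset.range (T + k - 1), (ζ.ofLp ⬝ᵥ regressor sys X U ω (s + 1)) ^ 2 +
            (ζ.ofLp ⬝ᵥ regressor sys X U ω 0) ^ 2 := by
        conv_lhs => rw [show T + k = (T + k - 1) + 1 by omega]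
        rw [Finset.sum_range_succ']
      rw [h2]
      have h3 := sq_nonneg (ζ.ofLp ⬝ᵥ regressor sys X U ω 0)
      linarith

/-- The bound `det G ≤ β_max ^ d` replaces the random determinant by a deterministic quantity common
to all `n` columns. -/
theorem Sys.IsClosedLoop.specNorm_error_le_errBound (h : sys.IsClosedLoop x₀ W S X U est)
    (hγ : 0 < sys.γ) {c p δ : ℝ} (hc : 0 < c) (hp : 0 < p) {t : ℕ} (ht : 1 ≤ t) {ω : Ω}
    (hR : ∑ s ∈ Finset.range t, regressor sys X U ω s ⬝ᵥ regressor sys X U ω s ≤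
        ∑ i ∈ Finset.Icc 1 t, zBar b i (δ / 3) x₀ ^ 2)
    (hexc : ∀ x : Fin d → ℝ, c * p / 4 * ((t : ℝ) - 1) * (x ⬝ᵥ x) ≤
        ∑ s ∈ Finset.range t, (x ⬝ᵥ regressor sys X U ω s) ^ 2)
    (hq : ∀ j, noiseSum (regressor sys X U ω) (noiseCoord W j ω) t ⬝ᵥ
        ((gram sys.γ (regressor sys X U ω) t)⁻¹ *ᵥ
          noiseSum (regressor sys X U ω) (noiseCoord W j ω) t) ≤
      2 * (b.σw : ℝ) ^ 2 * (Real.log (3 * n / δ) + 1 / 2 *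
        Real.log ((gram sys.γ (regressor sys X U ω) t).det / sys.γ ^ d))) :
    specNorm (est t ω - sys.θstar) ≤ errBound sys b c p t δ x₀ := by
  have ht' : (1 : ℝ) ≤ t := by exact_mod_cast ht
  have hdet := det_gram_le hγ (regressor sys X U ω) t (add_le_add_left hR sys.γ)
  rw [Fintype.card_fin] at hdet
  change _ ≤ betaMax b sys.γ t (δ / 3) x₀ ^ d at hdet
  have hpos := (gram_posDef hγ (regressor sys X U ω) t).det_pos
  have hlog : Real.log ((gram sys.γ (regressor sys X U ω) t).det / sys.γ ^ d) ≤
      d * Real.log (betaMax b sys.γ t (δ / 3) x₀ * sys.γ⁻¹) := by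
    rw [← Real.log_pow, mul_pow, inv_pow, ← div_eq_mul_inv]
    exact Real.log_le_log (by positivity) (by gcongr)
  have := h.specNorm_error_le hγ ht ω (l := c * p / 4 * ((t : ℝ) - 1))
    (K := 2 * (b.σw : ℝ) ^ 2 * (Real.log (3 * n / δ) +
        (d : ℝ) / 2 * Real.log (betaMax b sys.γ t (δ / 3) x₀ * sys.γ⁻¹)))
    (mul_nonneg (by positivity) (by linarith)) hexc (fun j => (hq j).trans ?_)
  · refine this.trans_eq ?_
    rw [errBound]
    congr 2
    rw [show ∀ a s c : ℝ, a * (2 * s ^ 2 * c) = s ^ 2 * (2 * a * c) from fun a s c => by ring,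
      Real.sqrt_mul (sq_nonneg _), Real.sqrt_sq b.σw.coe_nonneg]
  · refine mul_le_mul_of_nonneg_left (add_le_add le_rfl ?_) (by positivity)
    linarith

end HighProbability

end AdaptiveControl

/-! ### The main theorem -/

open AdaptiveControl
theorem theorem1 {n m q d : ℕ} (hn : 1 ≤ n) (hd : 1 ≤ d)
    {Ω : Type*} [MeasurableSpace Ω] (P : Measure Ω) [IsProbabilityMeasure P]
    (sys : Sys n m q d) (b : Bounds)
    (W : ℕ → Ω → sys.𝕎) (S : ℕ → Ω → sys.𝕊)
    (μw : Measure sys.𝕎) (μs : Measure sys.𝕊)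
    (XPE XRPI : Set (Vec n)) (cPE pPE ϑbar : ℝ)
    (hsys : sys.WellPosed)
    (hmeas : sys.MeasurableMaps)
    (hnoise : sys.NoiseAssumption P W S μw μs b.σw)
    (hreach : sys.ReachAssumption b)
    (hcontrol : sys.ControlAssumption b)
    (hbasis : sys.BasisAssumption b)
    (hXPE : XPE ⊆ sys.𝕏) (hcPE : 0 < cPE) (hpPE : 0 < pPE)
    (hexc : sys.RegionallyExcited μw μs XPE cPE pPE)
    (hXRPI : XRPI ⊆ sys.𝕏) (hϑbar : 0 < ϑbar)
    (hRPI : sys.IsRPI XRPI ϑbar)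
    (hΓ : sys.Γ b.uMax XRPI ⊆ XPE)
    (x₀ : Vec n) (hx₀ : x₀ ∈ XRPI) (δ : ℝ) (hδ : δ ∈ Ioo (0 : ℝ) 1) :
    (Tconverge sys b cPE pPE ϑbar δ x₀ + 1 ≤ Tcontained sys b XRPI δ x₀ →
      ∀ (X : ℕ → Ω → Vec n) (U : ℕ → Ω → Vec m) (est : ℕ → Ω → Param d n),
        sys.IsClosedLoop x₀ W S X U est →
        -- the event below contains a measurable set of probability at least `1 - δ`
        ∃ A : Set Ω, MeasurableSet A ∧ ENNReal.ofReal (1 - δ) ≤ P A ∧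
          A ⊆ {ω | (∀ t : ℕ, TburnIn d b cPE pPE δ x₀ ≤ (t : ℕ∞) →
                specNorm (est t ω - sys.θstar) ≤ errBound sys b cPE pPE t δ x₀) ∧
              (∀ t : ℕ, X t ω ∈ XRPI)}) ∧
    Tendsto (fun t : ℕ => errBound sys b cPE pPE t δ x₀) atTop (𝓝 0) ∧
    TburnIn d b cPE pPE δ x₀ < ⊤ ∧
    Tconverge sys b cPE pPE ϑbar δ x₀ < ⊤ := by
  obtain ⟨hδ0, hδ1⟩ := hδ
  have hδ3 : 0 < δ / 3 := by positivity
  have hu := hcontrol.uMax_nonneg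
  have hx₀' := hXRPI hx₀
  have hlim := tendsto_errBound hn hsys.γ_pos hreach hu hbasis hδ0 hcPE hpPE x₀
  obtain ⟨T₁, hT₁⟩ := exists_burnInIneq (d := d) hn hreach hu hbasis hδ0 hcPE hpPE x₀
  have hburn : TburnIn d b cPE pPE δ x₀ < ⊤ := sInf_natCast_lt_top hT₁
  obtain ⟨T₂, hT₂⟩ := eventually_atTop.1 (hlim.eventually_le_const hϑbar)
  have hconv : sInf {N : ℕ∞ | ∃ T : ℕ, N = T ∧ 1 ≤ T ∧
      ∀ t : ℕ, T ≤ t → errBound sys b cPE pPE t δ x₀ ≤ ϑbar} < ⊤ :=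
    sInf_natCast_lt_top (T := max T₂ 1)
      ⟨le_max_right _ _, fun t ht => hT₂ t ((le_max_left _ _).trans ht)⟩
  refine ⟨?_, hlim, hburn, max_lt hburn hconv⟩
  intro hcond X U est h
  obtain ⟨Tb, hTb, hTb1, hTbI⟩ := exists_eq_sInf_natCast hburn.ne
  obtain ⟨Te, hTe, hTe1, hTeI⟩ := exists_eq_sInf_natCast hconv.ne
  have hTc : Tconverge sys b cPE pPE ϑbar δ x₀ = ((max Tb Te : ℕ) : ℕ∞) := by
    rw [Tconverge, TburnIn, hTb, hTe]; rfl
  rw [hTc] at hcond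
  obtain ⟨Tin, hTin, -, hTinI⟩ := exists_le_of_le_sSup_natCast (k := max Tb Te)
    (by push_cast; exact hcond)
  -- `pPE` bounds a probability from below, provided `XPE` has a point (the prediction from `x₀`)
  -- and `ℝ^d` has a unit vector.
  have hp1 : pPE ≤ 1 := by
    obtain ⟨hps, hpw⟩ := hnoise.isProbabilityMeasure_prod
    obtain ⟨ω⟩ : Nonempty Ω := P.nonempty_of_neZero
    have hPE : sys.g (X 0 ω) (U 0 ω) 0 ∈ XPE := hΓ ⟨X 0 ω, by rw [h.init]; exact hx₀, U 0 ω,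
      h.control_mem hsys hx₀' 0 ω, h.norm_control_le hsys hx₀' hcontrol 0 ω, rfl⟩
    have h1 := (hexc 0 _ hPE (EuclideanSpace.single ⟨0, hd⟩ 1) (by simp)).trans prob_le_one
    exact ENNReal.ofReal_le_one.1 h1
  -- At `t = T = 1` division by 0 gives 0, so the first logarithm vanishes and the inequality would
  -- read `1 ≥ 1 +` a positive number.
  have hTb2 : 2 ≤ Tb := by
    by_contra hlt
    obtain rfl : Tb = 1 := by omega
    have h1 := hTbI 1 le_rfl
    have hl2 := one_sub_log_two_pos
    rw [BurnInIneq] at h1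
    norm_num at h1
    have h2 : 0 < Real.log (Real.pi ^ 2 / (2 * δ)) := by
      refine Real.log_pos ?_
      rw [one_lt_div (by positivity)]
      nlinarith [Real.pi_gt_three]
    have h3 : 0 < 2 / ((1 - Real.log 2) * pPE) * Real.log (Real.pi ^ 2 / (2 * δ)) := by positivity
    linarith
  obtain ⟨B₃, hB₃, hB₃ω⟩ := h.exists_excitation_failure_uniform hd hsys hmeas hnoise hx₀' hcontrol
    hcPE hpPE hp1 hexc hΓ hδ0 hTb2 hTbI
  have hB₁ := measure_exists_norm_gt_wBar_le (P := P) (w := fun t ω => (W t ω : Vec n)) hn b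
    hnoise.subgaussian hδ3 (by linarith)
  have hB₂ := h.measure_quadForm_gt_le hn hsys hmeas hnoise hx₀' hδ0
  set B₁ := {ω | ∃ t, 1 ≤ t ∧ wBar n b t (δ / 3) < ‖(W t ω : Vec n)‖}
  set B₂ := {ω | ∃ j t, 2 * (b.σw : ℝ) ^ 2 * (Real.log (3 * n / δ) + 1 / 2 *
        Real.log ((gram sys.γ (regressor sys X U ω) t).det / sys.γ ^ d)) <
      noiseSum (regressor sys X U ω) (noiseCoord W j ω) t ⬝ᵥ
        ((gram sys.γ (regressor sys X U ω) t)⁻¹ *ᵥ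
          noiseSum (regressor sys X U ω) (noiseCoord W j ω) t)}
  -- The bad set is replaced by a measurable hull, whose complement serves as `A`.
  have hB : P (toMeasurable P (B₁ ∪ B₂ ∪ B₃)) ≤ ENNReal.ofReal δ := by
    rw [measure_toMeasurable]
    calc P (B₁ ∪ B₂ ∪ B₃) ≤ P B₁ + P B₂ + P B₃ :=
          (measure_union_le _ _).trans (add_le_add (measure_union_le _ _) le_rfl)
      _ ≤ ENNReal.ofReal (δ / 3) + ENNReal.ofReal (δ / 3) + ENNReal.ofReal (δ / 3) := by gcongr
      _ = ENNReal.ofReal δ := by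
          rw [← ENNReal.ofReal_add hδ3.le hδ3.le, ← ENNReal.ofReal_add (by positivity) hδ3.le]
          congr 1; ring
  have hm := measurableSet_toMeasurable P (B₁ ∪ B₂ ∪ B₃)
  refine ⟨(toMeasurable P (B₁ ∪ B₂ ∪ B₃))ᶜ, hm.compl, ?_, fun ω hω => ?_⟩
  · rw [prob_compl_eq_one_sub hm, ENNReal.ofReal_sub _ hδ0.le, ENNReal.ofReal_one]
    exact tsub_le_tsub_left hB _
  have hω' : ω ∉ B₁ ∪ B₂ ∪ B₃ := fun hmem => hω (subset_toMeasurable P _ hmem)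
  rw [mem_union, mem_union, not_or, not_or] at hω'
  obtain ⟨⟨hω₁, hω₂⟩, hω₃⟩ := hω'
  have hw : ∀ t, 1 ≤ t → ‖(W t ω : Vec n)‖ ≤ wBar n b t (δ / 3) := fun t ht =>
    not_lt.1 fun hlt => hω₁ ⟨t, ht, hlt⟩
  have hR := h.sum_regressor_sq_le hn hsys hx₀' hreach hcontrol hbasis hδ3 hw
  -- The bound at time `t` refers to states only up to time `t - 2`; this makes the induction below
  -- well-founded.
  have herr : ∀ t, Tb ≤ t → (∀ k < t - 1, X k ω ∈ XRPI) →
      specNorm (est t ω - sys.θstar) ≤ errBound sys b cPE pPE t δ x₀ := fun t ht hX =>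
    h.specNorm_error_le_errBound hsys.γ_pos hcPE hpPE (by omega) (hR t)
      (hB₃ω ω hω₃ t ht hX (hR t)) fun j => not_lt.1 fun hlt => hω₂ ⟨j, t, hlt⟩
  have hinv : ∀ t, ∀ s ≤ t, X s ω ∈ XRPI := by
    intro t
    induction t with
    | zero =>
      intro s hs
      obtain rfl : s = 0 := by omega
      rw [h.init]; exact hx₀
    | succ t ih =>
      intro s hs
      rcases Nat.le_succ_iff.1 hs with hs | rfl
      · exact ih s hs
      -- Up to `Tin` the state bound alone keeps the state in `XRPI`. Afterwards `t ≥ Tin ≥ max Tb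
      -- Te + 1`, so `est (t - 1)`, the estimate used in the control at time `t`, is within `ϑbar`
      -- of the true parameter and invariance applies.
      by_cases hcase : t + 1 ≤ Tin
      · refine hTinI ⟨?_, h.state_mem hsys hx₀' _ ω⟩
        rw [mem_closedBall_zero_iff]
        exact (h.norm_state_le hn hsys hx₀' hreach hcontrol hδ3 hw (t + 1)).trans
          (xBar_mono hn hreach hu hδ3 x₀ hcase)
      · have hTbt : Tb ≤ t - 1 := by have := le_max_left Tb Te; omega
        have hTet : Te ≤ t - 1 := by have := le_max_right Tb Te; omega
        rw [h.step, h.control]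
        exact hRPI _ (ih t le_rfl) _ (W (t + 1) ω).2 _ (S t ω).2 _
          ((herr (t - 1) hTbt fun k hk => ih k (by omega)).trans (hTeI _ hTet))
  refine ⟨fun t ht => herr t ?_ fun k _ => hinv k k le_rfl, fun t => hinv t t le_rfl⟩
  rw [TburnIn, hTb] at ht
  exact_mod_cast ht
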